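/- Let $M$ be a compact, simply connected (in particular connected) smooth manifold of dimension $n\ge 2$ with non-empty boundary $\partial M$. A Finsler norm $F$ on $M$ is called \emph{admissible} if for all $x,x'\in\partial M$ there is exactly one geodesic of $F$ of finite length going from $x$ to $x'$ (up to affine orientation preserving reparametrization; constant curves count as geodesics, so for $x=x'$ the only one is the constant curve). In that case the \emph{boundary distance data} $d_F:\partial M\times\partial M\to[0,\infty)$ is defined by $d_F(x,x')=L_F(\gamma)=\int F(\gamma,\dot\gamma)\,dt$, where $\gamma$ is this geodesic. For a Riemannian metric $g$ put $F_g(x,y)=\sqrt{g_x(y,y)}$ and $d_g=d_{F_g}$, and call $g$ admissible if $F_g$ is. For $i\in\{1,2\}$ let $g_i$ be a smooth admissible Riemannian metric on $M$ and $\beta_i$ a smooth closed 1-form with $\|\beta_i\|_{g_i}:=\sup_{x\in M}\sup\{\beta_i(y): y\in T_xM,\ F_{g_i}(x,y)=1\}<1$, and suppose that the Randers metric $F_i=F_{g_i}+\beta_i$ is admissible. Assume that $(M,g_1)$ and $(M,g_2)$ are boundary rigid, that is: if $d_{g_1}=d_{g_2}$ on $\partial M\times\partial M$, then $g_2=\Psi^*g_1$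 for some diffeomorphism $\Psi:M\to M$ with $\Psi|_{\partial M}=\mathrm{Id}$. Then the following are equivalent: (a) $d_{F_1}(x,x')=d_{F_2}(x,x')$ for all $x,x'\in\partial M$. (b) There is a unique smooth function $\phi:M\to\mathbb{R}$ with $\phi|_{\partial M}=0$ for which there exists a diffeomorphism $\Psi:M\to M$ with $\Psi|_{\partial M}=\mathrm{Id}$ such that $\beta_2=\beta_1+d\phi$ and $g_2=\Psi^*g_1$. (c) There is a unique smooth function $\phi:M\to\mathbb{R}$ with $\phi|_{\partial M}=0$ for which there exists a diffeomorphism $\Psi:M\to M$ with $\Psi|_{\partial M}=\mathrm{Id}$ such that $\beta_2=\Psi^*\beta_1+d\phi$ and $g_2=\Psi^*g_1$. Moreover, whenever $\phi$ and $\Psi$ are as in (c), $F_2=\Psi^*F_1+d\phi$, i.e. $F_1$ and $F_2$ are almost isometric. -/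

import Mathlib

open Set Bundle
open scoped Manifold ContDiff Topology ENNReal

noncomputable section

namespace Randers

/-! Throughout, a smooth `n`-dimensional manifold with boundary is modelled on the Euclidean
half-space by the model with corners `𝓡∂ n`. A (possibly non-reversible) norm on the tangent bundle
is a function `F` of a point `x` and a tangent vector `y` at `x`. -/

section Basic

variable (n : ℕ) [NeZero n] (M : Type*) [TopologicalSpace M] [ChartedSpace (EuclideanHalfSpace n) M]

/-- Functions on the tangent bundle, `F x y` with `y ∈ T_x M`. -/
abbrev TangentFun : Type _ := (x : M) → TangentSpace (𝓡∂ n) x → ℝ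

/-- Smooth Riemannian metrics on `M`. -/
abbrev Metric [IsManifold (𝓡∂ n) ∞ M] : Type _ :=
  ContMDiffRiemannianMetric (𝓡∂ n) ∞ (EuclideanSpace ℝ (Fin n))
    (fun x : M ↦ TangentSpace (𝓡∂ n) x)

/-- Smooth 1-forms: smooth sections of the cotangent bundle. -/
structure OneForm [IsManifold (𝓡∂ n) ∞ M] where
  /-- The covector at each point. -/
  toFun (x : M) : TangentSpace (𝓡∂ n) x →L[ℝ] ℝ
  contMDiff : ContMDiff (𝓡∂ n) ((𝓡∂ n).prod 𝓘(ℝ, EuclideanSpace ℝ (Fin n) →L[ℝ] ℝ)) ∞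
    (fun x ↦ TotalSpace.mk' (EuclideanSpace ℝ (Fin n) →L[ℝ] ℝ)
      (E := fun x : M ↦ TangentSpace (𝓡∂ n) x →L[ℝ] ℝ) x (toFun x))

end Basic

variable {n : ℕ} [NeZero n] {M : Type*} [TopologicalSpace M]
  [ChartedSpace (EuclideanHalfSpace n) M]

/-! ### Local coordinates -/

/-- The `i`-th coordinate vector of `ℝⁿ`. -/
def coordVec (i : Fin n) : EuclideanSpace ℝ (Fin n) := EuclideanSpace.single i 1

/-- The tangent vector with components `v` in the chart `e`, at the point with coordinates `u`. -/
def tangentOf (e : OpenPartialHomeomorph M (EuclideanHalfSpace n))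
    (u v : EuclideanSpace ℝ (Fin n)) : TangentSpace (𝓡∂ n) ((e.extend (𝓡∂ n)).symm u) :=
  mfderivWithin 𝓘(ℝ, EuclideanSpace ℝ (Fin n)) (𝓡∂ n) (e.extend (𝓡∂ n)).symm
    (range (𝓡∂ n)) u v

/-- The function `F²` in the coordinates `(x, y)` induced by the chart `e` on the tangent bundle. -/
def localSq (F : TangentFun n M) (e : OpenPartialHomeomorph M (EuclideanHalfSpace n))
    (u v : EuclideanSpace ℝ (Fin n)) : ℝ :=
  F ((e.extend (𝓡∂ n)).symm u) (tangentOf e u v) ^ 2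

/-- The partial derivative `∂f/∂xᵏ` (one-sided at the boundary of the half-space). -/
def partialX (k : Fin n) (f : EuclideanSpace ℝ (Fin n) → EuclideanSpace ℝ (Fin n) → ℝ)
    (u v : EuclideanSpace ℝ (Fin n)) : ℝ :=
  fderivWithin ℝ (fun z ↦ f z v) (range (𝓡∂ n)) u (coordVec k)

/-- The partial derivative `∂f/∂yˡ`. -/
def partialY (l : Fin n) (f : EuclideanSpace ℝ (Fin n) → EuclideanSpace ℝ (Fin n) → ℝ)
    (u v : EuclideanSpace ℝ (Fin n)) : ℝ :=
  fderiv ℝ (fun w ↦ f u w) v (coordVec l)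

/-- The local metric `g_{ij}(x, y) = ½ ∂²F²/∂yⁱ∂yʲ` in the chart `e`. -/
def localMetric (F : TangentFun n M) (e : OpenPartialHomeomorph M (EuclideanHalfSpace n))
    (u v : EuclideanSpace ℝ (Fin n)) : Matrix (Fin n) (Fin n) ℝ :=
  Matrix.of fun i j ↦ (1 / 2) * partialY i (partialY j (localSq F e)) u v

/-- The spray coefficients `Gⁱ = ¼ gⁱˡ (yᵏ ∂²F²/∂xᵏ∂yˡ - ∂F²/∂xˡ)` in the chart `e`. When `F`
vanishes on zero vectors, the bracket is `0` at `y = 0`, so there the formula returns the value `0`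
of the continuous extension of the coefficients, whatever the matrix is. -/
def spray (F : TangentFun n M) (e : OpenPartialHomeomorph M (EuclideanHalfSpace n))
    (i : Fin n) (u v : EuclideanSpace ℝ (Fin n)) : ℝ :=
  (1 / 4) * ∑ l, (localMetric F e u v)⁻¹ i l *
    ((∑ k, v k * partialX k (partialY l (localSq F e)) u v) - partialX l (localSq F e) u v)

/-! ### Geodesics, length, boundary distance data -/

/-- The coordinate expression of a curve in the chart `e`. -/
def localCurve (e : OpenPartialHomeomorph M (EuclideanHalfSpace n)) (γ : ℝ → M) (t : ℝ) :
    EuclideanSpace ℝ (Fin n) :=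
  e.extend (𝓡∂ n) (γ t)

/-- `γ : [0, 1] → M` is a geodesic of `F` from `p` to `q`: it is smooth up to the end points and
satisfies `γ̈ⁱ + 2 Gⁱ(γ, γ̇) = 0` in all charts of the smooth structure. Only the restriction of `γ`
to `[0, 1]` matters; derivatives are one-sided at the end points. -/
structure IsGeodesic (F : TangentFun n M) (p q : M) (γ : ℝ → M) : Prop where
  smooth : ContMDiffOn 𝓘(ℝ, ℝ) (𝓡∂ n) ∞ γ (Icc 0 1)
  source : γ 0 = p
  target : γ 1 = q
  equation : ∀ e ∈ IsManifold.maximalAtlas (𝓡∂ n) ∞ M, ∀ t ∈ Icc (0 : ℝ) 1, γ t ∈ e.source →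
    ∀ i : Fin n,
      (derivWithin (derivWithin (localCurve e γ) (Icc 0 1)) (Icc 0 1) t) i
        + 2 * spray F e i (localCurve e γ t) (derivWithin (localCurve e γ) (Icc 0 1) t) = 0

/-- The length `L_F(γ) = ∫₀¹ F(γ, γ̇) dt`. -/
def length (F : TangentFun n M) (γ : ℝ → M) : ℝ :=
  ∫ t in (0 : ℝ)..1, F (γ t) (mfderivWithin 𝓘(ℝ, ℝ) (𝓡∂ n) γ (Icc 0 1) t (1 : ℝ))

/-- `F` is admissible: any two boundary points `p`, `q` are joined by a unique geodesic from `p` to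
`q` (parametrised by `[0, 1]`). -/
def Admissible (F : TangentFun n M) : Prop :=
  ∀ p q : (𝓡∂ n).boundary M, ∃ γ : ℝ → M, IsGeodesic F p q γ ∧
    ∀ γ' : ℝ → M, IsGeodesic F p q γ' → EqOn γ' γ (Icc 0 1)

/-- The boundary distance data of an admissible `F`: the length of the geodesic from `p` to `q`. -/
def boundaryDist (F : TangentFun n M) (hF : Admissible F) (p q : (𝓡∂ n).boundary M) : ℝ :=
  length F (hF p q).choose

/-- The dual norm `sup_x sup_{F(x, y) = 1} α_x(y)` of a field of covectors, as an extended number. -/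
def dualNorm (F : TangentFun n M) (α : (x : M) → TangentSpace (𝓡∂ n) x →L[ℝ] ℝ) : ℝ≥0∞ :=
  ⨆ (x : M) (y : TangentSpace (𝓡∂ n) x) (_ : F x y = 1), ENNReal.ofReal (α x y)

/-- The differential of a scalar field. -/
def differential (φ : M → ℝ) (x : M) : TangentSpace (𝓡∂ n) x →L[ℝ] ℝ :=
  mfderiv (𝓡∂ n) 𝓘(ℝ, ℝ) φ x

/-- `Ψ` is the identity on the boundary. -/
def FixesBoundary (Ψ : M ≃ₘ^∞⟮𝓡∂ n, 𝓡∂ n⟯ M) : Prop :=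
  ∀ x ∈ (𝓡∂ n).boundary M, Ψ x = x

/-- The pullback `(Ψ^* F)(x, y) = F(Ψ x, dΨ_x y)` of a function on the tangent bundle. -/
def pullback (Ψ : M ≃ₘ^∞⟮𝓡∂ n, 𝓡∂ n⟯ M) (F : TangentFun n M) : TangentFun n M :=
  fun x y ↦ F (Ψ x) (mfderiv (𝓡∂ n) (𝓡∂ n) Ψ x y)

variable [IsManifold (𝓡∂ n) ∞ M]

/-- The norm `F_g(x, y) = √(g_x(y, y))` of a Riemannian metric. -/
def metricNorm (g : Metric n M) : TangentFun n M :=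
  fun x y ↦ √(g.inner x y y)

/-- The Randers metric `F_g + β`. -/
def randers (g : Metric n M) (β : OneForm n M) : TangentFun n M :=
  fun x y ↦ metricNorm g x y + β.toFun x y

/-- The `j`-th component of `β` in the chart `e`. -/
def OneForm.component (β : OneForm n M) (e : OpenPartialHomeomorph M (EuclideanHalfSpace n))
    (j : Fin n) (u : EuclideanSpace ℝ (Fin n)) : ℝ :=
  β.toFun ((e.extend (𝓡∂ n)).symm u) (tangentOf e u (coordVec j))

/-- `dβ = 0`: in all charts, `∂ᵢ βⱼ = ∂ⱼ βᵢ`. -/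
def OneForm.Closed (β : OneForm n M) : Prop :=
  ∀ e ∈ IsManifold.maximalAtlas (𝓡∂ n) ∞ M, ∀ u ∈ (e.extend (𝓡∂ n)).target, ∀ i j : Fin n,
    fderivWithin ℝ (β.component e j) (range (𝓡∂ n)) u (coordVec i)
      = fderivWithin ℝ (β.component e i) (range (𝓡∂ n)) u (coordVec j)

/-- `g₂ = Ψ^* g₁`. -/
def IsPullbackMetric (Ψ : M ≃ₘ^∞⟮𝓡∂ n, 𝓡∂ n⟯ M) (g₁ g₂ : Metric n M) : Prop :=
  ∀ (x : M) (v w : TangentSpace (𝓡∂ n) x), g₂.inner x v w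
    = g₁.inner (Ψ x) (mfderiv (𝓡∂ n) (𝓡∂ n) Ψ x v) (mfderiv (𝓡∂ n) (𝓡∂ n) Ψ x w)

/-- `(M, g₁)` and `(M, g₂)` are boundary rigid: if the two admissible metrics have the same boundary
distance data, then `g₂ = Ψ^* g₁` for a diffeomorphism `Ψ` that is the identity on the boundary. -/
def BoundaryRigid (g₁ g₂ : Metric n M) (h₁ : Admissible (metricNorm g₁))
    (h₂ : Admissible (metricNorm g₂)) : Prop :=
  (∀ p q : (𝓡∂ n).boundary M,
      boundaryDist (metricNorm g₁) h₁ p q = boundaryDist (metricNorm g₂) h₂ p q) →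
    ∃ Ψ : M ≃ₘ^∞⟮𝓡∂ n, 𝓡∂ n⟯ M, FixesBoundary Ψ ∧ IsPullbackMetric Ψ g₁ g₂

/-- `β₂ = β₁ + dφ`. -/
def DiffersBy (β₁ β₂ : OneForm n M) (φ : M → ℝ) : Prop :=
  ∀ x : M, β₂.toFun x = β₁.toFun x + differential φ x

/-- `β₂ = Ψ^* β₁ + dφ`. -/
def PullbackDiffersBy (Ψ : M ≃ₘ^∞⟮𝓡∂ n, 𝓡∂ n⟯ M) (β₁ β₂ : OneForm n M) (φ : M → ℝ) : Prop :=
  ∀ x : M, β₂.toFun x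
    = (β₁.toFun (Ψ x)).comp (mfderiv (𝓡∂ n) (𝓡∂ n) Ψ x) + differential φ x

end Randers

end

/-! On a simply connected manifold the closed forms are exact, `β_i = df_i`
(`OneForm.Closed.exists_potential`), and adding `df` to `F_g` changes the length of every curve from
`p` to `q` by the same amount `f q - f p`. So a geodesic of `g`, reparametrised to have constant
Randers speed, is a geodesic of `F_g + df`. Admissibility makes it the only one between its end
points, which gives `boundaryDist_randers`: `d_F(p, q) = d_g(p, q) + f q - f p`. The converse
passage from Randers geodesics to Riemannian ones is never needed.

Since `d_g` is symmetric (`boundaryDist_metricNorm_comm`), equality of the Randers data splits into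
a symmetric part, `d_{g₁} = d_{g₂}`, and an antisymmetric part: `f₂ - f₁` is constant on the
boundary. Rigidity turns the first into `g₂ = Ψ^* g₁`, and the second yields `φ = f₂ - f₁ - const`,
which is unique because `M` is connected. In (c) the function is `f₂ - f₁ ∘ Ψ - const`, so its
uniqueness requires that `Ψ` itself be unique. The way back to (a) uses that isometries fixing the
boundary preserve `d_g`.

Uniqueness of `Ψ` (`IsPullbackMetric.eq`) says that an isometry `Θ` fixing the boundary is the
identity. At a boundary point its differential is a linear isometry that fixes a hyperplane and does
not turn the inward direction outward, hence the identity. In a chart, Koszul's permutation of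
indices bounds the second derivative of `Θ` by the distance of its 1-jet from that of the identity,
and Gronwall's inequality then gives `Θ = id` nearby (`eventually_eq_self_of_isometry`). This works
directly on a half-space, without an exponential map. An open-closed argument (`isometry_eq_self`)
spreads the equality over `M`. -/

noncomputable section

namespace Randers

set_option linter.unusedSectionVars false

/-! ### Charts up to the boundary: coordinate frames and coordinate expressions of tensors. -/

section Generic

variable {E : Type*} [NormedAddCommGroup E] [NormedSpace ℝ E] {H : Type*} [TopologicalSpace H]
  {I : ModelWithCorners ℝ E H} {M : Type*} [TopologicalSpace M] [ChartedSpace H M]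
  {e : OpenPartialHomeomorph M H}

/-- The target of an extended chart is open only relative to `range I`; this is what allows
derivatives within the target and within `range I` to be exchanged at boundary points. -/
lemma extend_target_mem_nhdsWithin' {u : E} (hu : u ∈ (e.extend I).target) :
    (e.extend I).target ∈ 𝓝[range I] u := by
  have h1 := e.extend_target_mem_nhdsWithin (I := I)
    (y := (e.extend I).symm u) (by
      have := (e.extend I).map_target hu
      rwa [e.extend_source] at this)
  rwa [(e.extend I).right_inv hu] at h1

lemma uniqueDiffOn_extend_target : UniqueDiffOn ℝ (e.extend I).target := fun u hu ↦
  (I.uniqueDiffOn u (e.extend_target_subset_range hu)).mono_nhds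
    (nhdsWithin_le_iff.2 (extend_target_mem_nhdsWithin' hu))

variable [IsManifold I ∞ M]

lemma contMDiffWithinAt_extend_symm (he : e ∈ IsManifold.maximalAtlas I ∞ M) {u : E}
    (hu : u ∈ (e.extend I).target) :
    ContMDiffWithinAt 𝓘(ℝ, E) I ∞ (e.extend I).symm (range I) u := by
  have h := contMDiffOn_extend_symm he
  rw [← e.extend_target'] at h
  exact (h u hu).mono_of_mem_nhdsWithin (extend_target_mem_nhdsWithin' hu)

variable (I e) in
/-- The coordinate frame of the chart `e` at the point with coordinates `u`. -/
def frame (u : E) : E →L[ℝ] TangentSpace I ((e.extend I).symm u) :=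
  mfderivWithin 𝓘(ℝ, E) I (e.extend I).symm (range I) u

/-- The frame is the tangent map of the inverse chart applied to a constant vector field. -/
lemma contMDiffOn_frame (he : e ∈ IsManifold.maximalAtlas I ∞ M) (v : E) :
    ContMDiffOn 𝓘(ℝ, E) I.tangent ∞
      (fun u ↦ (TotalSpace.mk' E ((e.extend I).symm u) (frame I e u v) :
        TangentBundle I M)) (e.extend I).target := by
  have h1 : ContMDiffOn 𝓘(ℝ, E) I ∞ (e.extend I).symm (e.extend I).target :=
    fun u hu ↦ (contMDiffWithinAt_extend_symm he hu).mono e.extend_target_subset_range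
  have h2 := h1.contMDiffOn_tangentMapWithin (m := ∞) (by simp)
    uniqueDiffOn_extend_target.uniqueMDiffOn
  have h3 : ContMDiff 𝓘(ℝ, E) 𝓘(ℝ, E).tangent ∞
     (fun u : E ↦ (TotalSpace.mk' E u v : TangentBundle 𝓘(ℝ, E) E)) := by
    exact (contMDiff_vectorSpace_iff_contDiff (V := fun _ ↦ v)).2 contDiff_const
  have h4 := ContMDiffOn.comp (s := (e.extend I).target) h2 h3.contMDiffOn (fun u hu ↦ hu)
  refine h4.congr ?_
  intro u hu
  have : mfderivWithin 𝓘(ℝ, E) I (e.extend I).symm (range I) u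
    = mfderivWithin 𝓘(ℝ, E) I (e.extend I).symm (e.extend I).target u := 
    ((((contMDiffWithinAt_extend_symm he hu).mdifferentiableWithinAt
      (by simp)).hasMFDerivWithinAt.mono e.extend_target_subset_range).mfderivWithin
      (uniqueDiffOn_extend_target u hu).uniqueMDiffWithinAt).symm
  simp only [Function.comp, tangentMapWithin, frame, this]
  rfl

lemma hasMFDerivWithinAt_extend_symm (he : e ∈ IsManifold.maximalAtlas I ∞ M) {u : E}
    (hu : u ∈ (e.extend I).target) :
    HasMFDerivWithinAt 𝓘(ℝ, E) I (e.extend I).symm (range I) u (frame I e u) :=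
  ((contMDiffWithinAt_extend_symm he hu).mdifferentiableWithinAt (by simp)).hasMFDerivWithinAt

lemma extend_symm_mem_source {u : E} (hu : u ∈ (e.extend I).target) :
    (e.extend I).symm u ∈ e.source := by
  have := (e.extend I).map_target hu
  rwa [e.extend_source] at this

/-- The derivative of the chart is a left inverse: the composite `L` is a derivative of the identity
within `range I`, where derivatives are unique. -/
lemma frame_injective (he : e ∈ IsManifold.maximalAtlas I ∞ M) {u : E}
    (hu : u ∈ (e.extend I).target) : Function.Injective (frame I e u) := by
  have h1 := hasMFDerivWithinAt_extend_symm he hu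
  have h2 := ((e.contMDiffAt_extend he
    (extend_symm_mem_source hu)).mdifferentiableAt (by simp)).hasMFDerivAt
  have h3 := h2.comp_hasMFDerivWithinAt u h1
  let L : E →L[ℝ] E := (mfderiv I 𝓘(ℝ, E) (e.extend I) ((e.extend I).symm u)).comp (frame I e u)
  have h3' : HasFDerivWithinAt (fun x ↦ e.extend I ((e.extend I).symm x)) L (range I) u :=
    h3.hasFDerivWithinAt
  have h5 : L = ContinuousLinearMap.id ℝ E := by
    have h4 : HasFDerivWithinAt (fun x ↦ x) (ContinuousLinearMap.id ℝ E) (range I) u :=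
      hasFDerivWithinAt_id u _
    have h6 : HasFDerivWithinAt (fun x ↦ e.extend I ((e.extend I).symm x))
        (ContinuousLinearMap.id ℝ E) (range I) u := by
      refine h4.congr_of_eventuallyEq ?_ ((e.extend I).right_inv hu)
      filter_upwards [extend_target_mem_nhdsWithin' hu] with y hy
      exact (e.extend I).right_inv hy
    exact (I.uniqueDiffOn u (e.extend_target_subset_range hu)).eq h3' h6
  intro v w hvw
  have hv : L v = L w := congrArg (mfderiv I 𝓘(ℝ, E) (e.extend I) ((e.extend I).symm u)) hvw
  rwa [h5] at hv

lemma frame_surjective [FiniteDimensional ℝ E] (he : e ∈ IsManifold.maximalAtlas I ∞ M) {u : E}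
    (hu : u ∈ (e.extend I).target) : Function.Surjective (frame I e u) := by
  let L : E →L[ℝ] E := frame I e u
  exact (LinearMap.injective_iff_surjective (f := L.toLinearMap)).1 (frame_injective he hu)

variable (e) in
/-- The coordinate expression of a bilinear field in the chart `e`. -/
def chartForm (g : (x : M) → TangentSpace I x →L[ℝ] TangentSpace I x →L[ℝ] ℝ) (u : E) :
    E →L[ℝ] E →L[ℝ] ℝ :=
  ContinuousLinearMap.bilinearComp (E := E) (F := E) (g ((e.extend I).symm u) : E →L[ℝ] E →L[ℝ] ℝ)
    (frame I e u) (frame I e u)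

lemma chartForm_apply (g : (x : M) → TangentSpace I x →L[ℝ] TangentSpace I x →L[ℝ] ℝ)
    (u v w : E) :
    chartForm e g u v w = g ((e.extend I).symm u) (frame I e u v) (frame I e u w) := rfl

variable (e) in
/-- The coordinate expression of a covector field in the chart `e`. -/
def chartCovector (β : (x : M) → TangentSpace I x →L[ℝ] ℝ) (u : E) : E →L[ℝ] ℝ :=
  (β ((e.extend I).symm u)).comp (frame I e u)

lemma chartCovector_apply (β : (x : M) → TangentSpace I x →L[ℝ] ℝ) (u v : E) :
    chartCovector e β u v = β ((e.extend I).symm u) (frame I e u v) := rfl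

lemma contDiffOn_chartForm [FiniteDimensional ℝ E]
    (he : e ∈ IsManifold.maximalAtlas I ∞ M)
    (g : (x : M) → TangentSpace I x →L[ℝ] TangentSpace I x →L[ℝ] ℝ)
    (hg : ContMDiff I (I.prod 𝓘(ℝ, E →L[ℝ] E →L[ℝ] ℝ)) ∞
      (fun b ↦ TotalSpace.mk' (E →L[ℝ] E →L[ℝ] ℝ)
        (E := fun x : M ↦ TangentSpace I x →L[ℝ] TangentSpace I x →L[ℝ] ℝ) b (g b))) :
    ContDiffOn ℝ ∞ (chartForm e g) (e.extend I).target := by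
  rw [contDiffOn_clm_apply]
  intro v
  rw [contDiffOn_clm_apply]
  intro w
  rw [← contMDiffOn_iff_contDiffOn]
  have h1 : ContMDiffOn 𝓘(ℝ, E) I ∞ (e.extend I).symm (e.extend I).target :=
    fun u hu ↦ (contMDiffWithinAt_extend_symm he hu).mono e.extend_target_subset_range
  have h2 := ContMDiffOn.clm_bundle_apply₂ (IB := I) (E₃ := fun _ : M ↦ ℝ) (F₃ := ℝ)
    (F₁ := E) (F₂ := E)
    (b := (e.extend I).symm) (s := (e.extend I).target)
    (ψ := fun u ↦ g ((e.extend I).symm u)) (hg.comp_contMDiffOn h1) (contMDiffOn_frame he v)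
    (contMDiffOn_frame he w)
  intro u hu
  have h3 := h2 u hu
  rw [contMDiffWithinAt_totalSpace] at h3
  exact h3.2

lemma contDiffOn_chartCovector [FiniteDimensional ℝ E]
    (he : e ∈ IsManifold.maximalAtlas I ∞ M)
    (β : (x : M) → TangentSpace I x →L[ℝ] ℝ)
    (hβ : ContMDiff I (I.prod 𝓘(ℝ, E →L[ℝ] ℝ)) ∞
      (fun b ↦ TotalSpace.mk' (E →L[ℝ] ℝ)
        (E := fun x : M ↦ TangentSpace I x →L[ℝ] ℝ) b (β b))) :
    ContDiffOn ℝ ∞ (chartCovector e β) (e.extend I).target := by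
  rw [contDiffOn_clm_apply]
  intro v
  rw [← contMDiffOn_iff_contDiffOn]
  have h1 : ContMDiffOn 𝓘(ℝ, E) I ∞ (e.extend I).symm (e.extend I).target :=
    fun u hu ↦ (contMDiffWithinAt_extend_symm he hu).mono e.extend_target_subset_range
  have h2 := ContMDiffOn.clm_bundle_apply (IB := I) (E₂ := fun _ : M ↦ ℝ) (F₂ := ℝ)
    (F₁ := E)
    (b := (e.extend I).symm) (s := (e.extend I).target)
    (ϕ := fun u ↦ β ((e.extend I).symm u)) (hβ.comp_contMDiffOn h1) (contMDiffOn_frame he v)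
  intro u hu
  have h3 := h2 u hu
  rw [contMDiffWithinAt_totalSpace] at h3
  exact h3.2

/-- All tangent spaces are the type `E` by definition, so equal base points can be substituted
without transporting vectors. -/
lemma tangentFun_congr (F : (x : M) → TangentSpace I x → ℝ) {x y : M} (h : x = y) {v w : E}
    (hvw : v = w) : F x v = F y w := by
  subst h hvw; rfl

lemma contDiffOn_comp_extend_symm {f : M → ℝ} (hf : ContMDiff I 𝓘(ℝ, ℝ) ∞ f)
    (he : e ∈ IsManifold.maximalAtlas I ∞ M) :
    ContDiffOn ℝ ∞ (fun u ↦ f ((e.extend I).symm u)) (e.extend I).target := by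
  rw [← contMDiffOn_iff_contDiffOn]
  exact hf.comp_contMDiffOn fun u hu ↦
    (contMDiffWithinAt_extend_symm he hu).mono e.extend_target_subset_range

lemma fderivWithin_comp_extend_symm {f : M → ℝ} (hf : ContMDiff I 𝓘(ℝ, ℝ) ∞ f)
    (he : e ∈ IsManifold.maximalAtlas I ∞ M) {u : E} (hu : u ∈ (e.extend I).target) (v : E) :
    fderivWithin ℝ (fun u ↦ f ((e.extend I).symm u)) (range I) u v
      = mfderiv I 𝓘(ℝ, ℝ) f ((e.extend I).symm u) (frame I e u v) := by
  have h1 := hasMFDerivWithinAt_extend_symm he hu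
  have h2 := ((hf ((e.extend I).symm u)).mdifferentiableAt (by simp)).hasMFDerivAt
  have h3 := h2.comp_hasMFDerivWithinAt u h1
  let L : E →L[ℝ] ℝ := (mfderiv I 𝓘(ℝ, ℝ) f ((e.extend I).symm u)).comp (frame I e u)
  have h3' : HasFDerivWithinAt (fun u ↦ f ((e.extend I).symm u)) L (range I) u :=
    h3.hasFDerivWithinAt
  rw [h3'.fderivWithin (I.uniqueDiffOn u (e.extend_target_subset_range hu))]
  rfl

section Curve

variable {γ : ℝ → M} {s : Set ℝ} {t : ℝ}

lemma contDiffWithinAt_extend_comp (he : e ∈ IsManifold.maximalAtlas I ∞ M)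
    (hγ : ContMDiffOn 𝓘(ℝ, ℝ) I ∞ γ s) (ht : t ∈ s) (hte : γ t ∈ e.source) :
    ContDiffWithinAt ℝ ∞ (fun t ↦ e.extend I (γ t)) s t := by
  rw [← contMDiffWithinAt_iff_contDiffWithinAt]
  exact (e.contMDiffAt_extend he hte).comp_contMDiffWithinAt t (hγ t ht)

lemma eventually_mem_source (hγ : ContinuousWithinAt γ s t) (hte : γ t ∈ e.source) :
    ∀ᶠ r in 𝓝[s] t, γ r ∈ e.source :=
  hγ (e.open_source.mem_nhds hte)

lemma mfderivWithin_curve (he : e ∈ IsManifold.maximalAtlas I ∞ M)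
    (hγ : ContMDiffOn 𝓘(ℝ, ℝ) I ∞ γ s) (ht : t ∈ s) (hs : UniqueDiffWithinAt ℝ s t)
    (hte : γ t ∈ e.source) :
    (mfderivWithin 𝓘(ℝ, ℝ) I γ s t (1 : ℝ) : E)
      = frame I e (e.extend I (γ t)) (derivWithin (fun t ↦ e.extend I (γ t)) s t) := by
  have hu : e.extend I (γ t) ∈ (e.extend I).target :=
    (e.extend I).map_source (by rwa [e.extend_source])
  have h0 := contDiffWithinAt_extend_comp he hγ ht hte
  have h1 := hasMFDerivWithinAt_extend_symm he hu
  have h2 := (h0.differentiableWithinAt (by simp)).hasFDerivWithinAt.hasMFDerivWithinAt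
  have h3 := HasMFDerivWithinAt.comp t h1 h2 (fun r _ ↦ mem_range_self _)
  have h4 := h3.congr_of_eventuallyEq (f₁ := γ) (by
    filter_upwards [eventually_mem_source (hγ t ht).continuousWithinAt hte] with r hr
    exact (e.extend_left_inv hr).symm) (e.extend_left_inv hte).symm
  rw [h4.mfderivWithin hs.uniqueMDiffWithinAt]
  rfl

end Curve

end Generic

/-! ### Derivatives of the squares of Riemannian and Randers norms on a vector space. -/

section Derivatives

variable {E : Type*} [NormedAddCommGroup E] [NormedSpace ℝ E]

/-- A shortcut instance. -/
instance bilinearNormedAddCommGroup : NormedAddCommGroup (E →L[ℝ] E →L[ℝ] ℝ) :=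
  ContinuousLinearMap.toNormedAddCommGroup

/-- A shortcut instance. -/
instance bilinearNormedSpace : NormedSpace ℝ (E →L[ℝ] E →L[ℝ] ℝ) :=
  ContinuousLinearMap.toNormedSpace

/-- A shortcut instance. -/
instance bilinearAddCommGroup : AddCommGroup (E →L[ℝ] E →L[ℝ] ℝ) :=
  NormedAddCommGroup.toAddCommGroup

/-- The directional derivative in the position variable. -/
def dirX (S : Set E) (k : E) (f : E → E → ℝ) (u v : E) : ℝ :=
  fderivWithin ℝ (fun z ↦ f z v) S u k

/-- The directional derivative in the velocity variable. -/
def dirY (l : E) (f : E → E → ℝ) (u v : E) : ℝ := fderiv ℝ (fun w ↦ f u w) v l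

variable {S : Set E} {G : E → E →L[ℝ] E →L[ℝ] ℝ} {b : E → E →L[ℝ] ℝ} {f : E → E → ℝ} {u v : E}
  {DG : E →L[ℝ] E →L[ℝ] E →L[ℝ] ℝ} {Db : E →L[ℝ] E →L[ℝ] ℝ}

lemma hasFDerivAt_quadratic {Q : E →L[ℝ] E →L[ℝ] ℝ} (hQ : ∀ v w, Q v w = Q w v) (v : E) :
    HasFDerivAt (fun v ↦ Q v v) ((2 : ℝ) • Q v) v := by
  have h := (Q.hasFDerivAt (x := v)).clm_apply (hasFDerivAt_id v)
  refine h.congr_fderiv ?_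
  ext w
  simp [hQ w v]
  ring

lemma hasFDerivWithinAt_clm_apply_const {X : Type*} [NormedAddCommGroup X]
    [NormedSpace ℝ X] {f : E → E →L[ℝ] X} {f' : E →L[ℝ] E →L[ℝ] X}
    (hf : HasFDerivWithinAt f f' S u) (w : E) :
    HasFDerivWithinAt (fun y ↦ f y w) (f'.flip w) S u := by
  refine (hf.clm_apply (hasFDerivWithinAt_const w u S)).congr_fderiv ?_
  ext z
  simp

lemma dirY_quadratic (hf : ∀ u v, f u v = G u v v) (hsymm : ∀ v w, G u v w = G u w v) (l v : E) :
    dirY l f u v = 2 * G u v l := by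
  simp only [dirY, hf]
  rw [(hasFDerivAt_quadratic hsymm v).fderiv]
  simp

lemma dirY_dirY_quadratic (hf : ∀ u v, f u v = G u v v) (hsymm : ∀ v w, G u v w = G u w v)
    (k l : E) : dirY k (dirY l f) u v = 2 * G u k l := by
  rw [dirY]
  simp only [dirY_quadratic hf hsymm]
  have h1 : HasFDerivAt (fun w ↦ 2 * G u w l) ((2 : ℝ) • (G u).flip l) v :=
    ((G u).flip l).hasFDerivAt.const_mul (2 : ℝ)
  rw [h1.fderiv]
  simp

lemma dirX_dirY_quadratic (hf : ∀ u v, f u v = G u v v) (hS : UniqueDiffWithinAt ℝ S u)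
    (hu : u ∈ S) (hsymm : ∀ᶠ u' in 𝓝[S] u, ∀ v w, G u' v w = G u' w v)
    (hG : HasFDerivWithinAt G DG S u) (k l : E) :
    dirX S k (dirY l f) u v = 2 * DG k v l := by
  have h0 := (hasFDerivWithinAt_clm_apply_const
    (hasFDerivWithinAt_clm_apply_const hG v) l).const_mul (2 : ℝ)
  have h : HasFDerivWithinAt (fun z ↦ dirY l f z v) ((2 : ℝ) • ((DG.flip v).flip l)) S u := by
    refine h0.congr_of_eventuallyEq ?_ (dirY_quadratic hf (hsymm.self_of_nhdsWithin hu) l v)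
    filter_upwards [hsymm] with u' h'
    exact dirY_quadratic hf h' l v
  rw [dirX, h.fderivWithin hS]
  simp

lemma dirX_quadratic (hf : ∀ u v, f u v = G u v v) (hS : UniqueDiffWithinAt ℝ S u)
    (hG : HasFDerivWithinAt G DG S u) (k : E) : dirX S k f u v = DG k v v := by
  have h0 := hasFDerivWithinAt_clm_apply_const (hasFDerivWithinAt_clm_apply_const hG v) v
  simp only [dirX, hf]
  rw [h0.fderivWithin hS]
  simp

section RandersNorm

/-- The Finsler norm with metric `G` and linear part `b`. -/
def randersNorm (G : E → E →L[ℝ] E →L[ℝ] ℝ) (b : E → E →L[ℝ] ℝ) (u v : E) : ℝ :=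
  √(G u v v) + b u v

/-- The vertical derivative of `randersNorm`. -/
def randersMomentum (G : E → E →L[ℝ] E →L[ℝ] ℝ) (b : E → E →L[ℝ] ℝ) (u v : E) : E →L[ℝ] ℝ :=
  (√(G u v v))⁻¹ • G u v + b u

lemma hasFDerivAt_sqrt_quadratic (hsymm : ∀ v w, G u v w = G u w v) (hv : 0 < G u v v) :
    HasFDerivAt (fun v ↦ √(G u v v)) ((√(G u v v))⁻¹ • G u v) v := by
  refine ((hasFDerivAt_quadratic hsymm v).sqrt hv.ne').congr_fderiv ?_
  rw [smul_smul]
  congr 1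
  field_simp

lemma hasFDerivAt_randersNorm (hsymm : ∀ v w, G u v w = G u w v) (hv : 0 < G u v v) :
    HasFDerivAt (randersNorm G b u) (randersMomentum G b u v) v :=
  (hasFDerivAt_sqrt_quadratic hsymm hv).add (b u).hasFDerivAt

lemma eventually_pos (hv : 0 < G u v v) : ∀ᶠ w in 𝓝 v, 0 < G u w w := by
  have : Continuous fun w ↦ G u w w := (G u).continuous.clm_apply continuous_id
  exact this.continuousAt.eventually (lt_mem_nhds hv)

lemma dirY_randers (hf : ∀ u v, f u v = randersNorm G b u v ^ 2)
    (hsymm : ∀ v w, G u v w = G u w v) (hv : 0 < G u v v) (l : E) :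
    dirY l f u v = 2 * (randersNorm G b u v * randersMomentum G b u v l) := by
  simp only [dirY, hf]
  rw [((hasFDerivAt_randersNorm hsymm hv).pow 2).fderiv]
  simp [mul_assoc]

/-- The fundamental tensor of `randersNorm`. -/
def randersTensor (G : E → E →L[ℝ] E →L[ℝ] ℝ) (b : E → E →L[ℝ] ℝ) (u v : E) :
    E →L[ℝ] E →L[ℝ] ℝ :=
  (randersMomentum G b u v).smulRight (randersMomentum G b u v) +
    randersNorm G b u v • ((√(G u v v))⁻¹ • G u -
      ((√(G u v v)) ^ 3)⁻¹ • (G u v).smulRight (G u v))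

lemma randersTensor_apply (w z : E) :
    randersTensor G b u v w z = randersMomentum G b u v w * randersMomentum G b u v z +
      randersNorm G b u v * ((√(G u v v))⁻¹ * G u w z -
        ((√(G u v v)) ^ 3)⁻¹ * (G u v w * G u v z)) := by
  simp [randersTensor]

lemma dirY_dirY_randers (hf : ∀ u v, f u v = randersNorm G b u v ^ 2)
    (hsymm : ∀ v w, G u v w = G u w v) (hv : 0 < G u v v) (k l : E) :
    dirY k (dirY l f) u v = 2 * randersTensor G b u v k l := by
  have h1 : HasFDerivAt (fun w ↦ randersMomentum G b u w l)
      ((√(G u v v))⁻¹ • (G u).flip l + (G u v l) •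
        (-((√(G u v v)) ^ 2)⁻¹ • ((√(G u v v))⁻¹ • G u v))) v := by
    have h2 := (hasDerivAt_inv (Real.sqrt_pos.2 hv).ne').comp_hasFDerivAt v
      (hasFDerivAt_sqrt_quadratic hsymm hv)
    exact ((h2.mul ((G u).flip l).hasFDerivAt).add_const (b u l))
  have h3 : HasFDerivAt (fun w ↦ dirY l f u w) _ v :=
    ((((hasFDerivAt_randersNorm hsymm hv).mul h1).const_mul 2).congr_of_eventuallyEq (by
      filter_upwards [eventually_pos hv] with w hw
      exact dirY_randers hf hsymm hw l))
  rw [dirY, h3.fderiv, randersTensor_apply]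
  simp
  ring

lemma hasFDerivWithinAt_sqrt_metric (hG : HasFDerivWithinAt G DG S u) (hv : 0 < G u v v) :
    HasFDerivWithinAt (fun u ↦ √(G u v v))
      ((2 * √(G u v v))⁻¹ • (DG.flip v).flip v) S u := by
  simpa using (hasFDerivWithinAt_clm_apply_const
    (hasFDerivWithinAt_clm_apply_const hG v) v).sqrt hv.ne'

lemma hasFDerivWithinAt_randersNorm (hG : HasFDerivWithinAt G DG S u)
    (hb : HasFDerivWithinAt b Db S u) (hv : 0 < G u v v) :
    HasFDerivWithinAt (fun u ↦ randersNorm G b u v)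
      ((2 * √(G u v v))⁻¹ • (DG.flip v).flip v + Db.flip v) S u :=
  (hasFDerivWithinAt_sqrt_metric hG hv).add (hasFDerivWithinAt_clm_apply_const hb v)

lemma dirX_randers (hf : ∀ u v, f u v = randersNorm G b u v ^ 2)
    (hS : UniqueDiffWithinAt ℝ S u) (hG : HasFDerivWithinAt G DG S u)
    (hb : HasFDerivWithinAt b Db S u) (hv : 0 < G u v v) (k : E) :
    dirX S k f u v =
      2 * (randersNorm G b u v * ((2 * √(G u v v))⁻¹ * DG k v v + Db k v)) := by
  simp only [dirX, hf]
  rw [((hasFDerivWithinAt_randersNorm hG hb hv).pow 2).fderivWithin hS]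
  simp [mul_assoc]
  ring

lemma dirX_dirY_randers (hf : ∀ u v, f u v = randersNorm G b u v ^ 2)
    (hS : UniqueDiffWithinAt ℝ S u) (hu : u ∈ S)
    (hsymm : ∀ᶠ u' in 𝓝[S] u, ∀ v w, G u' v w = G u' w v)
    (hG : HasFDerivWithinAt G DG S u)
    (hb : HasFDerivWithinAt b Db S u) (hv : 0 < G u v v) (k l : E) :
    dirX S k (dirY l f) u v =
      2 * (((2 * √(G u v v))⁻¹ * DG k v v + Db k v) * randersMomentum G b u v l
        + randersNorm G b u v * ((√(G u v v))⁻¹ * DG k v l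
          - (2 * √(G u v v) ^ 3)⁻¹ * (DG k v v * G u v l) + Db k l)) := by
  have h1 := (hasDerivAt_inv (Real.sqrt_pos.2 hv).ne').comp_hasFDerivWithinAt u
      (hasFDerivWithinAt_sqrt_metric hG hv)
  have h2 := (h1.mul (hasFDerivWithinAt_clm_apply_const
    (hasFDerivWithinAt_clm_apply_const hG v) l)).add (hasFDerivWithinAt_clm_apply_const hb l)
  -- The closed formula for the vertical derivative requires positivity, so it must hold at nearby
  -- base points before it can be differentiated in `u`.
  have hpos : ∀ᶠ u' in 𝓝[S] u, 0 < G u' v v :=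
    (hasFDerivWithinAt_clm_apply_const
      (hasFDerivWithinAt_clm_apply_const hG v) v).continuousWithinAt.eventually (lt_mem_nhds hv)
  have h3 : HasFDerivWithinAt (fun z ↦ dirY l f z v) _ S u :=
    ((((hasFDerivWithinAt_randersNorm hG hb hv).mul h2).const_mul 2).congr_of_eventuallyEq (by
      filter_upwards [hpos, hsymm] with w hw hw'
      exact dirY_randers hf hw' hw l) (dirY_randers hf (hsymm.self_of_nhdsWithin hu) hv l))
  rw [dirX, h3.fderivWithin hS]
  simp [randersMomentum]
  field_simp
  ring

/-- Half of the mixed second derivative of the square of `randersNorm`. -/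
def randersMixed (G : E → E →L[ℝ] E →L[ℝ] ℝ) (b : E → E →L[ℝ] ℝ)
    (DG : E →L[ℝ] E →L[ℝ] E →L[ℝ] ℝ) (Db : E →L[ℝ] E →L[ℝ] ℝ) (u v : E) : E →L[ℝ] E →L[ℝ] ℝ :=
  ((2 * √(G u v v))⁻¹ • (DG.flip v).flip v + Db.flip v).smulRight (randersMomentum G b u v)
    + randersNorm G b u v • ((√(G u v v))⁻¹ • DG.flip v
      - (2 * √(G u v v) ^ 3)⁻¹ • ((DG.flip v).flip v).smulRight (G u v) + Db)

lemma randersMixed_apply (k l : E) :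
    randersMixed G b DG Db u v k l =
      ((2 * √(G u v v))⁻¹ * DG k v v + Db k v) * randersMomentum G b u v l
        + randersNorm G b u v * ((√(G u v v))⁻¹ * DG k v l
          - (2 * √(G u v v) ^ 3)⁻¹ * (DG k v v * G u v l) + Db k l) := by
  simp [randersMixed]
  ring

/-- Half of the horizontal derivative of the square of `randersNorm`. -/
def randersForce (G : E → E →L[ℝ] E →L[ℝ] ℝ) (b : E → E →L[ℝ] ℝ)
    (DG : E →L[ℝ] E →L[ℝ] E →L[ℝ] ℝ) (Db : E →L[ℝ] E →L[ℝ] ℝ) (u v : E) : E →L[ℝ] ℝ :=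
  randersNorm G b u v • ((2 * √(G u v v))⁻¹ • (DG.flip v).flip v + Db.flip v)

lemma randersForce_apply (k : E) : randersForce G b DG Db u v k =
    randersNorm G b u v * ((2 * √(G u v v))⁻¹ * DG k v v + Db k v) := by
  simp [randersForce]
  ring

/-- The tensor is the square of the momentum plus a positive multiple of the `G`-square of the
component of `w` orthogonal to `v`. If it vanishes, `w = c • v`; by homogeneity the momentum of `v`
is the norm itself, which is positive, so `c = 0`. -/
lemma eq_zero_of_randersTensor_eq_zero (hsymm : ∀ v w, G u v w = G u w v)
    (hpos : ∀ w, w ≠ 0 → 0 < G u w w) (hv : v ≠ 0) (hN : 0 < randersNorm G b u v) {w : E}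
    (hw : randersTensor G b u v w w = 0) : w = 0 := by
  set a := √(G u v v) with ha
  have hG := hpos v hv
  have ha0 : 0 < a := Real.sqrt_pos.2 hG
  have ha2 : a ^ 2 = G u v v := Real.sq_sqrt hG.le
  set c := G u v w / G u v v with hc
  have hcG : G u v w = c * a ^ 2 := by rw [ha2, hc]; field_simp
  have key : G u (w - c • v) (w - c • v) = G u w w - c ^ 2 * a ^ 2 := by
    simp only [map_sub, map_smul, sub_apply, smul_apply,
      smul_eq_mul, hsymm w v, hcG, ← ha2]
    ring
  have h1 : randersTensor G b u v w w = randersMomentum G b u v w ^ 2 +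
      randersNorm G b u v * a⁻¹ * G u (w - c • v) (w - c • v) := by
    rw [randersTensor_apply, key, ← ha, hcG]
    field_simp
  have h2 : G u (w - c • v) (w - c • v) = 0 := by
    by_contra h
    have h3 : 0 < G u (w - c • v) (w - c • v) := hpos _ fun h0 ↦ h (by simp [h0])
    have : 0 < randersTensor G b u v w w := by rw [h1]; positivity
    exact this.ne' hw
  have h4 : w = c • v := by
    by_contra h
    exact (hpos _ (sub_ne_zero.2 h)).ne' h2
  have h5 : randersMomentum G b u v w = 0 := by
    rw [h1, h2] at hw
    simpa using hw
  have h6 : randersMomentum G b u v v = randersNorm G b u v := by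
    have h7 : randersMomentum G b u v v = a⁻¹ * G u v v + b u v := by simp [randersMomentum, ha]
    have h8 : randersNorm G b u v = a + b u v := rfl
    rw [h7, h8, ← ha2]
    field_simp
  rw [h4, map_smul, h6, smul_eq_mul] at h5
  rcases mul_eq_zero.1 h5 with h | h
  · rw [h4, h, zero_smul]
  · exact absurd h hN.ne'

/-- A reparametrised geodesic of `G` along which `randersNorm` is constant satisfies the
Euler-Lagrange equation of the square of `randersNorm`, provided that the linear part is closed. -/
lemma eulerLagrange_randers {z : E} {μ : ℝ} (hsymm : ∀ v w, G u v w = G u w v)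
    (hv : 0 < G u v v) (hDb : ∀ k l, Db k l = Db l k)
    (hz : ∀ w, G u z w + DG v v w - 1 / 2 * DG w v v = μ * G u v w)
    (hμ : μ * √(G u v v) + b u z + Db v v = 0) (w : E) :
    randersTensor G b u v w z + randersMixed G b DG Db u v v w
      - randersForce G b DG Db u v w = 0 := by
  rw [randersTensor_apply, randersMixed_apply, randersForce_apply]
  have ha0 : 0 < √(G u v v) := Real.sqrt_pos.2 hv
  have ha2 : √(G u v v) ^ 2 = G u v v := Real.sq_sqrt hv.le
  set a := √(G u v v) with ha
  -- With `z` as acceleration, `hz v` says that `√(G u v v)` has derivative `μ * √(G u v v)` along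
  -- the curve, so `hμ` expresses that the Randers norm of the velocity is constant.
  have e1 := hz w
  have e2 : G u v z + 1 / 2 * DG v v v = μ * a ^ 2 := by
    rw [ha2, ← hz v, hsymm z v]; ring
  have e3 : randersMomentum G b u v z = a⁻¹ * G u v z + b u z := by
    simp [randersMomentum, ← ha]
  rw [hDb v w, hsymm w z, e3]
  have e4 : G u z w = μ * G u v w - DG v v w + 1 / 2 * DG w v v := by linarith
  have e5 : DG v v v = 2 * (μ * a ^ 2 - G u v z) := by linarith
  have e6 : b u z = - (μ * a) - Db v v := by linarith
  rw [e4, e5, e6]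
  field_simp
  ring

end RandersNorm

end Derivatives

/-! ### The spray equation as an Euler-Lagrange equation. -/

section Spray

variable {n : ℕ} [NeZero n] {M : Type*} [TopologicalSpace M]
  [ChartedSpace (EuclideanHalfSpace n) M]
  {e : OpenPartialHomeomorph M (EuclideanHalfSpace n)}

lemma sum_smul_coordVec (v : EuclideanSpace ℝ (Fin n)) : ∑ i, v i • coordVec i = v := by
  ext j
  simp [coordVec, Finset.sum_apply, Pi.single_apply]

lemma sum_mul_coordVec (f : EuclideanSpace ℝ (Fin n) →L[ℝ] ℝ) (v : EuclideanSpace ℝ (Fin n)) :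
    ∑ i, v i * f (coordVec i) = f v := by
  conv_rhs => rw [← sum_smul_coordVec v]
  simp [map_sum]

/-- Multiplying by the fundamental matrix, which is invertible by `hdef`, removes the inverse from
the spray. What remains is half the Euler-Lagrange equation of `F²`, tested against all vectors and
free of indices. -/
lemma geodesicEquation_iff {F : TangentFun n M} {u v z : EuclideanSpace ℝ (Fin n)}
    (Q P : EuclideanSpace ℝ (Fin n) →L[ℝ] EuclideanSpace ℝ (Fin n) →L[ℝ] ℝ)
    (R : EuclideanSpace ℝ (Fin n) →L[ℝ] ℝ)
    (hQ : ∀ k l, dirY k (dirY l (localSq F e)) u v = 2 * Q k l)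
    (hP : ∀ k l, dirX (range (𝓡∂ n)) k (dirY l (localSq F e)) u v = 2 * P k l)
    (hR : ∀ k, dirX (range (𝓡∂ n)) k (localSq F e) u v = 2 * R k)
    (hdef : ∀ w, Q w w = 0 → w = 0) :
    (∀ i, z i + 2 * spray F e i u v = 0) ↔ ∀ w, Q w z + P v w - R w = 0 := by
  set A := localMetric F e u v with hA
  have hAQ : ∀ i j, A i j = Q (coordVec i) (coordVec j) := fun i j ↦ by
    have : A i j = 1 / 2 * (2 * Q (coordVec i) (coordVec j)) := by rw [← hQ]; rfl
    rw [this]; ring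
  let B := P v - R
  have hmul : ∀ (y : EuclideanSpace ℝ (Fin n)) i, A.mulVec y i = Q (coordVec i) y := by
    intro y i
    rw [← sum_mul_coordVec (Q (coordVec i)) y]
    simp [Matrix.mulVec, dotProduct, hAQ, mul_comm]
  have hinj : Function.Injective A.mulVec := by
    rw [← Matrix.coe_mulVecLin, injective_iff_map_eq_zero]
    intro y hy
    have h1 : ∀ i, Q (coordVec i) (WithLp.toLp 2 y) = 0 := fun i ↦ by
      rw [← hmul]; exact congrFun hy i
    have h2 := hdef (WithLp.toLp 2 y) (by
      have := sum_mul_coordVec (Q.flip (WithLp.toLp 2 y)) (WithLp.toLp 2 y)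
      simpa [h1] using this.symm)
    simpa using h2
  have hunit : IsUnit A := Matrix.mulVec_injective_iff_isUnit.1 hinj
  have hdet : IsUnit A.det := (Matrix.isUnit_iff_isUnit_det A).1 hunit
  have hspray : ∀ i, 2 * spray F e i u v = A⁻¹.mulVec (fun l ↦ B (coordVec l)) i := by
    intro i
    have : ∀ l, ((∑ k, v k * partialX k (partialY l (localSq F e)) u v)
      - partialX l (localSq F e) u v) = 2 * B (coordVec l) := by
      intro l
      have h1 : ∀ k, partialX k (partialY l (localSq F e)) u v = 2 * P (coordVec k) (coordVec l) :=
        fun k ↦ hP _ _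
      have h2 : partialX l (localSq F e) u v = 2 * R (coordVec l) := hR _
      have h3 := sum_mul_coordVec (P.flip (coordVec l)) v
      simp only [ContinuousLinearMap.flip_apply] at h3
      have h4 : B (coordVec l) = P v (coordVec l) - R (coordVec l) := rfl
      rw [h2, h4, ← h3, mul_sub, Finset.mul_sum]
      congr 1
      exact Finset.sum_congr rfl fun k _ ↦ by rw [h1]; ring
    simp only [spray, this, Matrix.mulVec, dotProduct, Finset.mul_sum, ← hA]
    exact Finset.sum_congr rfl fun l _ ↦ by ring
  have h1 : (∀ i, z i + 2 * spray F e i u v = 0) ↔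
      (z : Fin n → ℝ) + A⁻¹.mulVec (fun l ↦ B (coordVec l)) = 0 := by
    simp [funext_iff, hspray]
  have h2 : (∀ w, Q w z + P v w - R w = 0) ↔ A.mulVec z + (fun l ↦ B (coordVec l)) = 0 := by
    have hB : ∀ w, P v w - R w = B w := fun _ ↦ rfl
    simp only [funext_iff, Pi.add_apply, hmul, Pi.zero_apply, add_sub_assoc, hB]
    refine ⟨fun h i ↦ h _, fun h w ↦ ?_⟩
    have h3 := sum_mul_coordVec (Q.flip z + B) w
    simp only [add_apply, ContinuousLinearMap.flip_apply, h, mul_zero,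
      Finset.sum_const_zero] at h3
    exact h3.symm
  rw [h1, h2]
  constructor
  · intro h
    have := congrArg A.mulVec h
    rwa [Matrix.mulVec_add, Matrix.mulVec_mulVec, Matrix.mul_nonsing_inv _ hdet,
      Matrix.one_mulVec, Matrix.mulVec_zero] at this
  · intro h
    have := congrArg A⁻¹.mulVec h
    rwa [Matrix.mulVec_add, Matrix.mulVec_mulVec, Matrix.nonsing_inv_mul _ hdet,
      Matrix.one_mulVec, Matrix.mulVec_zero] at this

variable {F : TangentFun n M}
  {G : EuclideanSpace ℝ (Fin n) → EuclideanSpace ℝ (Fin n) →L[ℝ] EuclideanSpace ℝ (Fin n) →L[ℝ] ℝ}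
  {b : EuclideanSpace ℝ (Fin n) → EuclideanSpace ℝ (Fin n) →L[ℝ] ℝ}
  {u v z : EuclideanSpace ℝ (Fin n)}
  {DG : EuclideanSpace ℝ (Fin n) →L[ℝ] EuclideanSpace ℝ (Fin n) →L[ℝ]
    EuclideanSpace ℝ (Fin n) →L[ℝ] ℝ}
  {Db : EuclideanSpace ℝ (Fin n) →L[ℝ] EuclideanSpace ℝ (Fin n) →L[ℝ] ℝ}

lemma geodesicEquation_quadratic_iff (hF : ∀ u v, localSq F e u v = G u v v)
    (hu : u ∈ range (𝓡∂ n))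
    (hsymm : ∀ᶠ u' in 𝓝[range (𝓡∂ n)] u, ∀ v w, G u' v w = G u' w v)
    (hpos : ∀ w, w ≠ 0 → 0 < G u w w)
    (hG : HasFDerivWithinAt G DG (range (𝓡∂ n)) u) :
    (∀ i, z i + 2 * spray F e i u v = 0) ↔
      ∀ w, G u z w + DG v v w - 1 / 2 * DG w v v = 0 := by
  have hs := hsymm.self_of_nhdsWithin hu
  have hU : UniqueDiffWithinAt ℝ (range (𝓡∂ n)) u := (𝓡∂ n).uniqueDiffOn u hu
  rw [geodesicEquation_iff (G u) (DG.flip v) ((1 / 2 : ℝ) • (DG.flip v).flip v)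
    (fun k l ↦ dirY_dirY_quadratic hF hs k l)
    (fun k l ↦ dirX_dirY_quadratic hF hU hu hsymm hG k l)
    (fun k ↦ (dirX_quadratic hF hU hG k).trans (by simp))
    (fun w hw ↦ by_contra fun h ↦ (hpos w h).ne' hw)]
  refine forall_congr' fun w ↦ ?_
  simp [hs w z]

lemma geodesicEquation_randers (hF : ∀ u v, localSq F e u v = randersNorm G b u v ^ 2)
    (hu : u ∈ range (𝓡∂ n))
    (hsymm : ∀ᶠ u' in 𝓝[range (𝓡∂ n)] u, ∀ v w, G u' v w = G u' w v)
    (hpos : ∀ w, w ≠ 0 → 0 < G u w w)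
    (hG : HasFDerivWithinAt G DG (range (𝓡∂ n)) u)
    (hb : HasFDerivWithinAt b Db (range (𝓡∂ n)) u)
    (hv : v ≠ 0) (hN : 0 < randersNorm G b u v) (hDb : ∀ k l, Db k l = Db l k) {μ : ℝ}
    (hz : ∀ w, G u z w + DG v v w - 1 / 2 * DG w v v = μ * G u v w)
    (hμ : μ * √(G u v v) + b u z + Db v v = 0) :
    ∀ i, z i + 2 * spray F e i u v = 0 := by
  have hs := hsymm.self_of_nhdsWithin hu
  have hU : UniqueDiffWithinAt ℝ (range (𝓡∂ n)) u := (𝓡∂ n).uniqueDiffOn u hu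
  rw [geodesicEquation_iff (randersTensor G b u v) (randersMixed G b DG Db u v)
    (randersForce G b DG Db u v)
    (fun k l ↦ dirY_dirY_randers hF hs (hpos v hv) k l)
    (fun k l ↦ (dirX_dirY_randers hF hU hu hsymm hG hb (hpos v hv) k l).trans
      (by rw [randersMixed_apply]))
    (fun k ↦ (dirX_randers hF hU hG hb (hpos v hv) k).trans (by rw [randersForce_apply]))
    (fun w hw ↦ eq_zero_of_randersTensor_eq_zero hs hpos hv hN hw)]
  exact eulerLagrange_randers hs (hpos v hv) hDb hz hμ

end Spray

/-! ### Smooth reparametrisations of the unit interval. -/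

section Reparametrisation

/-- A smooth function on `[0, 1]` with positive derivative and end values `0`, `1` has a smooth
inverse. -/
lemma exists_smooth_inverse {σ : ℝ → ℝ} (hσ : ContDiffOn ℝ ∞ σ (Icc 0 1))
    (hpos : ∀ t ∈ Icc (0 : ℝ) 1, 0 < derivWithin σ (Icc 0 1) t) (h0 : σ 0 = 0) (h1 : σ 1 = 1) :
    ∃ τ : ℝ → ℝ, ContDiffOn ℝ ∞ τ (Icc 0 1) ∧ MapsTo τ (Icc 0 1) (Icc 0 1) ∧ τ 0 = 0 ∧ τ 1 = 1 ∧
      (∀ s ∈ Icc (0 : ℝ) 1, σ (τ s) = s) ∧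
      ∀ s ∈ Icc (0 : ℝ) 1,
        derivWithin τ (Icc 0 1) s = (derivWithin σ (Icc 0 1) (τ s))⁻¹ := by
  have hU : UniqueDiffOn ℝ (Icc (0 : ℝ) 1) := uniqueDiffOn_Icc zero_lt_one
  have hmono : StrictMonoOn σ (Icc 0 1) := by
    refine strictMonoOn_of_deriv_pos (convex_Icc 0 1) hσ.continuousOn fun x hx ↦ ?_
    have hx' := interior_subset hx
    rw [interior_Icc] at hx
    rw [← derivWithin_of_mem_nhds (Icc_mem_nhds hx.1 hx.2)]
    exact hpos x hx'
  have hm0 : (0 : ℝ) ∈ Icc (0 : ℝ) 1 := by simp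
  have hm1 : (1 : ℝ) ∈ Icc (0 : ℝ) 1 := by simp
  have himg : σ '' Icc 0 1 = Icc 0 1 := by
    apply Subset.antisymm
    · rintro _ ⟨t, ht, rfl⟩
      exact ⟨h0 ▸ hmono.monotoneOn hm0 ht ht.1, h1 ▸ hmono.monotoneOn ht hm1 ht.2⟩
    · have := intermediate_value_Icc zero_le_one hσ.continuousOn
      rwa [h0, h1] at this
  let τ := Function.invFunOn σ (Icc 0 1)
  have hτmaps : MapsTo τ (Icc 0 1) (Icc 0 1) := fun s hs ↦
    Function.invFunOn_mem (himg.ge hs)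
  have hτσ : ∀ s ∈ Icc (0 : ℝ) 1, σ (τ s) = s := fun s hs ↦
    Function.invFunOn_eq (himg.ge hs)
  have hστ : ∀ t ∈ Icc (0 : ℝ) 1, τ (σ t) = t := fun t ht ↦ by
    have hs : σ t ∈ Icc (0 : ℝ) 1 := himg ▸ mem_image_of_mem σ ht
    exact hmono.injOn (hτmaps hs) ht (hτσ _ hs)
  -- By compactness `σ` sends closed sets to closed sets, and these images are the preimages under
  -- `τ`.
  have hcont : ContinuousOn τ (Icc 0 1) := by
    rw [continuousOn_iff_isClosed]
    intro C hC
    refine ⟨σ '' (Icc 0 1 ∩ C), ((isCompact_Icc.inter_right hC).image_of_continuousOn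
      (hσ.continuousOn.mono inter_subset_left)).isClosed, ?_⟩
    ext s
    constructor
    · rintro ⟨h, hs⟩
      exact ⟨⟨τ s, ⟨hτmaps hs, h⟩, hτσ s hs⟩, hs⟩
    · rintro ⟨⟨t, ⟨ht, htC⟩, rfl⟩, hs⟩
      refine ⟨?_, hs⟩
      rw [mem_preimage, hστ t ht]
      exact htC
  have hderiv : ∀ s ∈ Icc (0 : ℝ) 1,
      HasDerivWithinAt τ (derivWithin σ (Icc 0 1) (τ s))⁻¹ (Icc 0 1) s := by
    intro s hs
    have hd := ((hσ.differentiableOn (by simp)) _ (hτmaps hs)).hasDerivWithinAt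
    have hne := (hpos _ (hτmaps hs)).ne'
    have hd' := hd.hasFDerivWithinAt
    refine (HasFDerivWithinAt.of_local_left_inverse (𝕜 := ℝ)
      (f' := ContinuousLinearEquiv.unitsEquivAut ℝ (Units.mk0 _ hne)) (f := σ) (t := Icc 0 1)
      ?_ ?_ hs ?_).hasDerivWithinAt.congr_deriv ?_
    · exact tendsto_nhdsWithin_iff.2 ⟨hcont s hs, by
        filter_upwards [self_mem_nhdsWithin] with r hr using hτmaps hr⟩
    · refine hd'.congr_fderiv ?_
      ext
      simp
    · filter_upwards [self_mem_nhdsWithin] with r hr using hτσ r hr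
    · simp [ContinuousLinearEquiv.unitsEquivAut]
  have hdw : ∀ s ∈ Icc (0 : ℝ) 1,
      derivWithin τ (Icc 0 1) s = (derivWithin σ (Icc 0 1) (τ s))⁻¹ := fun s hs ↦
    (hderiv s hs).derivWithin (hU s hs)
  have hσ' : ContDiffOn ℝ ∞ (derivWithin σ (Icc 0 1)) (Icc 0 1) :=
    ((contDiffOn_infty_iff_derivWithin hU).1 hσ).2
  -- Bootstrapping: the derivative of `τ` is the inverse of `σ' ∘ τ`, so it is as regular as `τ` and
  -- each step gains one order.
  have hsmooth : ∀ n : ℕ, ContDiffOn ℝ n τ (Icc 0 1) := by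
    intro n
    induction n with
    | zero => exact contDiffOn_zero.2 hcont
    | succ n ih =>
      rw [Nat.cast_succ, contDiffOn_succ_iff_derivWithin hU]
      refine ⟨fun s hs ↦ (hderiv s hs).differentiableWithinAt, by simp, ?_⟩
      refine ContDiffOn.congr ?_ hdw
      exact ((hσ'.of_le (by exact_mod_cast le_top)).comp ih hτmaps).inv
        fun s hs ↦ (hpos _ (hτmaps hs)).ne'
  refine ⟨τ, contDiffOn_infty.2 hsmooth, hτmaps, ?_, ?_, hτσ, hdw⟩
  · have := hστ 0 hm0; rwa [h0] at this
  · have := hστ 1 hm1; rwa [h1] at this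

variable {E : Type*} [NormedAddCommGroup E] [NormedSpace ℝ E] {x : ℝ → E} {τ : ℝ → ℝ} {s : Set ℝ}
  {t : ℝ}

lemma contDiffWithinAt_derivWithin (hs : UniqueDiffOn ℝ s) (ht : t ∈ s)
    (hx : ContDiffWithinAt ℝ ∞ x s t) :
    ContDiffWithinAt ℝ ∞ (derivWithin x s) s t :=
  (hx.fderivWithin_right (m := ∞) hs (by simp) ht).clm_apply contDiffWithinAt_const

lemma hasDerivWithinAt_derivWithin (hs : UniqueDiffOn ℝ s) (ht : t ∈ s)
    (hx : ContDiffWithinAt ℝ ∞ x s t) :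
    HasDerivWithinAt (derivWithin x s) (derivWithin (derivWithin x s) s t) s t :=
  ((contDiffWithinAt_derivWithin hs ht hx).differentiableWithinAt (by simp)).hasDerivWithinAt

lemma derivWithin_comp_reparam (hs : UniqueDiffOn ℝ s) (ht : t ∈ s)
    (hx : ContDiffWithinAt ℝ ∞ x s (τ t)) (hτ : ContDiffOn ℝ ∞ τ s) (hm : MapsTo τ s s) :
    derivWithin (x ∘ τ) s t = derivWithin τ s t • derivWithin x s (τ t) :=
  ((hx.differentiableWithinAt (by simp)).hasDerivWithinAt.scomp t
    ((hτ.differentiableOn (by simp)) t ht).hasDerivWithinAt hm).derivWithin (hs t ht)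

lemma derivWithin_derivWithin_comp_reparam (hs : UniqueDiffOn ℝ s) (ht : t ∈ s)
    (hx : ∀ᶠ r in 𝓝[s] (τ t), ContDiffWithinAt ℝ ∞ x s r) (hτ : ContDiffOn ℝ ∞ τ s)
    (hm : MapsTo τ s s) :
    derivWithin (derivWithin (x ∘ τ) s) s t = derivWithin (derivWithin τ s) s t •
      derivWithin x s (τ t) + derivWithin τ s t ^ 2 • derivWithin (derivWithin x s) s (τ t) := by
  have hx0 := hx.self_of_nhdsWithin (hm ht)
  have hc : Filter.Tendsto τ (𝓝[s] t) (𝓝[s] (τ t)) :=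
    tendsto_nhdsWithin_iff.2 ⟨hτ.continuousOn t ht, by
      filter_upwards [self_mem_nhdsWithin] with r hr using hm hr⟩
  have h1 : derivWithin (x ∘ τ) s =ᶠ[𝓝[s] t]
      fun r ↦ derivWithin τ s r • derivWithin x s (τ r) := by
    filter_upwards [hc.eventually hx, self_mem_nhdsWithin] with r hr hrs
    exact derivWithin_comp_reparam hs hrs hr hτ hm
  have h2 := hasDerivWithinAt_derivWithin hs ht (hτ t ht)
  have h3 : HasDerivWithinAt (fun r ↦ derivWithin x s (τ r)) _ s t :=
    (hasDerivWithinAt_derivWithin hs (hm ht) hx0).scomp t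
      ((hτ.differentiableOn (by simp)) t ht).hasDerivWithinAt hm
  have h4 := (h2.smul h3).congr_of_eventuallyEq_of_mem h1 ht
  rw [h4.derivWithin (hs t ht), smul_smul, sq, add_comm]

end Reparametrisation

/-! ### Curves in charts and the energy functional. -/

section Generic

variable {E : Type*} [NormedAddCommGroup E] [NormedSpace ℝ E] {H : Type*} [TopologicalSpace H]
  {I : ModelWithCorners ℝ E H} {M : Type*} [TopologicalSpace M] [ChartedSpace H M]
  [IsManifold I ∞ M] {e : OpenPartialHomeomorph M H}
  {g : (x : M) → TangentSpace I x →L[ℝ] TangentSpace I x →L[ℝ] ℝ}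
  {γ : ℝ → M} {t : ℝ} {u : E}

lemma chartForm_pos (hg : ∀ x v, v ≠ 0 → 0 < g x v v)
    (he : e ∈ IsManifold.maximalAtlas I ∞ M)
    (hu : u ∈ (e.extend I).target) {v : E} (hv : v ≠ 0) :
    0 < chartForm e g u v v := by
  rw [chartForm_apply]
  refine hg _ _ fun h ↦ hv ?_
  exact frame_injective he hu (h.trans (map_zero (frame I e u)).symm)

lemma hasFDerivWithinAt_of_contDiffOn_target {X : Type*} [NormedAddCommGroup X] [NormedSpace ℝ X]
    {f : E → X} (hf : ContDiffOn ℝ ∞ f (e.extend I).target)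
    (hu : u ∈ (e.extend I).target) :
    HasFDerivWithinAt f (fderivWithin ℝ f (range I) u) (range I) u :=
  (((hf u hu).mono_of_mem_nhdsWithin
    (extend_target_mem_nhdsWithin' hu)).differentiableWithinAt (by simp)).hasFDerivWithinAt

/-- The Euler-Lagrange operator of the energy of a quadratic form field on a subset of a vector
space. -/
def energyEL (S : Set E) (G : E → E →L[ℝ] E →L[ℝ] ℝ) (u v z w : E) : ℝ :=
  G u z w + fderivWithin ℝ G S u v v w - 1 / 2 * fderivWithin ℝ G S u w v v

/-- The acceleration enters linearly and the velocity quadratically, so a reparametrised geodesic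
fails the equation only by a multiple of `G u v`. -/
lemma energyEL_reparam (S : Set E) (G : E → E →L[ℝ] E →L[ℝ] ℝ) (u v z w : E) (a b : ℝ) :
    energyEL S G u (a • v) (b • v + a ^ 2 • z) w = a ^ 2 * energyEL S G u v z w + b * G u v w := by
  simp only [energyEL, map_add, map_smul, add_apply, smul_apply, smul_eq_mul]
  ring

variable (I) in
/-- The coordinate expression of a curve. -/
def coordCurve (e : OpenPartialHomeomorph M H) (γ : ℝ → M) (t : ℝ) : E := e.extend I (γ t)

variable (I) in
/-- The velocity of a curve on `[0, 1]`. -/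
def velocity (γ : ℝ → M) (t : ℝ) : TangentSpace I (γ t) :=
  mfderivWithin 𝓘(ℝ, ℝ) I γ (Icc 0 1) t (1 : ℝ)

lemma coordCurve_mem_target (hte : γ t ∈ e.source) :
    coordCurve I e γ t ∈ (e.extend I).target :=
  (e.extend I).map_source (by rwa [e.extend_source])

lemma tangentFun_velocity (F : (x : M) → TangentSpace I x → ℝ)
    (he : e ∈ IsManifold.maximalAtlas I ∞ M)
    (hγ : ContMDiffOn 𝓘(ℝ, ℝ) I ∞ γ (Icc 0 1)) (ht : t ∈ Icc (0 : ℝ) 1)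
    (hte : γ t ∈ e.source) :
    F (γ t) (velocity I γ t) = F ((e.extend I).symm (coordCurve I e γ t))
      (frame I e (coordCurve I e γ t) (derivWithin (coordCurve I e γ) (Icc 0 1) t)) :=
  tangentFun_congr F (e.extend_left_inv hte).symm
    (mfderivWithin_curve he hγ ht (uniqueDiffOn_Icc zero_lt_one t ht) hte)

lemma form_velocity (he : e ∈ IsManifold.maximalAtlas I ∞ M)
    (hγ : ContMDiffOn 𝓘(ℝ, ℝ) I ∞ γ (Icc 0 1)) (ht : t ∈ Icc (0 : ℝ) 1)
    (hte : γ t ∈ e.source) :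
    g (γ t) (velocity I γ t) (velocity I γ t) = chartForm e g (coordCurve I e γ t)
      (derivWithin (coordCurve I e γ) (Icc 0 1) t)
      (derivWithin (coordCurve I e γ) (Icc 0 1) t) := by
  rw [chartForm_apply]
  exact tangentFun_velocity (fun x y ↦ g x y y) he hγ ht hte

lemma covector_velocity {β : (x : M) → TangentSpace I x →L[ℝ] ℝ}
    (he : e ∈ IsManifold.maximalAtlas I ∞ M)
    (hγ : ContMDiffOn 𝓘(ℝ, ℝ) I ∞ γ (Icc 0 1)) (ht : t ∈ Icc (0 : ℝ) 1)
    (hte : γ t ∈ e.source) :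
    β (γ t) (velocity I γ t) = chartCovector e β (coordCurve I e γ t)
      (derivWithin (coordCurve I e γ) (Icc 0 1) t) := by
  rw [chartCovector_apply]
  exact tangentFun_velocity (fun x y ↦ β x y) he hγ ht hte

lemma contDiffWithinAt_coordCurve (he : e ∈ IsManifold.maximalAtlas I ∞ M)
    (hγ : ContMDiffOn 𝓘(ℝ, ℝ) I ∞ γ (Icc 0 1)) (ht : t ∈ Icc (0 : ℝ) 1)
    (hte : γ t ∈ e.source) : ContDiffWithinAt ℝ ∞ (coordCurve I e γ) (Icc 0 1) t :=
  contDiffWithinAt_extend_comp he hγ ht hte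

lemma eventually_contDiffWithinAt_coordCurve (he : e ∈ IsManifold.maximalAtlas I ∞ M)
    (hγ : ContMDiffOn 𝓘(ℝ, ℝ) I ∞ γ (Icc 0 1)) (ht : t ∈ Icc (0 : ℝ) 1)
    (hte : γ t ∈ e.source) :
    ∀ᶠ r in 𝓝[Icc 0 1] t, ContDiffWithinAt ℝ ∞ (coordCurve I e γ) (Icc 0 1) r := by
  filter_upwards [eventually_mem_source (hγ t ht).continuousWithinAt hte, self_mem_nhdsWithin]
    with r hr hr'
  exact contDiffWithinAt_coordCurve he hγ hr' hr

lemma hasDerivWithinAt_coordCurve (he : e ∈ IsManifold.maximalAtlas I ∞ M)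
    (hγ : ContMDiffOn 𝓘(ℝ, ℝ) I ∞ γ (Icc 0 1)) (ht : t ∈ Icc (0 : ℝ) 1)
    (hte : γ t ∈ e.source) :
    HasDerivWithinAt (coordCurve I e γ) (derivWithin (coordCurve I e γ) (Icc 0 1) t) (Icc 0 1) t :=
  ((contDiffWithinAt_coordCurve he hγ ht hte).differentiableWithinAt
    (by simp)).hasDerivWithinAt

lemma hasDerivWithinAt_comp_coordCurve {X : Type*} [NormedAddCommGroup X] [NormedSpace ℝ X]
    {f : E → X} (hf : ContDiffOn ℝ ∞ f (e.extend I).target)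
    (he : e ∈ IsManifold.maximalAtlas I ∞ M)
    (hγ : ContMDiffOn 𝓘(ℝ, ℝ) I ∞ γ (Icc 0 1)) (ht : t ∈ Icc (0 : ℝ) 1)
    (hte : γ t ∈ e.source) :
    HasDerivWithinAt (fun r ↦ f (coordCurve I e γ r))
      (fderivWithin ℝ f (range I) (coordCurve I e γ t)
        (derivWithin (coordCurve I e γ) (Icc 0 1) t)) (Icc 0 1) t :=
  (hasFDerivWithinAt_of_contDiffOn_target hf (coordCurve_mem_target hte)).comp_hasDerivWithinAt t
    (hasDerivWithinAt_coordCurve he hγ ht hte) fun _ _ ↦ mem_range_self _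

variable (g) in
/-- The geodesic equation of a symmetric bilinear field at one time in one chart. -/
def GeodesicAt (e : OpenPartialHomeomorph M H) (γ : ℝ → M) (t : ℝ) : Prop :=
  ∀ w, energyEL (range I) (chartForm e g) (coordCurve I e γ t)
    (derivWithin (coordCurve I e γ) (Icc 0 1) t)
    (derivWithin (derivWithin (coordCurve I e γ) (Icc 0 1)) (Icc 0 1) t) w = 0

/-- Conservation of energy: the Euler-Lagrange expression tested against the velocity itself is half
the derivative of the squared speed. -/
lemma hasDerivWithinAt_speedSq (hsymm : ∀ x v w, g x v w = g x w v)
    (he : e ∈ IsManifold.maximalAtlas I ∞ M)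
    (hG : ContDiffOn ℝ ∞ (chartForm e g) (e.extend I).target)
    (hγ : ContMDiffOn 𝓘(ℝ, ℝ) I ∞ γ (Icc 0 1)) (ht : t ∈ Icc (0 : ℝ) 1)
    (hte : γ t ∈ e.source) (h : GeodesicAt g e γ t) :
    HasDerivWithinAt (fun r ↦ g (γ r) (velocity I γ r) (velocity I γ r)) 0 (Icc 0 1) t := by
  have hEL := h (derivWithin (coordCurve I e γ) (Icc 0 1) t)
  have hU := uniqueDiffOn_Icc (zero_lt_one (α := ℝ))
  have h1 := hasDerivWithinAt_comp_coordCurve hG he hγ ht hte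
  have h2 := hasDerivWithinAt_derivWithin hU ht (contDiffWithinAt_coordCurve he hγ ht hte)
  have h3 := (h1.clm_apply h2).clm_apply h2
  have h4 : (fun r ↦ g (γ r) (velocity I γ r) (velocity I γ r)) =ᶠ[𝓝[Icc 0 1] t]
      fun r ↦ chartForm e g (coordCurve I e γ r) (derivWithin (coordCurve I e γ) (Icc 0 1) r)
        (derivWithin (coordCurve I e γ) (Icc 0 1) r) := by
    filter_upwards [eventually_mem_source (hγ t ht).continuousWithinAt hte,
      self_mem_nhdsWithin] with r hr hr'
    exact form_velocity he hγ hr' hr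
  refine (h3.congr_of_eventuallyEq_of_mem h4 ht).congr_deriv ?_
  · unfold energyEL at hEL
    have hs : chartForm e g (coordCurve I e γ t) (derivWithin (coordCurve I e γ) (Icc 0 1) t)
      (derivWithin (derivWithin (coordCurve I e γ) (Icc 0 1)) (Icc 0 1) t) =
      chartForm e g (coordCurve I e γ t)
      (derivWithin (derivWithin (coordCurve I e γ) (Icc 0 1)) (Icc 0 1) t)
      (derivWithin (coordCurve I e γ) (Icc 0 1) t) := by
      simp only [chartForm_apply,
        hsymm _ (frame I e _ (derivWithin (coordCurve I e γ) (Icc 0 1) t))]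
    simp only [add_apply]
    rw [hs]
    linarith

/-- Composition with a reparametrisation in a chart. -/
lemma coordCurve_reparam {τ : ℝ → ℝ} (he : e ∈ IsManifold.maximalAtlas I ∞ M)
    (hγ : ContMDiffOn 𝓘(ℝ, ℝ) I ∞ γ (Icc 0 1)) (hτ : ContDiffOn ℝ ∞ τ (Icc 0 1))
    (hm : MapsTo τ (Icc 0 1) (Icc 0 1)) (ht : t ∈ Icc (0 : ℝ) 1)
    (hte : γ (τ t) ∈ e.source) :
    derivWithin (coordCurve I e (γ ∘ τ)) (Icc 0 1) t =
        derivWithin τ (Icc 0 1) t • derivWithin (coordCurve I e γ) (Icc 0 1) (τ t) ∧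
      derivWithin (derivWithin (coordCurve I e (γ ∘ τ)) (Icc 0 1)) (Icc 0 1) t =
        derivWithin (derivWithin τ (Icc 0 1)) (Icc 0 1) t •
          derivWithin (coordCurve I e γ) (Icc 0 1) (τ t) +
        derivWithin τ (Icc 0 1) t ^ 2 •
          derivWithin (derivWithin (coordCurve I e γ) (Icc 0 1)) (Icc 0 1) (τ t) :=
  have hU := uniqueDiffOn_Icc (zero_lt_one (α := ℝ))
  ⟨derivWithin_comp_reparam hU ht (contDiffWithinAt_coordCurve he hγ (hm ht) hte) hτ hm,
    derivWithin_derivWithin_comp_reparam hU ht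
      (eventually_contDiffWithinAt_coordCurve he hγ (hm ht) hte) hτ hm⟩

lemma contMDiffOn_reparam {τ : ℝ → ℝ}
    (hγ : ContMDiffOn 𝓘(ℝ, ℝ) I ∞ γ (Icc 0 1)) (hτ : ContDiffOn ℝ ∞ τ (Icc 0 1))
    (hm : MapsTo τ (Icc 0 1) (Icc 0 1)) : ContMDiffOn 𝓘(ℝ, ℝ) I ∞ (γ ∘ τ) (Icc 0 1) :=
  hγ.comp hτ.contMDiffOn hm

lemma velocity_reparam {τ : ℝ → ℝ}
    (hγ : ContMDiffOn 𝓘(ℝ, ℝ) I ∞ γ (Icc 0 1)) (hτ : ContDiffOn ℝ ∞ τ (Icc 0 1))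
    (hm : MapsTo τ (Icc 0 1) (Icc 0 1)) (ht : t ∈ Icc (0 : ℝ) 1) :
    velocity I (γ ∘ τ) t = derivWithin τ (Icc 0 1) t • velocity I γ (τ t) := by
  have hU : UniqueMDiffWithinAt 𝓘(ℝ, ℝ) (Icc (0 : ℝ) 1) t :=
    (uniqueDiffOn_Icc zero_lt_one t ht).uniqueMDiffWithinAt
  have h1 := ((hτ.differentiableOn
    (by simp)) t ht).hasDerivWithinAt.hasFDerivWithinAt.hasMFDerivWithinAt
  have h2 := ((hγ _ (hm ht)).mdifferentiableWithinAt (by simp)).hasMFDerivWithinAt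
  have h3 := (h2.comp t h1 hm).mfderivWithin hU
  unfold velocity
  rw [h3]
  have h4 : derivWithin τ (Icc 0 1) t • (1 : ℝ) = derivWithin τ (Icc 0 1) t := by simp
  have h5 : ContinuousLinearMap.toSpanSingleton ℝ (derivWithin τ (Icc 0 1) t) (1 : ℝ) =
    derivWithin τ (Icc 0 1) t • (1 : ℝ) := by simp
  exact (congrArg (mfderivWithin 𝓘(ℝ, ℝ) I γ (Icc 0 1) (τ t)) h5).trans (map_smul _ _ _)

/-- The derivative of a function along a curve. -/
lemma hasDerivWithinAt_comp_curve {f : M → ℝ} (hf : ContMDiff I 𝓘(ℝ, ℝ) ∞ f)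
    (hγ : ContMDiffOn 𝓘(ℝ, ℝ) I ∞ γ (Icc 0 1)) (ht : t ∈ Icc (0 : ℝ) 1) :
    HasDerivWithinAt (fun r ↦ f (γ r)) (mfderiv I 𝓘(ℝ, ℝ) f (γ t) (velocity I γ t))
      (Icc 0 1) t := by
  have h1 := ((hf (γ t)).mdifferentiableAt (by simp)).hasMFDerivAt
  have h2 := ((hγ t ht).mdifferentiableWithinAt (by simp)).hasMFDerivWithinAt
  have h3 := h1.comp_hasMFDerivWithinAt t h2
  let L : ℝ →L[ℝ] ℝ := (mfderiv I 𝓘(ℝ, ℝ) f (γ t)).comp (mfderivWithin 𝓘(ℝ, ℝ) I γ (Icc 0 1) t)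
  have h4 : HasFDerivWithinAt (fun r ↦ f (γ r)) L (Icc 0 1) t := h3.hasFDerivWithinAt
  exact h4.hasDerivWithinAt

lemma contDiffOn_comp_curve {f : M → ℝ} (hf : ContMDiff I 𝓘(ℝ, ℝ) ∞ f)
    (hγ : ContMDiffOn 𝓘(ℝ, ℝ) I ∞ γ (Icc 0 1)) : ContDiffOn ℝ ∞ (fun r ↦ f (γ r)) (Icc 0 1) :=
  (hf.comp_contMDiffOn hγ).contDiffOn

end Generic

/-! ### Symmetry of the derivative of an exact form; curves with zero velocity. -/

section Generic

variable {E : Type*} [NormedAddCommGroup E] [NormedSpace ℝ E] {H : Type*} [TopologicalSpace H]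
  {I : ModelWithCorners ℝ E H} {M : Type*} [TopologicalSpace M] [ChartedSpace H M]
  [IsManifold I ∞ M] {e : OpenPartialHomeomorph M H}
  {γ : ℝ → M} {t : ℝ} {u : E}

lemma chartCovector_eq_fderivWithin {f : M → ℝ} (hf : ContMDiff I 𝓘(ℝ, ℝ) ∞ f)
    {β : (x : M) → TangentSpace I x →L[ℝ] ℝ} (hβ : ∀ x, β x = mfderiv I 𝓘(ℝ, ℝ) f x)
    (he : e ∈ IsManifold.maximalAtlas I ∞ M) (hu : u ∈ (e.extend I).target) :
    chartCovector e β u = fderivWithin ℝ (fun u ↦ f ((e.extend I).symm u)) (range I) u := by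
  ext v
  rw [fderivWithin_comp_extend_symm hf he hu, chartCovector_apply, hβ]
  rfl

/-- In coordinates `β` is the derivative of `f`, so this is the symmetry of second derivatives. It
persists at the boundary because `range I` lies in the closure of its interior. -/
lemma fderivWithin_chartCovector_symm {f : M → ℝ} (hf : ContMDiff I 𝓘(ℝ, ℝ) ∞ f)
    {β : (x : M) → TangentSpace I x →L[ℝ] ℝ} (hβ : ∀ x, β x = mfderiv I 𝓘(ℝ, ℝ) f x)
    (he : e ∈ IsManifold.maximalAtlas I ∞ M) (hu : u ∈ (e.extend I).target) (v w : E) :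
    fderivWithin ℝ (chartCovector e β) (range I) u v w =
      fderivWithin ℝ (chartCovector e β) (range I) u w v := by
  have hur := e.extend_target_subset_range hu
  have h1 : chartCovector e β =ᶠ[𝓝[range I] u]
      fderivWithin ℝ (fun u ↦ f ((e.extend I).symm u)) (range I) := by
    filter_upwards [extend_target_mem_nhdsWithin' hu] with y hy
    exact chartCovector_eq_fderivWithin hf hβ he hy
  rw [h1.fderivWithin_eq (chartCovector_eq_fderivWithin hf hβ he hu)]
  have h2 : ContDiffWithinAt ℝ ∞ (fun u ↦ f ((e.extend I).symm u)) (range I) u :=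
    (contDiffOn_comp_extend_symm hf he u hu).mono_of_mem_nhdsWithin
      (extend_target_mem_nhdsWithin' hu)
  exact (h2.isSymmSndFDerivWithinAt (by
    rw [minSmoothness_of_isRCLikeNormedField]
    exact WithTop.coe_le_coe.2 (le_top (a := (2 : ℕ∞)))) I.uniqueDiffOn
    (I.range_subset_closure_interior hur) hur) v w

/-- In a chart the coordinate curve has zero derivative on a convex piece of the interval, so the
curve is locally constant, and `[0, 1]` is connected. -/
lemma curve_const_of_velocity_eq_zero (hγ : ContMDiffOn 𝓘(ℝ, ℝ) I ∞ γ (Icc 0 1))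
    (h : ∀ t ∈ Icc (0 : ℝ) 1, velocity I γ t = 0) : γ 0 = γ 1 := by
  let γ' : Icc (0 : ℝ) 1 → M := fun t ↦ γ t
  have hloc : IsLocallyConstant γ' := by
    rw [IsLocallyConstant.iff_eventually_eq]
    rintro ⟨t, ht⟩
    let e := chartAt H (γ t)
    have he : e ∈ IsManifold.maximalAtlas I ∞ M := IsManifold.chart_mem_maximalAtlas _
    have hte : γ t ∈ e.source := mem_chart_source _ _
    obtain ⟨ε, hε, hball⟩ := Metric.mem_nhdsWithin_iff.1
      (eventually_mem_source (hγ t ht).continuousWithinAt hte)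
    have hd : ∀ r ∈ Metric.ball t ε ∩ Icc 0 1, HasDerivWithinAt (coordCurve I e γ) 0
        (Metric.ball t ε ∩ Icc 0 1) r := by
      intro r hr
      have h1 := hasDerivWithinAt_coordCurve he hγ hr.2 (hball hr)
      have h2 : derivWithin (coordCurve I e γ) (Icc 0 1) r = 0 := by
        refine frame_injective (I := I) he (coordCurve_mem_target (hball hr)) ?_
        rw [map_zero]
        exact (mfderivWithin_curve he hγ hr.2 (uniqueDiffOn_Icc zero_lt_one r hr.2)
          (hball hr)).symm.trans (h r hr.2)
      rw [h2] at h1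
      exact h1.mono inter_subset_right
    have hconst : ∀ r ∈ Metric.ball t ε ∩ Icc 0 1, γ r = γ t := by
      intro r hr
      have h1 := ((convex_ball t ε).inter (convex_Icc 0 1)
        ).norm_image_sub_le_of_norm_hasDerivWithin_le (C := 0) hd (by simp) ⟨Metric.mem_ball_self hε, ht⟩ hr
      have h2 : e.extend I (γ r) = e.extend I (γ t) := by
        rw [zero_mul] at h1
        exact sub_eq_zero.1 (norm_le_zero_iff.1 h1)
      rw [← e.extend_left_inv (I := I) (hball hr), h2, e.extend_left_inv hte]
    have : Metric.ball (⟨t, ht⟩ : Icc (0 : ℝ) 1) ε ∈ 𝓝 (⟨t, ht⟩ : Icc (0 : ℝ) 1) :=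
      Metric.ball_mem_nhds _ hε
    filter_upwards [this] with r hr
    exact hconst r ⟨hr, r.2⟩
  exact hloc.apply_eq_of_preconnectedSpace ⟨0, by simp⟩ ⟨1, by simp⟩

end Generic

/-! ### Riemannian geodesics and their constant speed. -/

section Geodesics

variable {n : ℕ} [NeZero n] {M : Type*} [TopologicalSpace M]
  [ChartedSpace (EuclideanHalfSpace n) M] [IsManifold (𝓡∂ n) ∞ M]
  {e : OpenPartialHomeomorph M (EuclideanHalfSpace n)} {g : Metric n M} {β : OneForm n M}
  {γ : ℝ → M} {t : ℝ} {p q : M} {u : EuclideanSpace ℝ (Fin n)}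

/-- The coordinate expression of a Riemannian metric. -/
abbrev chartMetric (g : Metric n M) (e : OpenPartialHomeomorph M (EuclideanHalfSpace n)) :
    EuclideanSpace ℝ (Fin n) → EuclideanSpace ℝ (Fin n) →L[ℝ] EuclideanSpace ℝ (Fin n) →L[ℝ] ℝ :=
  chartForm (I := 𝓡∂ n) e g.inner

lemma inner_self_nonneg (g : Metric n M) (x : M) (v : TangentSpace (𝓡∂ n) x) :
    0 ≤ g.inner x v v := by
  by_cases hv : v = 0
  · simp [hv]
  · exact (g.pos x v hv).le

lemma localSq_metricNorm (u v : EuclideanSpace ℝ (Fin n)) :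
    localSq (metricNorm g) e u v = chartMetric g e u v v :=
  Real.sq_sqrt (inner_self_nonneg g _ _)

lemma localSq_randers (u v : EuclideanSpace ℝ (Fin n)) :
    localSq (randers g β) e u v =
      randersNorm (chartMetric g e) (chartCovector (I := 𝓡∂ n) e β.toFun) u v ^ 2 := rfl

lemma chartMetric_symm (u v w : EuclideanSpace ℝ (Fin n)) :
    chartMetric g e u v w = chartMetric g e u w v := g.symm _ _ _

lemma chartMetric_pos (he : e ∈ IsManifold.maximalAtlas (𝓡∂ n) ∞ M)
    (hu : u ∈ (e.extend (𝓡∂ n)).target) {v : EuclideanSpace ℝ (Fin n)} (hv : v ≠ 0) :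
    0 < chartMetric g e u v v := chartForm_pos g.pos he hu hv

lemma contDiffOn_chartMetric (g : Metric n M) (he : e ∈ IsManifold.maximalAtlas (𝓡∂ n) ∞ M) :
    ContDiffOn ℝ ∞ (chartForm (I := 𝓡∂ n) e g.inner) (e.extend (𝓡∂ n)).target :=
  contDiffOn_chartForm he g.inner g.contMDiff

lemma spray_metricNorm_iff (he : e ∈ IsManifold.maximalAtlas (𝓡∂ n) ∞ M)
    (hu : u ∈ (e.extend (𝓡∂ n)).target) {v z : EuclideanSpace ℝ (Fin n)} :
    (∀ i, z i + 2 * spray (metricNorm g) e i u v = 0) ↔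
      ∀ w, energyEL (range (𝓡∂ n)) (chartMetric g e) u v z w = 0 :=
  geodesicEquation_quadratic_iff localSq_metricNorm (e.extend_target_subset_range hu)
    (Filter.Eventually.of_forall fun _ ↦ chartMetric_symm _) (fun _ hw ↦ chartMetric_pos he hu hw)
    (hasFDerivWithinAt_of_contDiffOn_target (contDiffOn_chartMetric g he) hu)

lemma isGeodesic_metricNorm_iff :
    IsGeodesic (metricNorm g) p q γ ↔ ContMDiffOn 𝓘(ℝ, ℝ) (𝓡∂ n) ∞ γ (Icc 0 1) ∧ γ 0 = p ∧
      γ 1 = q ∧ ∀ e ∈ IsManifold.maximalAtlas (𝓡∂ n) ∞ M, ∀ t ∈ Icc (0 : ℝ) 1, γ t ∈ e.source →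
        GeodesicAt (I := 𝓡∂ n) g.inner e γ t := by
  constructor
  · intro h
    refine ⟨h.smooth, h.source, h.target, fun e he t ht hte ↦ ?_⟩
    exact (spray_metricNorm_iff he (coordCurve_mem_target hte)).1 (h.equation e he t ht hte)
  · rintro ⟨h1, h2, h3, h4⟩
    refine ⟨h1, h2, h3, fun e he t ht hte ↦ ?_⟩
    exact (spray_metricNorm_iff he (coordCurve_mem_target hte)).2 (h4 e he t ht hte)

lemma exists_speed (h : IsGeodesic (metricNorm g) p q γ) :
    ∃ c : ℝ, 0 ≤ c ∧ ∀ t ∈ Icc (0 : ℝ) 1, metricNorm g (γ t) (velocity (𝓡∂ n) γ t) = c := by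
  have hU := uniqueDiffOn_Icc (zero_lt_one (α := ℝ))
  have hd : ∀ t ∈ Icc (0 : ℝ) 1, HasDerivWithinAt
      (fun r ↦ g.inner (γ r) (velocity (𝓡∂ n) γ r) (velocity (𝓡∂ n) γ r)) 0 (Icc 0 1) t := by
    intro t ht
    have he : chartAt (EuclideanHalfSpace n) (γ t) ∈ IsManifold.maximalAtlas (𝓡∂ n) ∞ M :=
      IsManifold.chart_mem_maximalAtlas _
    exact hasDerivWithinAt_speedSq g.symm he (contDiffOn_chartMetric g he) h.smooth ht
      (mem_chart_source _ _)
      ((isGeodesic_metricNorm_iff.1 h).2.2.2 _ he t ht (mem_chart_source _ _))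
  refine ⟨_, Real.sqrt_nonneg _, fun t ht ↦ congrArg Real.sqrt
    (constant_of_derivWithin_zero (fun t ht ↦ (hd t ht).differentiableWithinAt)
      (fun t ht ↦ (hd t ⟨ht.1, ht.2.le⟩).derivWithin (hU t ⟨ht.1, ht.2.le⟩)) t ht)⟩

lemma length_eq_of_const {F : TangentFun n M} {c : ℝ}
    (h : ∀ t ∈ Icc (0 : ℝ) 1, F (γ t) (velocity (𝓡∂ n) γ t) = c) : length F γ = c := by
  have : length F γ = ∫ _ in (0 : ℝ)..1, c := by
    refine intervalIntegral.integral_congr fun t ht ↦ ?_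
    rw [uIcc_of_le zero_le_one] at ht
    exact h t ht
  simpa using this

lemma metricNorm_smul (x : M) (v : TangentSpace (𝓡∂ n) x) {a : ℝ} (ha : 0 ≤ a) :
    metricNorm g x (a • v) = a * metricNorm g x v := by
  unfold metricNorm
  rw [show g.inner x (a • v) (a • v) = a ^ 2 * g.inner x v v by simp; ring,
    Real.sqrt_mul (sq_nonneg a), Real.sqrt_sq ha]

end Geodesics

/-! ### Randers geodesics as reparametrised Riemannian geodesics. -/

section Geodesics

variable {n : ℕ} [NeZero n] {M : Type*} [TopologicalSpace M]
  [ChartedSpace (EuclideanHalfSpace n) M] [IsManifold (𝓡∂ n) ∞ M]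
  {e : OpenPartialHomeomorph M (EuclideanHalfSpace n)} {g : Metric n M} {β : OneForm n M}
  {γ : ℝ → M} {t : ℝ} {p q : M} {u : EuclideanSpace ℝ (Fin n)}

lemma metricNorm_zero (g : Metric n M) (x : M) : metricNorm g x 0 = 0 := by
  simp [metricNorm]

lemma randers_zero (g : Metric n M) (β : OneForm n M) (x : M) : randers g β x 0 = 0 := by
  simp [randers, metricNorm_zero]

lemma randers_smul (x : M) (v : TangentSpace (𝓡∂ n) x) {a : ℝ} (ha : 0 ≤ a) :
    randers g β x (a • v) = a * randers g β x v := by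
  unfold randers
  rw [metricNorm_smul x v ha, map_smul, smul_eq_mul, mul_add]

lemma metricNorm_velocity (he : e ∈ IsManifold.maximalAtlas (𝓡∂ n) ∞ M)
    (hγ : ContMDiffOn 𝓘(ℝ, ℝ) (𝓡∂ n) ∞ γ (Icc 0 1)) (ht : t ∈ Icc (0 : ℝ) 1)
    (hte : γ t ∈ e.source) :
    metricNorm g (γ t) (velocity (𝓡∂ n) γ t) = √(chartMetric g e (coordCurve (𝓡∂ n) e γ t)
      (derivWithin (coordCurve (𝓡∂ n) e γ) (Icc 0 1) t)
      (derivWithin (coordCurve (𝓡∂ n) e γ) (Icc 0 1) t)) :=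
  congrArg Real.sqrt (form_velocity he hγ ht hte)

/-- A reparametrisation of a geodesic of `g` with constant Randers speed is a geodesic of
`F_g + df`. -/
lemma isGeodesic_randers_reparam {f : M → ℝ} (hf : ContMDiff (𝓡∂ n) 𝓘(ℝ, ℝ) ∞ f)
    (hβ : ∀ x, β.toFun x = differential f x) (h : IsGeodesic (metricNorm g) p q γ) {c L : ℝ} (hc : 0 < c) (hL : 0 < L)
    (hspeed : ∀ t ∈ Icc (0 : ℝ) 1, metricNorm g (γ t) (velocity (𝓡∂ n) γ t) = c)
    {τ : ℝ → ℝ} (hτ : ContDiffOn ℝ ∞ τ (Icc 0 1)) (hm : MapsTo τ (Icc 0 1) (Icc 0 1))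
    (h0 : τ 0 = 0) (h1 : τ 1 = 1) (hτpos : ∀ s ∈ Icc (0 : ℝ) 1, 0 < derivWithin τ (Icc 0 1) s)
    (hF : ∀ s ∈ Icc (0 : ℝ) 1, derivWithin τ (Icc 0 1) s *
      randers g β (γ (τ s)) (velocity (𝓡∂ n) γ (τ s)) = L) :
    IsGeodesic (randers g β) p q (γ ∘ τ) ∧
      ∀ s ∈ Icc (0 : ℝ) 1, randers g β ((γ ∘ τ) s) (velocity (𝓡∂ n) (γ ∘ τ) s) = L := by
  have hU := uniqueDiffOn_Icc (zero_lt_one (α := ℝ))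
  have hγ' := contMDiffOn_reparam h.smooth hτ hm
  have hvel := fun s hs ↦ velocity_reparam (I := 𝓡∂ n) (t := s) h.smooth hτ hm hs
  have hFL : ∀ s ∈ Icc (0 : ℝ) 1,
      randers g β ((γ ∘ τ) s) (velocity (𝓡∂ n) (γ ∘ τ) s) = L := by
    intro s hs
    rw [hvel s hs]
    exact (randers_smul _ _ (hτpos s hs).le).trans (hF s hs)
  have hNc : ∀ s ∈ Icc (0 : ℝ) 1,
      metricNorm g ((γ ∘ τ) s) (velocity (𝓡∂ n) (γ ∘ τ) s) = derivWithin τ (Icc 0 1) s * c := by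
    intro s hs
    rw [hvel s hs, ← hspeed _ (hm hs)]
    exact metricNorm_smul _ _ (hτpos s hs).le
  refine ⟨⟨hγ', by simp [h0, h.source], by simp [h1, h.target], fun e he s hs hse ↦ ?_⟩, hFL⟩
  have hxt : coordCurve (𝓡∂ n) e (γ ∘ τ) s ∈ (e.extend (𝓡∂ n)).target :=
    coordCurve_mem_target hse
  obtain ⟨hd1, hd2⟩ := coordCurve_reparam he h.smooth hτ hm hs hse
  have hEL := (isGeodesic_metricNorm_iff.1 h).2.2.2 e he (τ s) (hm hs) hse
  have hsqrt := (metricNorm_velocity (g := g) he hγ' hs hse).symm.trans (hNc s hs)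
  have hb := contDiffOn_chartCovector he β.toFun β.contMDiff
  have hN : 0 < randersNorm (chartMetric g e) (chartCovector (I := 𝓡∂ n) e β.toFun)
      (coordCurve (𝓡∂ n) e (γ ∘ τ) s)
      (derivWithin (coordCurve (𝓡∂ n) e (γ ∘ τ)) (Icc 0 1) s) := by
    have := hFL s hs
    rw [randers, metricNorm_velocity he hγ' hs hse, covector_velocity he hγ' hs hse] at this
    rw [randersNorm, this]
    exact hL
  have hv : derivWithin (coordCurve (𝓡∂ n) e (γ ∘ τ)) (Icc 0 1) s ≠ 0 := by
    intro h0
    rw [h0] at hN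
    simp [randersNorm] at hN
  have hder := hasDerivWithinAt_derivWithin hU hs (contDiffWithinAt_coordCurve he hγ' hs hse)
  -- This is the derivative of the constant Randers speed `L`, whose Riemannian part is `τ' * c` and
  -- whose remaining part is the value of `β` on the velocity.
  have hμ : derivWithin (derivWithin τ (Icc 0 1)) (Icc 0 1) s * c +
      (fderivWithin ℝ (chartCovector (I := 𝓡∂ n) e β.toFun) (range (𝓡∂ n))
          (coordCurve (𝓡∂ n) e (γ ∘ τ) s)
          (derivWithin (coordCurve (𝓡∂ n) e (γ ∘ τ)) (Icc 0 1) s)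
          (derivWithin (coordCurve (𝓡∂ n) e (γ ∘ τ)) (Icc 0 1) s) +
        chartCovector (I := 𝓡∂ n) e β.toFun (coordCurve (𝓡∂ n) e (γ ∘ τ) s)
          (derivWithin (derivWithin (coordCurve (𝓡∂ n) e (γ ∘ τ)) (Icc 0 1)) (Icc 0 1) s)) = 0 := by
    have k1 := (hasDerivWithinAt_derivWithin hU hs (hτ s hs)).mul_const c
    have k2 := (hasDerivWithinAt_comp_coordCurve hb he hγ' hs hse).clm_apply hder
    have k3 := k1.add k2
    have k4 : HasDerivWithinAt (fun _ : ℝ ↦ L) 0 (Icc 0 1) s := hasDerivWithinAt_const _ _ _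
    have k5 : (fun _ : ℝ ↦ L) =ᶠ[𝓝[Icc 0 1] s] ((fun r ↦ derivWithin τ (Icc 0 1) r * c) +
        fun r ↦ chartCovector (I := 𝓡∂ n) e β.toFun (coordCurve (𝓡∂ n) e (γ ∘ τ) r)
          (derivWithin (coordCurve (𝓡∂ n) e (γ ∘ τ)) (Icc 0 1) r)) := by
      filter_upwards [eventually_mem_source (hγ' s hs).continuousWithinAt hse,
        self_mem_nhdsWithin] with r hr hr'
      rw [Pi.add_apply, ← hNc r hr', ← covector_velocity he hγ' hr' hr]
      exact (hFL r hr').symm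
    exact (hU s hs).eq_deriv _ k3 (k4.congr_of_eventuallyEq k5.symm (k5.symm.self_of_nhdsWithin hs))
  -- `energyEL_reparam` leaves `τ''` times the metric dual of the old velocity; the new velocity is
  -- `τ'` times the old one, hence `μ = τ'' / τ'`.
  refine geodesicEquation_randers (G := chartMetric g e)
    (b := chartCovector (I := 𝓡∂ n) e β.toFun) (fun u v ↦ localSq_randers u v)
    (e.extend_target_subset_range hxt) (Filter.Eventually.of_forall fun _ ↦ chartMetric_symm _)
    (fun w hw ↦ chartMetric_pos he hxt hw)
    (hasFDerivWithinAt_of_contDiffOn_target (contDiffOn_chartMetric g he) hxt)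
    (hasFDerivWithinAt_of_contDiffOn_target hb hxt) hv hN
    (fderivWithin_chartCovector_symm hf hβ he hxt)
    (μ := derivWithin (derivWithin τ (Icc 0 1)) (Icc 0 1) s / derivWithin τ (Icc 0 1) s) ?_ ?_
  · intro w
    have := energyEL_reparam (range (𝓡∂ n)) (chartMetric g e) (coordCurve (𝓡∂ n) e γ (τ s))
      (derivWithin (coordCurve (𝓡∂ n) e γ) (Icc 0 1) (τ s))
      (derivWithin (derivWithin (coordCurve (𝓡∂ n) e γ) (Icc 0 1)) (Icc 0 1) (τ s)) w
      (derivWithin τ (Icc 0 1) s) (derivWithin (derivWithin τ (Icc 0 1)) (Icc 0 1) s)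
    rw [hEL w, ← hd1, ← hd2, mul_zero, zero_add] at this
    refine this.trans ?_
    have h3 := (hτpos s hs).ne'
    change _ = _ * chartMetric g e (coordCurve (𝓡∂ n) e γ (τ s))
      (derivWithin (coordCurve (𝓡∂ n) e (γ ∘ τ)) (Icc 0 1) s) w
    rw [hd1, map_smul, smul_apply, smul_eq_mul]
    field_simp
  · have h3 := (hτpos s hs).ne'
    change _ * √(chartMetric g e (coordCurve (𝓡∂ n) e (γ ∘ τ) s)
      (derivWithin (coordCurve (𝓡∂ n) e (γ ∘ τ)) (Icc 0 1) s)
      (derivWithin (coordCurve (𝓡∂ n) e (γ ∘ τ)) (Icc 0 1) s)) + _ + _ = 0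
    rw [hsqrt]
    rw [show ∀ a : ℝ, a / derivWithin τ (Icc 0 1) s * (derivWithin τ (Icc 0 1) s * c) = a * c from
      fun a ↦ by field_simp, add_assoc]
    rw [add_comm (chartCovector _ _ _ _)]
    exact hμ

/-- Along `γ` the Randers speed is the derivative of `t * c + f (γ t)`, with `c` the Riemannian
speed. This is positive because `p ≠ q` excludes a constant curve, so Randers arc length is an
admissible parameter, and integrating it gives the change of length `f q - f p`. -/
lemma exists_isGeodesic_randers (hpos : ∀ (x : M) (y : TangentSpace (𝓡∂ n) x), y ≠ 0 →
      0 < randers g β x y)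
    {f : M → ℝ} (hf : ContMDiff (𝓡∂ n) 𝓘(ℝ, ℝ) ∞ f) (hβ : ∀ x, β.toFun x = differential f x)
    (h : IsGeodesic (metricNorm g) p q γ) (hpq : p ≠ q) :
    ∃ γ', IsGeodesic (randers g β) p q γ' ∧
      length (randers g β) γ' = length (metricNorm g) γ + f q - f p := by
  have hU := uniqueDiffOn_Icc (zero_lt_one (α := ℝ))
  obtain ⟨c, hc0, hspeed⟩ := exists_speed h
  have hvel0 : ∀ t ∈ Icc (0 : ℝ) 1, velocity (𝓡∂ n) γ t = 0 → c = 0 := by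
    intro t ht h0
    rw [← hspeed t ht, h0, metricNorm_zero]
  have hc : 0 < c := by
    refine hc0.lt_of_ne fun h0 ↦ hpq ?_
    rw [← h.source, ← h.target]
    refine curve_const_of_velocity_eq_zero h.smooth fun t ht ↦ by_contra fun hv ↦ ?_
    have := Real.sqrt_pos.2 (g.pos _ _ hv)
    exact this.ne' ((hspeed t ht).trans h0.symm)
  have hvne : ∀ t ∈ Icc (0 : ℝ) 1, velocity (𝓡∂ n) γ t ≠ 0 := fun t ht h0 ↦
    hc.ne' (hvel0 t ht h0)
  have hF : ∀ t ∈ Icc (0 : ℝ) 1, HasDerivWithinAt (fun r ↦ r * c + f (γ r))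
      (randers g β (γ t) (velocity (𝓡∂ n) γ t)) (Icc 0 1) t := by
    intro t ht
    have h1 := ((hasDerivWithinAt_id t (Icc 0 1)).mul_const c).add
      (hasDerivWithinAt_comp_curve hf h.smooth ht)
    refine h1.congr_deriv ?_
    rw [randers, hspeed t ht, hβ, one_mul]
    rfl
  have hmono : StrictMonoOn (fun r ↦ r * c + f (γ r)) (Icc 0 1) := by
    refine strictMonoOn_of_deriv_pos (convex_Icc 0 1) (fun t ht ↦ (hF t ht).continuousWithinAt)
      fun t ht ↦ ?_
    rw [interior_Icc] at ht
    have ht' := Ioo_subset_Icc_self ht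
    rw [((hF t ht').hasDerivAt (Icc_mem_nhds ht.1 ht.2)).deriv]
    exact hpos _ _ (hvne t ht')
  set L := c + f q - f p with hLdef
  have hL : 0 < L := by
    have := hmono (show (0 : ℝ) ∈ Icc 0 1 by simp) (show (1 : ℝ) ∈ Icc 0 1 by simp) zero_lt_one
    simp only [h.source, h.target] at this
    linarith
  -- Randers arc length divided by the total length; its inverse `τ` gives `γ ∘ τ` the constant
  -- Randers speed `L`.
  let σ : ℝ → ℝ := fun r ↦ (r * c + f (γ r) - f p) / L
  have hσd : ∀ t ∈ Icc (0 : ℝ) 1, derivWithin σ (Icc 0 1) t =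
      randers g β (γ t) (velocity (𝓡∂ n) γ t) / L := fun t ht ↦
    (((hF t ht).sub_const (f p)).div_const L).derivWithin (hU t ht)
  have hσ : ContDiffOn ℝ ∞ σ (Icc 0 1) :=
    (((contDiffOn_id.mul contDiffOn_const).add (contDiffOn_comp_curve hf h.smooth)).sub
      contDiffOn_const).div_const L
  have hFpos : ∀ t ∈ Icc (0 : ℝ) 1, 0 < randers g β (γ t) (velocity (𝓡∂ n) γ t) :=
    fun t ht ↦ hpos _ _ (hvne t ht)
  obtain ⟨τ, hτ, hm, h0, h1, -, hτd⟩ := exists_smooth_inverse hσ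
    (fun t ht ↦ by rw [hσd t ht]; exact div_pos (hFpos t ht) hL)
    (by simp [σ, h.source])
    (by
      simp only [σ, h.target, one_mul]
      exact div_self hL.ne')
  have hτd' : ∀ s ∈ Icc (0 : ℝ) 1, derivWithin τ (Icc 0 1) s =
      L / randers g β (γ (τ s)) (velocity (𝓡∂ n) γ (τ s)) := by
    intro s hs
    rw [hτd s hs, hσd _ (hm hs), inv_div]
  obtain ⟨hgeo, hconst⟩ := isGeodesic_randers_reparam hf hβ h hc hL hspeed hτ hm h0 h1
    (fun s hs ↦ by rw [hτd' s hs]; exact div_pos hL (hFpos _ (hm hs)))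
    (fun s hs ↦ by rw [hτd' s hs]; exact div_mul_cancel₀ _ (hFpos _ (hm hs)).ne')
  refine ⟨γ ∘ τ, hgeo, ?_⟩
  rw [length_eq_of_const hconst, length_eq_of_const hspeed]

end Geodesics

/-! ### Boundary distance data of Riemannian and Randers metrics. -/

section Geodesics

variable {n : ℕ} [NeZero n] {M : Type*} [TopologicalSpace M]
  [ChartedSpace (EuclideanHalfSpace n) M] [IsManifold (𝓡∂ n) ∞ M]
  {e : OpenPartialHomeomorph M (EuclideanHalfSpace n)} {g : Metric n M} {β : OneForm n M}
  {γ : ℝ → M} {t : ℝ} {p q : M} {u : EuclideanSpace ℝ (Fin n)}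

lemma velocity_const (p : M) (t : ℝ) : velocity (𝓡∂ n) (fun _ ↦ p) t = 0 := by
  unfold velocity
  rw [mfderivWithin_const]
  rfl

lemma length_const {F : TangentFun n M} (hF : ∀ x, F x 0 = 0) (p : M) :
    length F (fun _ ↦ p) = 0 := by
  refine length_eq_of_const fun t _ ↦ ?_
  rw [velocity_const p t]
  exact hF p

/-- At zero velocity the first part of the spray bracket has the factor `v k = 0` and the second
differentiates the zero function in `x`, so the inverse matrix does not matter, even where it is
only a default value. -/
lemma isGeodesic_const {F : TangentFun n M} (hF : ∀ x, F x 0 = 0) (p : M) :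
    IsGeodesic F p p (fun _ ↦ p) := by
  refine ⟨contMDiffOn_const, rfl, rfl, fun e _ t _ _ i ↦ ?_⟩
  have h1 : derivWithin (localCurve e fun _ ↦ p) (Icc 0 1) = fun _ ↦ 0 := by
    ext1 t
    exact congrFun (derivWithin_const (Icc (0 : ℝ) 1) (e.extend (𝓡∂ n) p)) t
  have h2 : ∀ u, localSq F e u 0 = 0 := by
    intro u
    have : tangentOf e u 0 = 0 := map_zero _
    rw [localSq, this, hF]
    simp
  have h3 : ∀ l u, partialX l (localSq F e) u 0 = 0 := by
    intro l u
    simp [partialX, h2]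
  rw [h1]
  simp [spray, h3]

lemma length_congr {F : TangentFun n M} {γ' : ℝ → M} (h : EqOn γ γ' (Icc 0 1)) :
    length F γ = length F γ' := by
  refine intervalIntegral.integral_congr fun t ht ↦ ?_
  rw [uIcc_of_le zero_le_one] at ht
  refine tangentFun_congr F (h ht) ?_
  rw [mfderivWithin_congr h (h ht)]
  rfl

/-- Uniqueness in `Admissible` allows any geodesic to replace the chosen one. -/
lemma boundaryDist_eq_length {F : TangentFun n M} (hF : Admissible F)
    {p q : (𝓡∂ n).boundary M} (h : IsGeodesic F p q γ) : boundaryDist F hF p q = length F γ :=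
  (length_congr ((hF p q).choose_spec.2 γ h)).symm

lemma boundaryDist_self {F : TangentFun n M} (hF : Admissible F) (h0 : ∀ x, F x 0 = 0)
    (p : (𝓡∂ n).boundary M) : boundaryDist F hF p p = 0 :=
  (boundaryDist_eq_length hF (isGeodesic_const h0 p)).trans (length_const h0 _)

/-- Off the diagonal, one Randers geodesic obtained from the geodesic of `g` suffices, by
uniqueness. On the diagonal all terms cancel, since constant curves are geodesics of length zero. -/
lemma boundaryDist_randers (hpos : ∀ (x : M) (y : TangentSpace (𝓡∂ n) x), y ≠ 0 →
      0 < randers g β x y) {f : M → ℝ} (hf : ContMDiff (𝓡∂ n) 𝓘(ℝ, ℝ) ∞ f)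
    (hβ : ∀ x, β.toFun x = differential f x) (hg : Admissible (metricNorm g))
    (hF : Admissible (randers g β)) (p q : (𝓡∂ n).boundary M) :
    boundaryDist (randers g β) hF p q = boundaryDist (metricNorm g) hg p q + f q - f p := by
  by_cases hpq : p = q
  · subst hpq
    rw [boundaryDist_self hF (randers_zero g β), boundaryDist_self hg (metricNorm_zero g)]
    ring
  · obtain ⟨γ', h1, h2⟩ := exists_isGeodesic_randers hpos hf hβ (hg p q).choose_spec.1
      (Subtype.coe_injective.ne hpq)
    rw [boundaryDist_eq_length hF h1, h2, boundaryDist]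

lemma metricNorm_neg (x : M) (v : TangentSpace (𝓡∂ n) x) :
    metricNorm g x (-v) = metricNorm g x v := by
  simp [metricNorm]

lemma randers_pos (h : dualNorm (metricNorm g) β.toFun < 1) (x : M)
    (y : TangentSpace (𝓡∂ n) x) (hy : y ≠ 0) : 0 < randers g β x y := by
  have hN : 0 < metricNorm g x y := Real.sqrt_pos.2 (g.pos x y hy)
  -- `dualNorm` bounds `β` from above only; the lower bound for `β y` comes from the opposite unit
  -- vector.
  set w : TangentSpace (𝓡∂ n) x := -((metricNorm g x y)⁻¹ • y) with hw
  have hw1 : metricNorm g x w = 1 := by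
    rw [hw, metricNorm_neg, metricNorm_smul x y (inv_nonneg.2 hN.le), inv_mul_cancel₀ hN.ne']
  have h1 : ENNReal.ofReal (β.toFun x w) ≤ dualNorm (metricNorm g) β.toFun :=
    le_iSup_of_le x (le_iSup_of_le w (le_iSup_of_le hw1 le_rfl))
  have h2 : β.toFun x w < 1 := by
    have := h1.trans_lt h
    rwa [ENNReal.ofReal_lt_one] at this
  have h3 : β.toFun x w = -((metricNorm g x y)⁻¹ * β.toFun x y) := by
    rw [hw, map_neg, map_smul, smul_eq_mul]
  rw [h3, neg_lt, inv_mul_eq_div, lt_div_iff₀ hN] at h2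
  rw [randers]
  linarith

/-- For `τ t = 1 - t` one has `τ' = -1` and `τ'' = 0`, and the energy equation sees `τ'` only
through its square. Together with the evenness of the norm this is the Riemannian reversibility that
separates `d_g` from the potential. -/
lemma isGeodesic_reverse (h : IsGeodesic (metricNorm g) p q γ) :
    IsGeodesic (metricNorm g) q p (γ ∘ fun t ↦ 1 - t) ∧
      length (metricNorm g) (γ ∘ fun t ↦ 1 - t) = length (metricNorm g) γ := by
  have hU := uniqueDiffOn_Icc (zero_lt_one (α := ℝ))
  have hτ : ContDiffOn ℝ ∞ (fun t : ℝ ↦ 1 - t) (Icc 0 1) :=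
    (contDiff_const.sub contDiff_id).contDiffOn
  have hm : MapsTo (fun t : ℝ ↦ 1 - t) (Icc 0 1) (Icc 0 1) := fun t ht ↦
    ⟨by linarith [ht.2], by linarith [ht.1]⟩
  have hd : ∀ t ∈ Icc (0 : ℝ) 1, derivWithin (fun t : ℝ ↦ 1 - t) (Icc 0 1) t = -1 := fun t ht ↦
    ((hasDerivWithinAt_id t _).const_sub 1).derivWithin (hU t ht)
  have hdd : ∀ t ∈ Icc (0 : ℝ) 1,
      derivWithin (derivWithin (fun t : ℝ ↦ 1 - t) (Icc 0 1)) (Icc 0 1) t = 0 := by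
    intro t ht
    rw [derivWithin_congr hd (hd t ht)]
    simp
  obtain ⟨c, -, hc⟩ := exists_speed h
  have hc' : ∀ t ∈ Icc (0 : ℝ) 1, metricNorm g ((γ ∘ fun t ↦ 1 - t) t)
      (velocity (𝓡∂ n) (γ ∘ fun t ↦ 1 - t) t) = c := by
    intro t ht
    rw [velocity_reparam h.smooth hτ hm ht, hd t ht, ← hc _ (hm ht), neg_one_smul]
    exact metricNorm_neg _ _
  refine ⟨isGeodesic_metricNorm_iff.2 ⟨contMDiffOn_reparam h.smooth hτ hm, by simp [h.target],
    by simp [h.source], fun e he t ht hte w ↦ ?_⟩, ?_⟩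
  · obtain ⟨h1, h2⟩ := coordCurve_reparam he h.smooth hτ hm ht hte
    rw [h1, h2, energyEL_reparam, hdd t ht, zero_mul, add_zero]
    have h3 := (isGeodesic_metricNorm_iff.1 h).2.2.2 e he (1 - t) (hm ht) hte w
    exact (congrArg _ h3).trans (mul_zero _)
  · rw [length_eq_of_const hc, length_eq_of_const hc']

lemma boundaryDist_metricNorm_comm (hg : Admissible (metricNorm g)) (p q : (𝓡∂ n).boundary M) :
    boundaryDist (metricNorm g) hg p q = boundaryDist (metricNorm g) hg q p := by
  obtain ⟨h1, h2⟩ := isGeodesic_reverse (hg p q).choose_spec.1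
  rw [boundaryDist_eq_length hg h1, h2, boundaryDist]

end Geodesics

/-! ### Isometries in adapted charts. -/

section Generic

variable {E : Type*} [NormedAddCommGroup E] [NormedSpace ℝ E] {H : Type*} [TopologicalSpace H]
  {I : ModelWithCorners ℝ E H} {M : Type*} [TopologicalSpace M] [ChartedSpace H M]
  [IsManifold I ∞ M] {e : OpenPartialHomeomorph M H}
  {γ : ℝ → M} {t : ℝ} {u : E}

/-- The chart `e ∘ Ψ` obtained by composing the chart `e` with the diffeomorphism `Ψ`. -/
def chartComp (Ψ : M ≃ₘ^∞⟮I, I⟯ M) (e : OpenPartialHomeomorph M H) : OpenPartialHomeomorph M H :=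
  Ψ.toHomeomorph.toOpenPartialHomeomorph.trans e

lemma chartComp_mem_maximalAtlas (Ψ : M ≃ₘ^∞⟮I, I⟯ M)
    (he : e ∈ IsManifold.maximalAtlas I ∞ M) :
    chartComp Ψ e ∈ IsManifold.maximalAtlas I ∞ M := by
  rw [IsManifold.mem_maximalAtlas_iff_contMDiffOn] at he ⊢
  refine ⟨he.1.comp Ψ.contMDiff.contMDiffOn fun x hx ↦ ?_,
    Ψ.symm.contMDiff.comp_contMDiffOn (he.2.mono fun x hx ↦ ?_)⟩
  · rw [chartComp, OpenPartialHomeomorph.trans_source] at hx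
    exact hx.2
  · rw [chartComp, OpenPartialHomeomorph.trans_target] at hx
    exact hx.1

lemma mem_chartComp_source (Ψ : M ≃ₘ^∞⟮I, I⟯ M) {x : M} :
    x ∈ (chartComp Ψ e).source ↔ Ψ x ∈ e.source := by
  rw [chartComp, OpenPartialHomeomorph.trans_source]
  exact ⟨fun h ↦ h.2, fun h ↦ ⟨mem_univ _, h⟩⟩

lemma chartComp_extend_symm (Ψ : M ≃ₘ^∞⟮I, I⟯ M) (u : E) :
    Ψ (((chartComp Ψ e).extend I).symm u) = (e.extend I).symm u :=
  Ψ.apply_symm_apply _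

/-- `Ψ` composed with the inverse of the chart `e ∘ Ψ` is the inverse of `e`: in this pair of charts
`Ψ` is the identity. -/
lemma mfderiv_frame_chartComp (Ψ : M ≃ₘ^∞⟮I, I⟯ M) (he : e ∈ IsManifold.maximalAtlas I ∞ M)
    (hu : u ∈ ((chartComp Ψ e).extend I).target) (v : E) :
    (mfderiv I I Ψ (((chartComp Ψ e).extend I).symm u)
      (frame I (chartComp Ψ e) u v) : E) = frame I e u v := by
  have h1 := hasMFDerivWithinAt_extend_symm (chartComp_mem_maximalAtlas Ψ he) hu
  have h2 := ((Ψ.contMDiff (((chartComp Ψ e).extend I).symm u)).mdifferentiableAt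
    (by simp)).hasMFDerivAt
  have h3 := h2.comp_hasMFDerivWithinAt u h1
  have hU : UniqueMDiffWithinAt 𝓘(ℝ, E) (range I) u :=
    (I.uniqueDiffOn u (OpenPartialHomeomorph.extend_target_subset_range _ hu)).uniqueMDiffWithinAt
  have h4 := h3.mfderivWithin hU
  have h5 : Ψ ∘ ((chartComp Ψ e).extend I).symm = (e.extend I).symm :=
    funext (chartComp_extend_symm Ψ)
  have h6 : frame I e u v = mfderivWithin 𝓘(ℝ, E) I (Ψ ∘ ((chartComp Ψ e).extend I).symm)
      (range I) u v := by
    rw [frame, h5]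
    rfl
  rw [h6, h4]
  rfl

lemma form_congr (g : (x : M) → TangentSpace I x →L[ℝ] TangentSpace I x →L[ℝ] ℝ) {x y : M}
    (h : x = y) {v v' w w' : E} (hv : v = v') (hw : w = w') :
    (g x : E →L[ℝ] E →L[ℝ] ℝ) v w = (g y : E →L[ℝ] E →L[ℝ] ℝ) v' w' := by
  subst h hv hw; rfl

variable {g₁ g₂ : (x : M) → TangentSpace I x →L[ℝ] TangentSpace I x →L[ℝ] ℝ}

lemma chartForm_chartComp (Ψ : M ≃ₘ^∞⟮I, I⟯ M)
    (hΨ : ∀ x v w, g₂ x v w = g₁ (Ψ x) (mfderiv I I Ψ x v) (mfderiv I I Ψ x w))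
    (he : e ∈ IsManifold.maximalAtlas I ∞ M) (hu : u ∈ ((chartComp Ψ e).extend I).target) :
    chartForm (chartComp Ψ e) g₂ u = chartForm e g₁ u := by
  ext v w
  rw [chartForm_apply, chartForm_apply, hΨ]
  exact form_congr g₁ (chartComp_extend_symm Ψ u) (mfderiv_frame_chartComp Ψ he hu v)
    (mfderiv_frame_chartComp Ψ he hu w)

/-- Both curves have the same coordinates and both metrics the same coordinate expression near the
point, so the two equations coincide literally. -/
lemma geodesicAt_chartComp_iff (Ψ : M ≃ₘ^∞⟮I, I⟯ M)
    (hΨ : ∀ x v w, g₂ x v w = g₁ (Ψ x) (mfderiv I I Ψ x v) (mfderiv I I Ψ x w))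
    (he : e ∈ IsManifold.maximalAtlas I ∞ M) (hte : Ψ (γ t) ∈ e.source) :
    GeodesicAt g₂ (chartComp Ψ e) γ t ↔ GeodesicAt g₁ e (Ψ ∘ γ) t := by
  have hu : coordCurve I (chartComp Ψ e) γ t ∈ ((chartComp Ψ e).extend I).target :=
    coordCurve_mem_target ((mem_chartComp_source Ψ).2 hte)
  have h1 : chartForm (chartComp Ψ e) g₂ =ᶠ[𝓝[range I] (coordCurve I (chartComp Ψ e) γ t)]
      chartForm e g₁ := by
    filter_upwards [extend_target_mem_nhdsWithin' hu] with y hy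
    exact chartForm_chartComp Ψ hΨ he hy
  have h2 := chartForm_chartComp Ψ hΨ he hu
  unfold GeodesicAt energyEL
  rw [h1.fderivWithin_eq h2, h2]
  rfl

lemma velocity_comp_diffeomorph (Ψ : M ≃ₘ^∞⟮I, I⟯ M)
    (hγ : ContMDiffOn 𝓘(ℝ, ℝ) I ∞ γ (Icc 0 1)) (ht : t ∈ Icc (0 : ℝ) 1) :
    velocity I (Ψ ∘ γ) t = mfderiv I I Ψ (γ t) (velocity I γ t) := by
  have h1 := ((Ψ.contMDiff (γ t)).mdifferentiableAt (by simp)).hasMFDerivAt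
  have h2 := ((hγ t ht).mdifferentiableWithinAt (by simp)).hasMFDerivWithinAt
  unfold velocity
  rw [(h1.comp_hasMFDerivWithinAt t h2).mfderivWithin
    (uniqueDiffOn_Icc zero_lt_one t ht).uniqueMDiffWithinAt]
  rfl

end Generic

/-! ### Isometry invariance of the boundary distance. -/

section Geodesics

variable {n : ℕ} [NeZero n] {M : Type*} [TopologicalSpace M]
  [ChartedSpace (EuclideanHalfSpace n) M] [IsManifold (𝓡∂ n) ∞ M] {g₁ g₂ : Metric n M}
  {γ : ℝ → M} {p q : M}

lemma IsGeodesic.comp_isometry {Ψ : M ≃ₘ^∞⟮𝓡∂ n, 𝓡∂ n⟯ M} (hΨ : IsPullbackMetric Ψ g₁ g₂)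
    (h : IsGeodesic (metricNorm g₂) p q γ) :
    IsGeodesic (metricNorm g₁) (Ψ p) (Ψ q) (Ψ ∘ γ) := by
  refine isGeodesic_metricNorm_iff.2 ⟨Ψ.contMDiff.comp_contMDiffOn h.smooth, by simp [h.source],
    by simp [h.target], fun e he t ht hte ↦ (geodesicAt_chartComp_iff Ψ hΨ he hte).1 ?_⟩
  exact (isGeodesic_metricNorm_iff.1 h).2.2.2 _ (chartComp_mem_maximalAtlas Ψ he) t ht
    ((mem_chartComp_source Ψ).2 hte)

lemma length_comp_isometry {Ψ : M ≃ₘ^∞⟮𝓡∂ n, 𝓡∂ n⟯ M} (hΨ : IsPullbackMetric Ψ g₁ g₂)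
    (hγ : ContMDiffOn 𝓘(ℝ, ℝ) (𝓡∂ n) ∞ γ (Icc 0 1)) :
    length (metricNorm g₁) (Ψ ∘ γ) = length (metricNorm g₂) γ := by
  refine intervalIntegral.integral_congr fun t ht ↦ ?_
  rw [uIcc_of_le zero_le_one] at ht
  have h := velocity_comp_diffeomorph Ψ hγ ht
  unfold metricNorm
  rw [hΨ]
  unfold velocity at h
  rw [h]
  rfl

lemma boundaryDist_eq_of_isPullbackMetric {Ψ : M ≃ₘ^∞⟮𝓡∂ n, 𝓡∂ n⟯ M}
    (hΨ : IsPullbackMetric Ψ g₁ g₂) (hfix : FixesBoundary Ψ) (hg₁ : Admissible (metricNorm g₁))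
    (hg₂ : Admissible (metricNorm g₂)) (p q : (𝓡∂ n).boundary M) :
    boundaryDist (metricNorm g₁) hg₁ p q = boundaryDist (metricNorm g₂) hg₂ p q := by
  have h := (hg₂ p q).choose_spec.1
  have h' := h.comp_isometry hΨ
  rw [hfix p p.2, hfix q q.2] at h'
  rw [boundaryDist_eq_length hg₁ h', length_comp_isometry hΨ h.smooth, boundaryDist]

end Geodesics

/-! ### Closed 1-forms on simply connected manifolds are exact. -/

/-- The real numbers with the discrete topology. -/
def DiscreteReal : Type := ℝ

instance : TopologicalSpace DiscreteReal := ⊥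

instance : DiscreteTopology DiscreteReal := ⟨rfl⟩

/-- A family of locally defined functions with locally constant differences on a simply connected
space comes from one globally defined function, up to locally constant functions. -/
lemma exists_global_potential {X : Type*} [TopologicalSpace X] [SimplyConnectedSpace X]
    [LocallyPathConnectedSpace X] (U : X → Set X) (hU : ∀ i, IsOpen (U i)) (hx : ∀ x, x ∈ U x)
    (f : X → X → ℝ) (h : ∀ i j, ∀ x ∈ U i ∩ U j, ∀ᶠ y in 𝓝 x, f i y - f j y = f i x - f j x) :
    ∃ F : X → ℝ, ∀ i, ∀ x ∈ U i, ∀ᶠ y in 𝓝 x, F y - f i y = F x - f i x := by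
  -- A point over `x` with coordinate `v` in the index `i` stands for the value `f i x + v`, which
  -- the coordinate changes preserve. The discrete fibre makes every continuous section locally of
  -- the form `f i` plus a constant.
  let Z : FiberBundleCore X X DiscreteReal :=
    { baseSet := U
      isOpen_baseSet := hU
      indexAt := id
      mem_baseSet_at := hx
      coordChange := fun i j x v ↦ ((show ℝ from v) + (f i x - f j x) : ℝ)
      coordChange_self := fun i x _ v ↦ by
        change (show ℝ from v) + (f i x - f i x) = v
        rw [sub_self, add_zero]
      continuousOn_coordChange := by
        rintro i j ⟨x, v⟩ hxv
        refine ContinuousAt.continuousWithinAt ?_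
        have h1 : ∀ᶠ p : X × DiscreteReal in 𝓝 (x, v), p.2 = v := by
          have : ({v} : Set DiscreteReal) ∈ 𝓝 v := (isOpen_discrete _).mem_nhds rfl
          exact (continuous_snd.continuousAt (x := (x, v))) this
        have h2 : ∀ᶠ p : X × DiscreteReal in 𝓝 (x, v), f i p.1 - f j p.1 = f i x - f j x :=
          (continuous_fst.continuousAt (x := (x, v))) (h i j x hxv.1)
        have h3 : ContinuousAt (fun _ : X × DiscreteReal ↦
            (show DiscreteReal from ((show ℝ from v) + (f i x - f j x) : ℝ))) (x, v) :=
          continuousAt_const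
        refine h3.congr ?_
        filter_upwards [h1, h2] with p hp1 hp2
        rw [hp1, hp2]
      coordChange_comp := fun i j k x _ v ↦ by
        change (show ℝ from v) + (f i x - f j x) + (f j x - f k x) =
          (show ℝ from v) + (f i x - f k x)
        ring }
  have hcov : IsCoveringMap Z.proj := IsCoveringMap.mk _ (fun _ ↦ DiscreteReal)
    (fun x ↦ Z.localTriv x) fun x ↦ hx x
  obtain ⟨x₀⟩ : Nonempty X := inferInstance
  -- A lift of the identity through the covering is a global section; simple connectedness provides
  -- it.
  obtain ⟨s, ⟨-, hs⟩, -⟩ := hcov.existsUnique_continuousMap_lifts (ContinuousMap.id X) x₀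
    (⟨x₀, (0 : ℝ)⟩ : Z.TotalSpace) rfl
  have hs' : ∀ x, (s x).1 = x := fun x ↦ congrFun hs x
  refine ⟨fun x ↦ (show ℝ from (s x).2) + f x x, fun i x hxi ↦ ?_⟩
  have h1 : ContinuousAt (fun y ↦ (Z.localTriv i (s y)).2) x := by
    refine continuous_snd.continuousAt.comp (((Z.localTriv i).continuousOn_toFun.continuousAt
      ?_).comp s.continuous.continuousAt)
    refine (Z.localTriv i).open_source.mem_nhds ?_
    rw [Z.mem_localTriv_source, hs']
    exact hxi
  have h2 : ∀ y, (Z.localTriv i (s y)).2 = ((show ℝ from (s y).2) + (f y y - f i y) : ℝ) := by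
    intro y
    rw [Z.localTriv_apply]
    change (show ℝ from (s y).2) + (f (s y).1 (s y).1 - f i (s y).1) = _
    rw [hs' y]
  have h3 := h1.eventually ((isOpen_discrete {(Z.localTriv i (s x)).2}).mem_nhds rfl)
  filter_upwards [h3] with y hy
  have : (Z.localTriv i (s y)).2 = (Z.localTriv i (s x)).2 := hy
  rw [h2, h2] at this
  have h4 : (show ℝ from (s y).2) + (f y y - f i y) =
    (show ℝ from (s x).2) + (f x x - f i x) := this
  linarith

section Generic

variable {E : Type*} [NormedAddCommGroup E] [NormedSpace ℝ E] {H : Type*} [TopologicalSpace H]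
  {I : ModelWithCorners ℝ E H} {M : Type*} [TopologicalSpace M] [ChartedSpace H M]
  [IsManifold I ∞ M] {e : OpenPartialHomeomorph M H}

lemma exists_ball_subset_extend_target {u : E} (hu : u ∈ (e.extend I).target) :
    ∃ ε > 0, Metric.ball u ε ∩ range I ⊆ (e.extend I).target :=
  Metric.mem_nhdsWithin_iff.1 (extend_target_mem_nhdsWithin' hu)

lemma hasFDerivWithinAt_comp_extend_symm {f : M → ℝ} {u : E}
    {L : TangentSpace I ((e.extend I).symm u) →L[ℝ] ℝ}
    (hf : HasMFDerivAt I 𝓘(ℝ, ℝ) f ((e.extend I).symm u) L)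
    (he : e ∈ IsManifold.maximalAtlas I ∞ M) (hu : u ∈ (e.extend I).target) :
    HasFDerivWithinAt (fun u ↦ f ((e.extend I).symm u))
      (L.comp (frame I e u) : E →L[ℝ] ℝ) (range I) u :=
  (hf.comp_hasMFDerivWithinAt u
    (hasMFDerivWithinAt_extend_symm he hu)).hasFDerivWithinAt

lemma eventually_eq_of_mfderiv_eq_zero {f : M → ℝ} {U : Set M} (hU : IsOpen U)
    (hf : ∀ x ∈ U, HasMFDerivAt I 𝓘(ℝ, ℝ) f x (0 : TangentSpace I x →L[ℝ] ℝ)) {x : M}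
    (hx : x ∈ U) : ∀ᶠ y in 𝓝 x, f y = f x := by
  have he : chartAt H x ∈ IsManifold.maximalAtlas I ∞ M := IsManifold.chart_mem_maximalAtlas _
  generalize hE : chartAt H x = e at he
  have hxe : x ∈ e.source := hE ▸ mem_chart_source H x
  have hu : e.extend I x ∈ (e.extend I).target :=
    (e.extend I).map_source (by rwa [e.extend_source])
  have hnear : ∀ᶠ u in 𝓝[range I] (e.extend I x),
      u ∈ (e.extend I).target ∧ (e.extend I).symm u ∈ U := by
    have h1 := (contMDiffWithinAt_extend_symm he hu).continuousWithinAt.preimage_mem_nhdsWithin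
      (by rw [e.extend_left_inv hxe]; exact hU.mem_nhds hx)
    filter_upwards [extend_target_mem_nhdsWithin' hu, h1] with u hu1 hu2 using ⟨hu1, hu2⟩
  obtain ⟨ε, hε, hball⟩ := Metric.mem_nhdsWithin_iff.1 hnear
  have hd : ∀ u ∈ Metric.ball (e.extend I x) ε ∩ range I,
      HasFDerivWithinAt (fun u ↦ f ((e.extend I).symm u)) (0 : E →L[ℝ] ℝ)
        (Metric.ball (e.extend I x) ε ∩ range I) u := by
    intro u hu'
    obtain ⟨h1, h2⟩ := hball hu'
    have h3 := hasFDerivWithinAt_comp_extend_symm (hf _ h2) he h1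
    rw [ContinuousLinearMap.zero_comp] at h3
    exact h3.mono inter_subset_right
  have hconv : Convex ℝ (Metric.ball (e.extend I x) ε ∩ range I) :=
    (convex_ball _ _).inter I.convex_range
  have hsrc : e.source ∈ 𝓝 x := e.open_source.mem_nhds hxe
  have hpre : ∀ᶠ y in 𝓝 x, e.extend I y ∈ Metric.ball (e.extend I x) ε :=
    (e.continuousAt_extend hxe).eventually (Metric.ball_mem_nhds _ hε)
  filter_upwards [hsrc, hpre] with y hy hy'
  have h1 := hconv.norm_image_sub_le_of_norm_hasFDerivWithin_le (C := 0) hd (by simp)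
    ⟨Metric.mem_ball_self hε, mem_range_self _⟩ ⟨hy', mem_range_self _⟩
  rw [zero_mul] at h1
  have h2 := sub_eq_zero.1 (norm_le_zero_iff.1 h1)
  rwa [e.extend_left_inv hy, e.extend_left_inv hxe] at h2

lemma eq_of_mfderiv_eq_zero [PreconnectedSpace M] {f : M → ℝ}
    (hf : ∀ x, HasMFDerivAt I 𝓘(ℝ, ℝ) f x (0 : TangentSpace I x →L[ℝ] ℝ)) (x y : M) :
    f x = f y :=
  ((IsLocallyConstant.iff_eventually_eq f).2 fun x ↦
    eventually_eq_of_mfderiv_eq_zero (I := I) isOpen_univ (fun x _ ↦ hf x)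
      (mem_univ x)).apply_eq_of_preconnectedSpace x y

/-- The Poincaré lemma on a ball intersected with `range I`, which is convex also at the boundary.
The potential is smooth because its derivative is, and its differential is read back from
coordinates by surjectivity of the frame. -/
lemma exists_local_potential [FiniteDimensional ℝ E] {β : (x : M) → TangentSpace I x →L[ℝ] ℝ}
    (hβ : ∀ e ∈ IsManifold.maximalAtlas I ∞ M, ContDiffOn ℝ ∞ (chartCovector e β)
      (e.extend I).target)
    (hsymm : ∀ e ∈ IsManifold.maximalAtlas I ∞ M, ∀ u ∈ (e.extend I).target, ∀ v w : E,
      fderivWithin ℝ (chartCovector e β) (range I) u v w =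
        fderivWithin ℝ (chartCovector e β) (range I) u w v) (x₀ : M) :
    ∃ U : Set M, IsOpen U ∧ x₀ ∈ U ∧ ∃ f : M → ℝ, ContMDiffOn I 𝓘(ℝ, ℝ) ∞ f U ∧
      ∀ x ∈ U, mfderiv I 𝓘(ℝ, ℝ) f x = β x := by
  have he : chartAt H x₀ ∈ IsManifold.maximalAtlas I ∞ M := IsManifold.chart_mem_maximalAtlas _
  generalize hE : chartAt H x₀ = e at he
  have hxe : x₀ ∈ e.source := hE ▸ mem_chart_source H x₀
  have hu : e.extend I x₀ ∈ (e.extend I).target :=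
    (e.extend I).map_source (by rwa [e.extend_source])
  obtain ⟨ε, hε, hball⟩ := exists_ball_subset_extend_target hu
  set s := Metric.ball (e.extend I x₀) ε ∩ range I with hs
  have hconv : Convex ℝ s := (convex_ball _ _).inter I.convex_range
  have hsU : UniqueDiffOn ℝ s := by
    rw [hs, inter_comm]
    exact I.uniqueDiffOn.inter Metric.isOpen_ball
  have hω : ContDiffOn ℝ ∞ (chartCovector e β) s := (hβ e he).mono hball
  have hfd : ∀ a ∈ s, fderivWithin ℝ (chartCovector e β) s a =
      fderivWithin ℝ (chartCovector e β) (range I) a := by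
    intro a ha
    rw [hs, inter_comm]
    exact fderivWithin_inter (Metric.isOpen_ball.mem_nhds ha.1)
  obtain ⟨φ, hφ⟩ := hconv.exists_forall_hasFDerivWithinAt_of_fderivWithin_symmetric
    (hω.differentiableOn (by simp)) fun a ha x _ y _ ↦ by
      rw [hfd a ha]
      exact hsymm e he a (hball ha) x y
  have hφs : ContDiffOn ℝ ∞ φ s := by
    rw [contDiffOn_infty_iff_fderivWithin hsU]
    exact ⟨fun a ha ↦ (hφ a ha).differentiableWithinAt,
      hω.congr fun a ha ↦ (hφ a ha).fderivWithin (hsU a ha)⟩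
  set U := e.source ∩ e.extend I ⁻¹' Metric.ball (e.extend I x₀) ε with hU
  have hUo : IsOpen U := e.isOpen_extend_preimage Metric.isOpen_ball
  have hf : ContMDiffOn I 𝓘(ℝ, ℝ) ∞ (φ ∘ e.extend I) U :=
    hφs.contMDiffOn.comp (fun x hx ↦ (e.contMDiffAt_extend he hx.1).contMDiffWithinAt)
      fun x hx ↦ ⟨hx.2, mem_range_self _⟩
  refine ⟨U, hUo, ⟨hxe, Metric.mem_ball_self hε⟩, φ ∘ e.extend I, hf, fun x hx ↦ ?_⟩
  have hxs : e.extend I x ∈ s := ⟨hx.2, mem_range_self _⟩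
  have hxt := hball hxs
  have hmd : MDifferentiableAt I 𝓘(ℝ, ℝ) (φ ∘ e.extend I) x :=
    ((hf x hx).contMDiffAt (hUo.mem_nhds hx)).mdifferentiableAt (by simp)
  have hmd' : MDifferentiableAt I 𝓘(ℝ, ℝ) (φ ∘ e.extend I)
      ((e.extend I).symm (e.extend I x)) := by
    rwa [e.extend_left_inv hx.1]
  let L : E →L[ℝ] ℝ := mfderiv I 𝓘(ℝ, ℝ) (φ ∘ e.extend I) ((e.extend I).symm (e.extend I x))
  have key : L.comp (frame I e (e.extend I x) : E →L[ℝ] E) =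
      chartCovector e β (e.extend I x) := by
    have h1 := (hasFDerivWithinAt_comp_extend_symm hmd'.hasMFDerivAt he hxt).mono
      (inter_subset_right (s := Metric.ball (e.extend I x₀) ε))
    have h2 : HasFDerivWithinAt (fun u ↦ (φ ∘ e.extend I) ((e.extend I).symm u))
        (chartCovector e β (e.extend I x)) s (e.extend I x) := by
      refine (hφ _ hxs).congr (fun u hu ↦ ?_) ?_
      · exact congrArg φ ((e.extend I).right_inv (hball hu))
      · exact congrArg φ ((e.extend I).right_inv hxt)
    exact (hsU _ hxs).eq h1 h2
  have key2 : mfderiv I 𝓘(ℝ, ℝ) (φ ∘ e.extend I) ((e.extend I).symm (e.extend I x)) =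
      β ((e.extend I).symm (e.extend I x)) := by
    ext w
    obtain ⟨v, rfl⟩ := frame_surjective he hxt w
    exact congrArg (fun L : E →L[ℝ] ℝ ↦ L v) key
  rwa [e.extend_left_inv hx.1] at key2

lemma exists_potential [FiniteDimensional ℝ E] [SimplyConnectedSpace M]
    [LocallyPathConnectedSpace M] {β : (x : M) → TangentSpace I x →L[ℝ] ℝ}
    (hβ : ∀ e ∈ IsManifold.maximalAtlas I ∞ M, ContDiffOn ℝ ∞ (chartCovector e β)
      (e.extend I).target)
    (hsymm : ∀ e ∈ IsManifold.maximalAtlas I ∞ M, ∀ u ∈ (e.extend I).target, ∀ v w : E,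
      fderivWithin ℝ (chartCovector e β) (range I) u v w =
        fderivWithin ℝ (chartCovector e β) (range I) u w v) :
    ∃ f : M → ℝ, ContMDiff I 𝓘(ℝ, ℝ) ∞ f ∧ ∀ x, β x = mfderiv I 𝓘(ℝ, ℝ) f x := by
  choose U hUo hxU f hf hfβ using exists_local_potential hβ hsymm
  have hmd : ∀ i, ∀ x ∈ U i, HasMFDerivAt I 𝓘(ℝ, ℝ) (f i) x (β x) := by
    intro i x hx
    rw [← hfβ i x hx]
    exact (((hf i x hx).contMDiffAt ((hUo i).mem_nhds hx)).mdifferentiableAt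
      (by simp)).hasMFDerivAt
  obtain ⟨F, hF⟩ := exists_global_potential U hUo hxU f fun i j x hx ↦
    eventually_eq_of_mfderiv_eq_zero (I := I) (f := fun y ↦ f i y - f j y)
      ((hUo i).inter (hUo j)) (fun y hy ↦ by
        have h1 := (hmd i y hy.1).sub (hmd j y hy.2)
        rw [sub_self] at h1
        exact h1) hx
  have hloc : ∀ x, F =ᶠ[𝓝 x] fun y ↦ f x y + (F x - f x x) := by
    intro x
    filter_upwards [hF x x (hxU x)] with y hy
    linarith
  refine ⟨F, fun x ↦ ?_, fun x ↦ ?_⟩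
  · have h1 := (hf x x (hxU x)).contMDiffAt ((hUo x).mem_nhds (hxU x))
    exact (h1.add contMDiffAt_const).congr_of_eventuallyEq (hloc x)
  · have h1 := (hmd x x (hxU x)).add (hasMFDerivAt_const (I := I) (F x - f x x) x)
    exact (add_zero (β x)).symm.trans (h1.congr_of_eventuallyEq (hloc x)).mfderiv.symm

end Generic

section Closed

variable {n : ℕ} [NeZero n] {M : Type*} [TopologicalSpace M]
  [ChartedSpace (EuclideanHalfSpace n) M] [IsManifold (𝓡∂ n) ∞ M]

/-- `Closed` tests coordinate vectors only; bilinearity extends it to the symmetry of the derivative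
that the Poincaré lemma needs. -/
lemma OneForm.Closed.exists_potential [SimplyConnectedSpace M] {β : OneForm n M}
    (h : β.Closed) :
    ∃ f : M → ℝ, ContMDiff (𝓡∂ n) 𝓘(ℝ, ℝ) ∞ f ∧ ∀ x, β.toFun x = differential f x := by
  have : LocallyPathConnectedSpace M :=
    ChartedSpace.locallyPathConnectedSpace (EuclideanHalfSpace n) M
  refine Randers.exists_potential (I := 𝓡∂ n)
    (fun e he ↦ contDiffOn_chartCovector he β.toFun β.contMDiff) fun e he u hu v w ↦ ?_
  have hU := (𝓡∂ n).uniqueDiffOn u (e.extend_target_subset_range hu)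
  have hd := hasFDerivWithinAt_of_contDiffOn_target
    (contDiffOn_chartCovector he β.toFun β.contMDiff) hu
  have h1 : ∀ (j : Fin n) (v : EuclideanSpace ℝ (Fin n)),
      fderivWithin ℝ (β.component e j) (range (𝓡∂ n)) u v =
      fderivWithin ℝ (chartCovector (I := 𝓡∂ n) e β.toFun) (range (𝓡∂ n)) u v (coordVec j) := by
    intro j v
    have := (hasFDerivWithinAt_clm_apply_const hd (coordVec j)).fderivWithin hU
    exact congrArg (fun L : EuclideanSpace ℝ (Fin n) →L[ℝ] ℝ ↦ L v) this
  have h2 := fun i j ↦ h e he u hu i j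
  simp only [h1] at h2
  rw [← sum_smul_coordVec v, ← sum_smul_coordVec w]
  simp only [map_sum, map_smul, sum_apply, smul_apply, h2]
  simp only [Finset.smul_sum, smul_smul]
  rw [Finset.sum_comm]
  refine Finset.sum_congr rfl fun i _ ↦ Finset.sum_congr rfl fun j _ ↦ ?_
  rw [mul_comm, h2]

end Closed

/-! ### Local rigidity of isometries on convex sets. -/

section Local

variable {E F : Type*} [NormedAddCommGroup E] [NormedSpace ℝ E] [NormedAddCommGroup F]
  [NormedSpace ℝ F]

/-- Gronwall's inequality along the segment from `u₀` to `u`. -/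
lemma eq_zero_of_norm_hasFDerivWithinAt_le {Y : E → F} {Y' : E → E →L[ℝ] F} {T : Set E}
    (hT : Convex ℝ T) {K : ℝ} (hY : ∀ u ∈ T, HasFDerivWithinAt Y (Y' u) T u)
    (hK : ∀ u ∈ T, ‖Y' u‖ ≤ K * ‖Y u‖) {u₀ : E} (hu₀ : u₀ ∈ T) (h0 : Y u₀ = 0) :
    ∀ u ∈ T, Y u = 0 := by
  intro u hu
  have hx : ∀ t ∈ Icc (0 : ℝ) 1, AffineMap.lineMap u₀ u t ∈ T := fun t ht ↦
    hT.lineMap_mem hu₀ hu ht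
  have hd : ∀ t ∈ Icc (0 : ℝ) 1, HasDerivWithinAt (fun t ↦ Y (AffineMap.lineMap u₀ u t))
      (Y' (AffineMap.lineMap u₀ u t) (u - u₀)) (Icc 0 1) t := fun t ht ↦
    (hY _ (hx t ht)).comp_hasDerivWithinAt t AffineMap.hasDerivWithinAt_lineMap hx
  have := eq_zero_of_abs_deriv_le_mul_abs_self_of_eq_zero_right (K := K * ‖u - u₀‖)
    (fun t ht ↦ (hd t ht).continuousWithinAt)
    (fun t ht ↦ (hd t ⟨ht.1, ht.2.le⟩).mono_of_mem_nhdsWithin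
      (Icc_mem_nhdsGE_of_mem ht)) (by simpa using h0)
    (fun t ht ↦ by
      refine ((Y' _).le_opNorm _).trans ?_
      rw [mul_right_comm]
      exact mul_le_mul_of_nonneg_right (hK _ (hx t ⟨ht.1, ht.2.le⟩)) (norm_nonneg _))
    1 ⟨zero_le_one, le_rfl⟩
  simpa using this

/-- Koszul's trick: adding the expression in `hR` for `(k, i, j)` and `(i, k, j)` and subtracting
that for `(j, k, i)` leaves twice `A (B k i) (D j)`, hence the bound `3 / 2 * r`. Removing `D`,
which is close to the identity, costs a factor 2, and coercivity the factor `1 / c`. -/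
lemma norm_le_of_bilinear_derivative_bound {A : E →L[ℝ] E →L[ℝ] ℝ} {B : E →L[ℝ] E →L[ℝ] E}
    {D : E →L[ℝ] E} {c r : ℝ} (hc : 0 < c) (hr : 0 ≤ r) (hA : ∀ v w, A v w = A w v)
    (hcoer : ∀ x, c * ‖x‖ ≤ ‖A x‖) (hD : ‖D - ContinuousLinearMap.id ℝ E‖ ≤ 1 / 2)
    (hB : ∀ k i, B k i = B i k)
    (hR : ∀ k i j, |A (B k i) (D j) + A (D i) (B k j)| ≤ r * ‖k‖ * ‖i‖ * ‖j‖) :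
    ‖B‖ ≤ 3 * r / c := by
  refine B.opNorm_le_bound₂ (by positivity) fun k i ↦ ?_
  have h1 : ‖(A (B k i)).comp D‖ ≤ 3 / 2 * (r * ‖k‖ * ‖i‖) := by
    refine ContinuousLinearMap.opNorm_le_bound _ (by positivity) fun j ↦ ?_
    have e1 := abs_le.1 (hR k i j)
    have e2 := abs_le.1 (hR i k j)
    have e3 := abs_le.1 (hR j k i)
    rw [hA (D i), hB k j] at e1
    rw [hA (D k), hB i k, hB i j] at e2
    rw [hA (D k)] at e3
    rw [ContinuousLinearMap.comp_apply, Real.norm_eq_abs, abs_le]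
    constructor <;> nlinarith
  have h2 : ‖A (B k i)‖ ≤ 2 * ‖(A (B k i)).comp D‖ := by
    have h3 : A (B k i) = (A (B k i)).comp D -
        (A (B k i)).comp (D - ContinuousLinearMap.id ℝ E) := by
      ext; simp
    have h4 := norm_sub_le ((A (B k i)).comp D)
      ((A (B k i)).comp (D - ContinuousLinearMap.id ℝ E))
    rw [← h3] at h4
    have h5 := (A (B k i)).opNorm_comp_le (D - ContinuousLinearMap.id ℝ E)
    have h6 := mul_le_mul_of_nonneg_left hD (norm_nonneg (A (B k i)))
    linarith
  have h7 := hcoer (B k i)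
  rw [div_mul_eq_mul_div, div_mul_eq_mul_div, le_div_iff₀ hc]
  nlinarith

/-- The arguments are replaced one at a time; with `‖D x‖ ≤ 2 * ‖x‖` the three replacements cost `1
+ 2 + 4 = 7`. -/
lemma abs_trilinear_sub_le {a b : E →L[ℝ] E →L[ℝ] E →L[ℝ] ℝ} {D : E →L[ℝ] E}
    (hD : ‖D - ContinuousLinearMap.id ℝ E‖ ≤ 1 / 2) (k i j : E) :
    |a k i j - b (D k) (D i) (D j)| ≤
      (‖a - b‖ + 7 * ‖b‖ * ‖D - ContinuousLinearMap.id ℝ E‖) * ‖k‖ * ‖i‖ * ‖j‖ := by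
  set δ := ‖D - ContinuousLinearMap.id ℝ E‖ with hδ
  have hδ0 : 0 ≤ δ := norm_nonneg _
  have hsub : ∀ x, ‖x - D x‖ ≤ δ * ‖x‖ := fun x ↦ by
    have := (D - ContinuousLinearMap.id ℝ E).le_opNorm x
    rw [norm_sub_rev]
    simpa using this
  have hDx : ∀ x, ‖D x‖ ≤ 2 * ‖x‖ := fun x ↦ by
    have h1 := norm_sub_norm_le (D x) x
    rw [norm_sub_rev] at h1
    have h2 := hsub x
    have h3 := mul_le_mul_of_nonneg_right hD (norm_nonneg x)
    linarith [norm_nonneg x]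
  have hb3 : ∀ (L : E →L[ℝ] E →L[ℝ] E →L[ℝ] ℝ) (x y z : E) (p q s : ℝ), ‖x‖ ≤ p → ‖y‖ ≤ q →
      ‖z‖ ≤ s → |L x y z| ≤ ‖L‖ * p * q * s := by
    intro L x y z p q s hp hq hs
    exact (L x y).le_of_opNorm_le_of_le (L.le_of_opNorm₂_le_of_le le_rfl hp hq) hs
  have e : a k i j - b (D k) (D i) (D j) =
      (a - b) k i j + b (k - D k) i j + b (D k) (i - D i) j + b (D k) (D i) (j - D j) := by
    simp only [map_sub, sub_apply]
    ring
  have h1 := hb3 (a - b) k i j _ _ _ le_rfl le_rfl le_rfl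
  have h2 := hb3 b (k - D k) i j _ _ _ (hsub k) le_rfl le_rfl
  have h3 := hb3 b (D k) (i - D i) j _ _ _ (hDx k) (hsub i) le_rfl
  have h4 := hb3 b (D k) (D i) (j - D j) _ _ _ (hDx k) (hDx i) (hsub j)
  rw [e]
  refine (abs_add_le _ _).trans ((add_le_add ((abs_add_le _ _).trans (add_le_add
    ((abs_add_le _ _).trans (add_le_add h1 h2)) h3)) h4).trans_eq ?_)
  ring

lemma exists_coercive [FiniteDimensional ℝ E] {A : E →L[ℝ] E →L[ℝ] ℝ}
    (hA : ∀ w, w ≠ 0 → 0 < A w w) : ∃ c > 0, ∀ A' : E →L[ℝ] E →L[ℝ] ℝ, ‖A' - A‖ ≤ c →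
      ∀ x, c * ‖x‖ ≤ ‖A' x‖ := by
  have hker : A.toLinearMap.ker = ⊥ := by
    rw [LinearMap.ker_eq_bot']
    intro w hw
    by_contra h
    have h1 := hA w h
    have h2 : A w = 0 := hw
    simp [h2] at h1
  obtain ⟨K, hK, hanti⟩ := LinearMap.exists_antilipschitzWith A.toLinearMap hker
  have hK' : (0 : ℝ) < K := hK
  -- `A` is bounded below by `1 / K`; half of this absorbs the perturbation and half remains.
  refine ⟨1 / (2 * K), by positivity, fun A' hA' x ↦ ?_⟩
  have h1 : ‖x‖ ≤ K * ‖A x‖ := hanti.le_mul_norm (map_zero _) x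
  have h2 : ‖A x‖ ≤ ‖A' x‖ + ‖(A' - A) x‖ := by
    have := norm_sub_le (A' x) ((A' - A) x)
    simpa using this
  have h3 := (A' - A).le_of_opNorm_le hA' x
  rw [div_mul_eq_mul_div, one_mul, div_le_iff₀ (by positivity)]
  rw [div_mul_eq_mul_div, one_mul] at h3
  have h4 : ‖x‖ / (2 * K) * (2 * K) = ‖x‖ := by field_simp
  nlinarith

/-- A smooth isometry germ on a convex set with dense interior is the identity as soon as its
1-jet at one point is that of the identity. -/
lemma eventually_eq_self_of_isometry [FiniteDimensional ℝ E] {S : Set E} (hS : Convex ℝ S)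
    (hSu : UniqueDiffOn ℝ S) (hSint : S ⊆ closure (interior S)) {G : E → E →L[ℝ] E →L[ℝ] ℝ}
    {θ : E → E} {u₀ : E} (hu₀ : u₀ ∈ S) (hG : ContDiffWithinAt ℝ ∞ G S u₀)
    (hsymm : ∀ᶠ u in 𝓝[S] u₀, ∀ v w, G u v w = G u w v)
    (hpos : ∀ w, w ≠ 0 → 0 < G u₀ w w) (hθ : ContDiffWithinAt ℝ ∞ θ S u₀)
    (hθS : ∀ᶠ u in 𝓝[S] u₀, θ u ∈ S)
    (hiso : ∀ᶠ u in 𝓝[S] u₀, ∀ v w,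
      G u v w = G (θ u) (fderivWithin ℝ θ S u v) (fderivWithin ℝ θ S u w))
    (h0 : θ u₀ = u₀) (hD0 : fderivWithin ℝ θ S u₀ = ContinuousLinearMap.id ℝ E) :
    ∀ᶠ u in 𝓝[S] u₀, θ u = u := by
  set D := fderivWithin ℝ θ S with hDdef
  set DD := fderivWithin ℝ D S with hDDdef
  set DG := fderivWithin ℝ G S with hDGdef
  have hDc : ContDiffWithinAt ℝ ∞ D S u₀ := hθ.fderivWithin_right hSu (by simp) hu₀
  have hDGc : ContDiffWithinAt ℝ ∞ DG S u₀ := hG.fderivWithin_right hSu (by simp) hu₀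
  -- At order `∞` regularity at a point need not spread to a neighbourhood; at order 2 it does, and
  -- that is enough here.
  have hev : ∀ {X : Type _} [NormedAddCommGroup X] [NormedSpace ℝ X] {f : E → X},
      ContDiffWithinAt ℝ ∞ f S u₀ → ∀ᶠ u in 𝓝[S] u₀, ContDiffWithinAt ℝ 2 f S u := by
    intro X _ _ f hf
    have := (hf.of_le (m := 2) (WithTop.coe_le_coe.2 (le_top (a := (2 : ℕ∞))))).eventually
      (by decide)
    rwa [insert_eq_of_mem hu₀] at this
  have htend : Filter.Tendsto θ (𝓝[S] u₀) (𝓝[S] u₀) := by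
    refine tendsto_nhdsWithin_iff.2 ⟨?_, hθS⟩
    have := hθ.continuousWithinAt.tendsto
    rwa [h0] at this
  obtain ⟨Λ, t, ht, hΛ⟩ := (hDGc.of_le (m := 1) (by simp)).exists_lipschitzOnWith hS
  obtain ⟨c, hc, hcoer⟩ := exists_coercive hpos
  have hGc : ∀ᶠ u in 𝓝[S] u₀, ‖G u - G u₀‖ ≤ c := by
    have := hG.continuousWithinAt.tendsto.eventually (Metric.closedBall_mem_nhds (G u₀) hc)
    filter_upwards [this] with u hu using by rwa [← dist_eq_norm]
  have hDG1 : ∀ᶠ u in 𝓝[S] u₀, ‖DG u‖ ≤ ‖DG u₀‖ + 1 := by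
    have := hDGc.continuousWithinAt.norm.tendsto.eventually
      (Iic_mem_nhds (lt_add_one (‖DG u₀‖)))
    filter_upwards [this] with u hu using hu
  have hD1 : ∀ᶠ u in 𝓝[S] u₀, ‖D u - ContinuousLinearMap.id ℝ E‖ ≤ 1 / 2 := by
    have := hDc.continuousWithinAt.tendsto.eventually
      (Metric.closedBall_mem_nhds (D u₀) (by norm_num : (0 : ℝ) < 1 / 2))
    filter_upwards [this] with u hu using by rwa [← dist_eq_norm, ← hD0]
  have hall := ((hev hθ).and ((hev hDc).and ((hev hG).and ((htend.eventually (hev hG)).and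
    (hθS.and (hD1.and ((Filter.Eventually.and ht (htend.eventually ht)).and
    ((htend.eventually hDG1).and ((htend.eventually hGc).and
    ((htend.eventually hsymm).and hiso))))))))))
  obtain ⟨ε, hε, hball⟩ := Metric.mem_nhdsWithin_iff.1 hall
  set T := Metric.ball u₀ ε ∩ S with hT
  have hTconv : Convex ℝ T := (convex_ball _ _).inter hS
  have hTu : UniqueDiffOn ℝ T := by
    rw [hT, inter_comm]
    exact hSu.inter Metric.isOpen_ball
  have hTS : T ⊆ S := inter_subset_right
  have hu₀T : u₀ ∈ T := ⟨Metric.mem_ball_self hε, hu₀⟩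
  have hder : ∀ {X : Type _} [NormedAddCommGroup X] [NormedSpace ℝ X] {f : E → X} {u : E},
      ContDiffWithinAt ℝ 2 f S u → HasFDerivWithinAt f (fderivWithin ℝ f S u) S u :=
    fun hf ↦ (hf.differentiableWithinAt (by simp)).hasFDerivWithinAt
  -- The deviation of the 1-jet from that of the identity has derivative `(D - id, DD)`. Once `DD`
  -- is bounded by the deviation, this is a linear differential inequality with zero initial value.
  have hmain : ∀ u ∈ T, (θ u - u, D u - ContinuousLinearMap.id ℝ E) =
      (0 : E × (E →L[ℝ] E)) := by
    refine eq_zero_of_norm_hasFDerivWithinAt_le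
      (Y := fun u ↦ (θ u - u, D u - ContinuousLinearMap.id ℝ E))
      (Y' := fun u ↦ (D u - ContinuousLinearMap.id ℝ E).prod (DD u))
      hTconv (K := 1 + 3 * (Λ + 7 * (‖DG u₀‖ + 1)) / c) ?_ ?_ hu₀T (by simp [h0, hD0])
    · intro u hu
      obtain ⟨h1, h2, -⟩ := hball hu
      exact (((hder h1).sub (hasFDerivWithinAt_id u S)).prodMk ((hder h2).sub_const _)).mono hTS
    · intro u hu
      obtain ⟨h1, h2, h3, h4, h5, h6, ⟨h7, h7'⟩, h8, h9, h10, -⟩ := hball hu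
      have hb1 : ‖θ u - u‖ ≤ ‖(θ u - u, D u - ContinuousLinearMap.id ℝ E)‖ :=
        le_max_left _ _
      have hb2 : ‖D u - ContinuousLinearMap.id ℝ E‖ ≤
        ‖(θ u - u, D u - ContinuousLinearMap.id ℝ E)‖ := le_max_right _ _
      set N := ‖(θ u - u, D u - ContinuousLinearMap.id ℝ E)‖
      have hN : 0 ≤ N := norm_nonneg _
      have hDDsymm : ∀ k i, DD u k i = DD u i k := fun k i ↦
        (h1.isSymmSndFDerivWithinAt (by rw [minSmoothness_of_isRCLikeNormedField]) hSu
          (hSint hu.2) hu.2) k i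
      -- The isometry equation differentiated in the direction `k`. As `θ` may leave `T`, the metric
      -- at `θ u` is differentiated within the larger set `S`.
      have hRid : ∀ k i j, DG u k i j - DG (θ u) (D u k) (D u i) (D u j) =
          G (θ u) (DD u k i) (D u j) + G (θ u) (D u i) (DD u k j) := by
        intro k i j
        have e1 := ((hder h3).mono hTS).clm_apply (hasFDerivWithinAt_const i u T)
        have e2 := e1.clm_apply (hasFDerivWithinAt_const j u T)
        have hθT : HasFDerivWithinAt θ (D u) T u := (hder h1).mono hTS
        have hDT : HasFDerivWithinAt D (DD u) T u := (hder h2).mono hTS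
        have hmaps : MapsTo θ T S := fun y hy ↦ (hball hy).2.2.2.2.1
        have e3 := (hder h4).comp u hθT hmaps
        have e4 := (e3.clm_apply (hDT.clm_apply (hasFDerivWithinAt_const i u T))).clm_apply
          (hDT.clm_apply (hasFDerivWithinAt_const j u T))
        have e5 := e4.congr (f₁ := fun y ↦ G y i j) (fun y hy ↦ (hball hy).2.2.2.2.2.2.2.2.2.2 i j)
          ((hball hu).2.2.2.2.2.2.2.2.2.2 i j)
        have e6 := congrArg (fun L : E →L[ℝ] ℝ ↦ L k) ((hTu u hu).eq e2 e5)
        have e7 : DG u k i j = G (θ u) (D u i) (DD u k j) + (G (θ u) (DD u k i) (D u j) +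
            DG (θ u) (D u k) (D u i) (D u j)) := by simpa using e6
        rw [e7]
        ring
      have hR : ‖DD u‖ ≤ 3 * ((Λ + 7 * (‖DG u₀‖ + 1)) * N) / c := by
        refine norm_le_of_bilinear_derivative_bound hc (by positivity) h10 (hcoer _ h9) h6 hDDsymm
          fun k i j ↦ ?_
        rw [← hRid]
        refine (abs_trilinear_sub_le h6 k i j).trans ?_
        gcongr
        have q1 : ‖DG u - DG (θ u)‖ ≤ Λ * N := by
          have := hΛ.dist_le_mul u h7 (θ u) h7'
          rw [dist_eq_norm, dist_eq_norm, norm_sub_rev u] at this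
          exact this.trans (mul_le_mul_of_nonneg_left hb1 Λ.2)
        have q2 : 7 * ‖DG (θ u)‖ * ‖D u - ContinuousLinearMap.id ℝ E‖ ≤
            7 * (‖DG u₀‖ + 1) * N := by gcongr
        linarith
      have hprod : ‖(D u - ContinuousLinearMap.id ℝ E).prod (DD u)‖ ≤
          max ‖D u - ContinuousLinearMap.id ℝ E‖ ‖DD u‖ :=
        (ContinuousLinearMap.opNorm_prod _ _).le
      refine hprod.trans (max_le ?_ ?_)
      · have : 0 ≤ 3 * (Λ + 7 * (‖DG u₀‖ + 1)) / c * N := by positivity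
        linarith
      · refine hR.trans ?_
        have : 3 * ((Λ + 7 * (‖DG u₀‖ + 1)) * N) / c =
          3 * (Λ + 7 * (‖DG u₀‖ + 1)) / c * N := by ring
        linarith
  have : T ∈ 𝓝[S] u₀ := by
    rw [hT, inter_comm]
    exact inter_mem_nhdsWithin S (Metric.ball_mem_nhds _ hε)
  filter_upwards [this] with u hu
  exact sub_eq_zero.1 (congrArg Prod.fst (hmain u hu))

end Local

/-! ### Isometries with a trivial 1-jet on a connected manifold. -/

section Generic

variable {E : Type*} [NormedAddCommGroup E] [NormedSpace ℝ E] {H : Type*} [TopologicalSpace H]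
  {I : ModelWithCorners ℝ E H} {M : Type*} [TopologicalSpace M] [ChartedSpace H M]
  [IsManifold I ∞ M] {e : OpenPartialHomeomorph M H} {Θ : M ≃ₘ^∞⟮I, I⟯ M} {u : E} {x : M}
  {g : (x : M) → TangentSpace I x →L[ℝ] TangentSpace I x →L[ℝ] ℝ}

variable (I) in
/-- The coordinate expression of a self-map. -/
def chartMap (e : OpenPartialHomeomorph M H) (Θ : M → M) (u : E) : E :=
  e.extend I (Θ ((e.extend I).symm u))

lemma contDiffWithinAt_chartMap (he : e ∈ IsManifold.maximalAtlas I ∞ M)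
    (hu : u ∈ (e.extend I).target) (h : Θ ((e.extend I).symm u) ∈ e.source) :
    ContDiffWithinAt ℝ ∞ (chartMap I e Θ) (range I) u := by
  rw [← contMDiffWithinAt_iff_contDiffWithinAt]
  exact (e.contMDiffAt_extend he h).comp_contMDiffWithinAt u
    ((Θ.contMDiff _).comp_contMDiffWithinAt u (contMDiffWithinAt_extend_symm he hu))

lemma eventually_mem_target_and_mem_source (he : e ∈ IsManifold.maximalAtlas I ∞ M)
    (hu : u ∈ (e.extend I).target) (h : Θ ((e.extend I).symm u) ∈ e.source) :
    ∀ᶠ y in 𝓝[range I] u, y ∈ (e.extend I).target ∧ Θ ((e.extend I).symm y) ∈ e.source := by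
  have h1 := ((Θ.contMDiff _).comp_contMDiffWithinAt u
    (contMDiffWithinAt_extend_symm he hu)).continuousWithinAt.preimage_mem_nhdsWithin
    (e.open_source.mem_nhds h)
  filter_upwards [extend_target_mem_nhdsWithin' hu, h1] with y hy1 hy2 using ⟨hy1, hy2⟩

lemma extend_symm_chartMap (h : Θ ((e.extend I).symm u) ∈ e.source) :
    (e.extend I).symm (chartMap I e Θ u) = Θ ((e.extend I).symm u) :=
  e.extend_left_inv h

lemma frame_fderivWithin_chartMap (he : e ∈ IsManifold.maximalAtlas I ∞ M)
    (hu : u ∈ (e.extend I).target) (h : Θ ((e.extend I).symm u) ∈ e.source) (v : E) :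
    (frame I e (chartMap I e Θ u) (fderivWithin ℝ (chartMap I e Θ) (range I) u v) : E) =
      mfderiv I I Θ ((e.extend I).symm u) (frame I e u v) := by
  have hU : UniqueMDiffWithinAt 𝓘(ℝ, E) (range I) u :=
    (I.uniqueDiffOn u (e.extend_target_subset_range hu)).uniqueMDiffWithinAt
  have hθt : chartMap I e Θ u ∈ (e.extend I).target :=
    (e.extend I).map_source (by rwa [e.extend_source])
  have h1 := (hasMFDerivWithinAt_extend_symm he hθt)
  have h2 := ((contDiffWithinAt_chartMap he hu h).differentiableWithinAt
    (by simp)).hasFDerivWithinAt.hasMFDerivWithinAt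
  have h3 := HasMFDerivWithinAt.comp u h1 h2 fun y _ ↦ mem_range_self _
  have h4 := ((Θ.contMDiff ((e.extend I).symm u)).mdifferentiableAt
    (by simp)).hasMFDerivAt.comp_hasMFDerivWithinAt u (hasMFDerivWithinAt_extend_symm he hu)
  have h5 := h3.congr_of_eventuallyEq (f₁ := Θ ∘ (e.extend I).symm) (by
    filter_upwards [eventually_mem_target_and_mem_source he hu h] with y hy
    exact (extend_symm_chartMap hy.2).symm) (extend_symm_chartMap h).symm
  have h6 := (hU.eq h5 h4)
  exact congrArg (fun L : E →L[ℝ] E ↦ L v) h6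

lemma chartForm_chartMap (hΘ : ∀ x v w, g x v w = g (Θ x) (mfderiv I I Θ x v) (mfderiv I I Θ x w))
    (he : e ∈ IsManifold.maximalAtlas I ∞ M)
    (hu : u ∈ (e.extend I).target) (h : Θ ((e.extend I).symm u) ∈ e.source) (v w : E) :
    chartForm e g u v w = chartForm e g (chartMap I e Θ u)
      (fderivWithin ℝ (chartMap I e Θ) (range I) u v)
      (fderivWithin ℝ (chartMap I e Θ) (range I) u w) := by
  rw [chartForm_apply, chartForm_apply, hΘ]
  exact form_congr g (extend_symm_chartMap h).symm (frame_fderivWithin_chartMap he hu h v).symm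
    (frame_fderivWithin_chartMap he hu h w).symm

lemma eventually_isometry_eq_self [FiniteDimensional ℝ E]
    (hG : ContDiffOn ℝ ∞ (chartForm e g) (e.extend I).target)
    (hsymm : ∀ x v w, g x v w = g x w v) (hpos : ∀ x v, v ≠ 0 → 0 < g x v v)
    (hΘ : ∀ x v w, g x v w = g (Θ x) (mfderiv I I Θ x v) (mfderiv I I Θ x w))
    (he : e ∈ IsManifold.maximalAtlas I ∞ M) (hx : x ∈ e.source) (hfix : Θ x = x)
    (hD : fderivWithin ℝ (chartMap I e Θ) (range I) (e.extend I x) =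
      ContinuousLinearMap.id ℝ E) :
    ∀ᶠ y in 𝓝 x, Θ y = y := by
  have hu : e.extend I x ∈ (e.extend I).target :=
    (e.extend I).map_source (by rwa [e.extend_source])
  have hsrc : Θ ((e.extend I).symm (e.extend I x)) ∈ e.source := by
    rwa [e.extend_left_inv hx, hfix]
  have hev := eventually_mem_target_and_mem_source he hu hsrc
  have hloc := eventually_eq_self_of_isometry (u₀ := e.extend I x) I.convex_range I.uniqueDiffOn
    I.range_subset_closure_interior (mem_range_self _)
    ((hG _ hu).mono_of_mem_nhdsWithin (extend_target_mem_nhdsWithin' hu))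
    (Filter.Eventually.of_forall fun u v w ↦ by
      rw [chartForm_apply, chartForm_apply]
      exact hsymm _ _ _)
    (fun w hw ↦ chartForm_pos hpos he hu hw) (contDiffWithinAt_chartMap he hu hsrc)
    (Filter.Eventually.of_forall fun u ↦ mem_range_self _)
    (by filter_upwards [hev] with y hy using chartForm_chartMap hΘ he hy.1 hy.2)
    (by rw [chartMap, e.extend_left_inv hx, hfix]) hD
  have htend : Filter.Tendsto (e.extend I) (𝓝 x) (𝓝[range I] (e.extend I x)) :=
    tendsto_nhdsWithin_iff.2 ⟨e.continuousAt_extend hx,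
      Filter.Eventually.of_forall fun _ ↦ mem_range_self _⟩
  filter_upwards [htend.eventually hloc, htend.eventually hev, e.open_source.mem_nhds hx]
    with y hy1 hy2 hy
  have h1 := congrArg (e.extend I).symm hy1
  rwa [extend_symm_chartMap hy2.2, e.extend_left_inv hy] at h1

lemma fderivWithin_chartMap_of_eventually_eq (he : e ∈ IsManifold.maximalAtlas I ∞ M)
    (hx : x ∈ e.source) (h : ∀ᶠ y in 𝓝 x, Θ y = y) :
    fderivWithin ℝ (chartMap I e Θ) (range I) (e.extend I x) = ContinuousLinearMap.id ℝ E := by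
  have hu : e.extend I x ∈ (e.extend I).target :=
    (e.extend I).map_source (by rwa [e.extend_source])
  have h1 := (contMDiffWithinAt_extend_symm he hu).continuousWithinAt.preimage_mem_nhdsWithin
    (t := {y | Θ y = y}) (by rw [e.extend_left_inv hx]; exact h)
  have h2 : chartMap I e Θ =ᶠ[𝓝[range I] (e.extend I x)] id := by
    filter_upwards [extend_target_mem_nhdsWithin' hu, h1] with y hy1 hy2
    have : Θ ((e.extend I).symm y) = (e.extend I).symm y := hy2
    rw [chartMap, this]
    exact (e.extend I).right_inv hy1
  rw [h2.fderivWithin_eq_of_mem (mem_range_self _),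
    fderivWithin_id (I.uniqueDiffOn (e.extend I x) (mem_range_self _))]

/-- The set `J` of points near which `Θ` is the identity is open. A limit point of `J` is fixed
because `M` is Hausdorff, and by continuity the derivative there is the identity, so local rigidity
puts the point in `J`. -/
lemma isometry_eq_self [FiniteDimensional ℝ E] [T2Space M] [PreconnectedSpace M]
    (hG : ∀ e ∈ IsManifold.maximalAtlas I ∞ M, ContDiffOn ℝ ∞ (chartForm e g) (e.extend I).target)
    (hsymm : ∀ x v w, g x v w = g x w v) (hpos : ∀ x v, v ≠ 0 → 0 < g x v v)
    (hΘ : ∀ x v w, g x v w = g (Θ x) (mfderiv I I Θ x v) (mfderiv I I Θ x w))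
    (h : ∀ᶠ y in 𝓝 x, Θ y = y) (y : M) : Θ y = y := by
  set J : Set M := {x | ∀ᶠ y in 𝓝 x, Θ y = y} with hJ
  have hJo : IsOpen J := isOpen_setOfPred_eventually_nhds
  have hJc : IsClosed J := by
    refine isClosed_of_closure_subset fun z hz ↦ ?_
    have hfix : Θ z = z :=
      closure_minimal (fun w (hw : w ∈ J) ↦ hw.self_of_nhds)
        (isClosed_eq Θ.continuous continuous_id) hz
    have he : chartAt H z ∈ IsManifold.maximalAtlas I ∞ M := IsManifold.chart_mem_maximalAtlas _
    generalize hE : chartAt H z = e at he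
    have hze : z ∈ e.source := hE ▸ mem_chart_source H z
    have hu : e.extend I z ∈ (e.extend I).target :=
      (e.extend I).map_source (by rwa [e.extend_source])
    refine eventually_isometry_eq_self (hG e he) hsymm hpos hΘ he hze hfix ?_
    by_contra hne
    have hc := ((contDiffWithinAt_chartMap he hu
      (by rwa [e.extend_left_inv hze, hfix])).fderivWithin_right (m := ∞) I.uniqueDiffOn
      (by simp) (mem_range_self _)).continuousWithinAt
    have htend : Filter.Tendsto (e.extend I) (𝓝 z) (𝓝[range I] (e.extend I z)) :=
      tendsto_nhdsWithin_iff.2 ⟨e.continuousAt_extend hze,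
        Filter.Eventually.of_forall fun _ ↦ mem_range_self _⟩
    have h1 := htend.eventually (hc.tendsto.eventually (isOpen_ne.mem_nhds hne))
    obtain ⟨w, hwJ, hw1, hw2⟩ := ((mem_closure_iff_frequently.1 hz).and_eventually
      (h1.and (e.open_source.mem_nhds hze))).exists
    exact hw1 (fderivWithin_chartMap_of_eventually_eq he hw2 hwJ)
  have huniv : J = univ := IsClopen.eq_univ ⟨hJc, hJo⟩ ⟨x, h⟩
  exact (huniv ▸ mem_univ y : y ∈ J).self_of_nhds

end Generic

/-! ### Isometries fixing the boundary. -/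

section Boundary

/-- The vector `d = D ν - ν` is orthogonal to the fixed hyperplane, and to `D ν + ν` since `D`
preserves the length of `ν`. As `ℓ (D ν + ν) ≥ 1`, these span everything, so `d = 0`; the sign
condition `hDν` excludes the reflection. -/
lemma eq_id_of_isometry_of_eq_on_ker {E : Type*} [NormedAddCommGroup E] [NormedSpace ℝ E]
    {A : E →L[ℝ] E →L[ℝ] ℝ} {D : E →L[ℝ] E} {ℓ : E →L[ℝ] ℝ} {ν : E}
    (hA : ∀ v w, A v w = A w v) (hpos : ∀ v, v ≠ 0 → 0 < A v v)
    (hD : ∀ v w, A (D v) (D w) = A v w) (hker : ∀ v, ℓ v = 0 → D v = v) (hν : ℓ ν = 1)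
    (hDν : 0 ≤ ℓ (D ν)) : D = ContinuousLinearMap.id ℝ E := by
  have hdecomp : ∀ v, ℓ (v - ℓ v • ν) = 0 := fun v ↦ by simp [hν]
  set d := D ν - ν with hd
  have h1 : ∀ v, ℓ v = 0 → A d v = 0 := fun v hv ↦ by
    rw [hd, map_sub, sub_apply]
    nth_rewrite 1 [← hker v hv]
    rw [hD, sub_self]
  have h2 : A d ν = 0 := by
    have e1 : A d (D ν + ν) = 0 := by
      have := hD ν ν
      rw [hd, map_sub, sub_apply, map_add, map_add, this, hA ν (D ν)]
      ring
    have e2 := h1 _ (hdecomp (D ν))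
    rw [map_sub, map_smul, smul_eq_mul] at e2
    rw [map_add] at e1
    have e3 : (ℓ (D ν) + 1) * A d ν = 0 := by linarith
    exact (mul_eq_zero.1 e3).resolve_left (by linarith)
  have h3 : ∀ v, A d v = 0 := fun v ↦ by
    have := h1 _ (hdecomp v)
    rw [map_sub, map_smul, h2] at this
    simpa using this
  have h4 : d = 0 := by_contra fun h ↦ (hpos d h).ne' (h3 d)
  ext1 v
  have h5 := hker _ (hdecomp v)
  rw [map_sub, map_smul, sub_eq_zero.1 h4] at h5
  simpa using h5

variable {n : ℕ} [NeZero n] {M : Type*} [TopologicalSpace M]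
  [ChartedSpace (EuclideanHalfSpace n) M] [IsManifold (𝓡∂ n) ∞ M] {g : Metric n M}
  {Θ : M ≃ₘ^∞⟮𝓡∂ n, 𝓡∂ n⟯ M}

/-- Interior points can be recognised in any chart of the atlas, where they have a positive zeroth
coordinate. -/
lemma extend_chartAt_symm_mem_boundary {x : M} {u : EuclideanSpace ℝ (Fin n)}
    (hu : u ∈ ((chartAt (EuclideanHalfSpace n) x).extend (𝓡∂ n)).target) (h : u 0 = 0) :
    ((chartAt (EuclideanHalfSpace n) x).extend (𝓡∂ n)).symm u ∈ (𝓡∂ n).boundary M := by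
  rw [← ModelWithCorners.compl_interior]
  intro hint
  have h1 := ((𝓡∂ n).isInteriorPoint_iff_of_mem_atlas (n := ∞) (by simp)
    (chart_mem_atlas _ x) (extend_symm_mem_source hu)).1 hint
  rw [PartialEquiv.right_inv _ hu] at h1
  have h2 := interior_mono (OpenPartialHomeomorph.extend_target_subset_range _) h1
  rw [interior_range_modelWithCornersEuclideanHalfSpace] at h2
  exact (ne_of_gt h2) h

lemma fderivWithin_chartMap_of_fixesBoundary (hΘ : IsPullbackMetric Θ g g)
    (hfix : FixesBoundary Θ) {x : M} (hx : x ∈ (𝓡∂ n).boundary M) :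
    fderivWithin ℝ (chartMap (𝓡∂ n) (chartAt (EuclideanHalfSpace n) x) Θ) (range (𝓡∂ n))
      ((chartAt (EuclideanHalfSpace n) x).extend (𝓡∂ n) x) =
      ContinuousLinearMap.id ℝ (EuclideanSpace ℝ (Fin n)) := by
  have he : chartAt (EuclideanHalfSpace n) x ∈ IsManifold.maximalAtlas (𝓡∂ n) ∞ M :=
    IsManifold.chart_mem_maximalAtlas _
  set e := chartAt (EuclideanHalfSpace n) x with hedef
  have hxe : x ∈ e.source := mem_chart_source _ _
  set u₀ := e.extend (𝓡∂ n) x with hu₀def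
  have hu : u₀ ∈ (e.extend (𝓡∂ n)).target :=
    (e.extend (𝓡∂ n)).map_source (by rwa [e.extend_source])
  have hsymm0 : (e.extend (𝓡∂ n)).symm u₀ = x := e.extend_left_inv hxe
  have hsrc : Θ ((e.extend (𝓡∂ n)).symm u₀) ∈ e.source := by
    rwa [hsymm0, hfix x hx]
  have hθ0 : chartMap (𝓡∂ n) e Θ u₀ = u₀ := by rw [chartMap, hsymm0, hfix x hx]
  have h0 : u₀ 0 = 0 := by
    have h1 : u₀ ∈ frontier (range (𝓡∂ n)) := hx
    rw [frontier_range_modelWithCornersEuclideanHalfSpace] at h1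
    exact h1.symm
  have hd := ((contDiffWithinAt_chartMap he hu hsrc).differentiableWithinAt
    (by simp)).hasFDerivWithinAt
  set D := fderivWithin ℝ (chartMap (𝓡∂ n) e Θ) (range (𝓡∂ n)) u₀ with hD
  have hray : ∀ v : EuclideanSpace ℝ (Fin n), 0 ≤ v 0 →
      HasDerivWithinAt (fun s : ℝ ↦ chartMap (𝓡∂ n) e Θ (u₀ + s • v)) (D v) (Ici 0) 0 := by
    intro v hv
    have h1 : HasDerivWithinAt (fun s : ℝ ↦ u₀ + s • v) v (Ici 0) 0 := by
      have := ((hasDerivWithinAt_id (0 : ℝ) (Ici 0)).smul_const v).const_add u₀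
      simpa using this
    have h2 : HasFDerivWithinAt (chartMap (𝓡∂ n) e Θ) D (range (𝓡∂ n)) (u₀ + (0 : ℝ) • v) := by
      simpa using hd
    refine h2.comp_hasDerivWithinAt 0 h1 fun s hs ↦ ?_
    rw [range_modelWithCornersEuclideanHalfSpace]
    have : 0 ≤ s * v 0 := mul_nonneg hs hv
    simpa [h0] using this
  have hA : ∀ v w, chartMetric g e u₀ (D v) (D w) = chartMetric g e u₀ v w := fun v w ↦ by
    have := chartForm_chartMap hΘ he hu hsrc v w
    rw [hθ0] at this
    exact this.symm
  refine eq_id_of_isometry_of_eq_on_ker (A := chartMetric g e u₀)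
    (ℓ := EuclideanSpace.proj 0) (ν := coordVec 0) (fun v w ↦ chartMetric_symm u₀ v w)
    (fun v hv ↦ chartMetric_pos he hu hv) hA ?_ (by simp [coordVec]) ?_
  · intro v hv
    have hv0 : v 0 = 0 := hv
    have h1 := hray v hv0.ge
    have h2 : HasDerivWithinAt (fun s : ℝ ↦ u₀ + s • v) v (Ici 0) 0 := by
      have := ((hasDerivWithinAt_id (0 : ℝ) (Ici 0)).smul_const v).const_add u₀
      simpa using this
    have htend : Filter.Tendsto (fun s : ℝ ↦ u₀ + s • v) (𝓝 0) (𝓝[range (𝓡∂ n)] u₀) := by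
      refine tendsto_nhdsWithin_iff.2 ⟨?_, Filter.Eventually.of_forall fun s ↦ ?_⟩
      · have : Continuous fun s : ℝ ↦ u₀ + s • v := by fun_prop
        simpa using this.tendsto 0
      · rw [range_modelWithCornersEuclideanHalfSpace]
        simp [h0, hv0]
    have h3 : ∀ᶠ s : ℝ in 𝓝 0, chartMap (𝓡∂ n) e Θ (u₀ + s • v) = u₀ + s • v := by
      filter_upwards [htend (extend_target_mem_nhdsWithin' hu)] with s hs
      have hs' : u₀ + s • v ∈ (e.extend (𝓡∂ n)).target := hs
      have := hfix _ (extend_chartAt_symm_mem_boundary hs' (by simp [h0, hv0]))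
      rw [chartMap, this]
      exact (e.extend (𝓡∂ n)).right_inv hs'
    have h4 := h2.congr_of_eventuallyEq (h3.filter_mono nhdsWithin_le_nhds) h3.self_of_nhds
    exact (uniqueDiffOn_Ici (0 : ℝ) 0 (by simp)).eq_deriv _ h1 h4
  -- Along the inward ray the zeroth coordinate of the image is nonnegative and starts at `0`, so
  -- its slopes are nonnegative.
  · have h1 := hray (coordVec 0) (by simp [coordVec])
    have h2 : HasDerivWithinAt (fun s : ℝ ↦
        chartMap (𝓡∂ n) e Θ (u₀ + s • coordVec 0) 0) (D (coordVec 0) 0) (Ioi 0) 0 :=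
      ((EuclideanSpace.proj (𝕜 := ℝ) (0 : Fin n)).hasFDerivAt.comp_hasDerivWithinAt 0 h1).mono
        Ioi_subset_Ici_self
    rw [hasDerivWithinAt_iff_tendsto_slope' (by simp)] at h2
    refine ge_of_tendsto h2 ?_
    filter_upwards [self_mem_nhdsWithin] with s hs
    have h3 : 0 ≤ chartMap (𝓡∂ n) e Θ (u₀ + s • coordVec 0) 0 := by
      have : chartMap (𝓡∂ n) e Θ (u₀ + s • coordVec 0) ∈ range (𝓡∂ n) := mem_range_self _
      rwa [range_modelWithCornersEuclideanHalfSpace] at this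
    have h4 : chartMap (𝓡∂ n) e Θ (u₀ + (0 : ℝ) • coordVec 0) 0 = 0 := by
      rw [zero_smul, add_zero, hθ0, h0]
    rw [slope_def_field, h4]
    have hs' : 0 < s := hs
    exact div_nonneg (by linarith) (by linarith)

lemma isometry_eq_self_of_fixesBoundary [T2Space M] [PreconnectedSpace M]
    (hM : ((𝓡∂ n).boundary M).Nonempty) (hΘ : IsPullbackMetric Θ g g)
    (hfix : FixesBoundary Θ) (y : M) : Θ y = y := by
  obtain ⟨x, hx⟩ := hM
  have he : chartAt (EuclideanHalfSpace n) x ∈ IsManifold.maximalAtlas (𝓡∂ n) ∞ M :=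
    IsManifold.chart_mem_maximalAtlas _
  exact isometry_eq_self (fun e he ↦ contDiffOn_chartMetric g he) g.symm g.pos hΘ
    (eventually_isometry_eq_self (contDiffOn_chartMetric g he) g.symm g.pos hΘ he
      (mem_chart_source _ _) (hfix x hx) (fderivWithin_chartMap_of_fixesBoundary hΘ hfix hx)) y

end Boundary

/-! ### Uniqueness of the diffeomorphism, and relations between forms in terms of potentials. -/

section Pullback

variable {n : ℕ} [NeZero n] {M : Type*} [TopologicalSpace M]
  [ChartedSpace (EuclideanHalfSpace n) M] [IsManifold (𝓡∂ n) ∞ M] {g₁ g₂ g₃ : Metric n M}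
  {Φ Ψ : M ≃ₘ^∞⟮𝓡∂ n, 𝓡∂ n⟯ M}

lemma IsPullbackMetric.trans (h₁ : IsPullbackMetric Φ g₁ g₂) (h₂ : IsPullbackMetric Ψ g₂ g₃) :
    IsPullbackMetric (Ψ.trans Φ) g₁ g₃ := by
  intro x v w
  have h : mfderiv (𝓡∂ n) (𝓡∂ n) (Ψ.trans Φ) x =
      (mfderiv (𝓡∂ n) (𝓡∂ n) Φ (Ψ x)).comp (mfderiv (𝓡∂ n) (𝓡∂ n) Ψ x) :=
    mfderiv_comp x ((Φ.contMDiff _).mdifferentiableAt (by simp))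
      ((Ψ.contMDiff _).mdifferentiableAt (by simp))
  rw [h₂, h₁, h]
  rfl

lemma IsPullbackMetric.symm (h : IsPullbackMetric Ψ g₁ g₂) : IsPullbackMetric Ψ.symm g₂ g₁ := by
  intro x v w
  have h1 : ∀ v : TangentSpace (𝓡∂ n) x, (mfderiv (𝓡∂ n) (𝓡∂ n) Ψ (Ψ.symm x)
      (mfderiv (𝓡∂ n) (𝓡∂ n) Ψ.symm x v) : EuclideanSpace ℝ (Fin n)) = v := by
    intro v
    have h2 := ((Ψ.contMDiff (Ψ.symm x)).mdifferentiableAt (by simp)).hasMFDerivAt.comp x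
      ((Ψ.symm.contMDiff x).mdifferentiableAt (by simp)).hasMFDerivAt
    have h3 : (Ψ ∘ Ψ.symm : M → M) = id := funext Ψ.apply_symm_apply
    rw [h3] at h2
    have h4 := hasMFDerivAt_unique h2 (hasMFDerivAt_id x)
    exact congrArg (fun L : EuclideanSpace ℝ (Fin n) →L[ℝ] EuclideanSpace ℝ (Fin n) ↦ L v) h4
  rw [h]
  exact (form_congr g₁.inner (Ψ.apply_symm_apply x) (h1 v) (h1 w)).symm

lemma FixesBoundary.symm (h : FixesBoundary Ψ) : FixesBoundary Ψ.symm := fun x hx ↦ by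
  rw [← h x hx, Ψ.symm_apply_apply, h x hx]

lemma FixesBoundary.trans (h₁ : FixesBoundary Φ) (h₂ : FixesBoundary Ψ) :
    FixesBoundary (Ψ.trans Φ) := fun x hx ↦
  (congrArg Φ (h₂ x hx)).trans (h₁ x hx)

/-- A diffeomorphism that is the identity on the boundary is determined by the pullback of one
Riemannian metric. -/
lemma IsPullbackMetric.eq [T2Space M] [PreconnectedSpace M]
    (hM : ((𝓡∂ n).boundary M).Nonempty) (h₁ : IsPullbackMetric Φ g₁ g₂)
    (h₂ : IsPullbackMetric Ψ g₁ g₂) (hΦ : FixesBoundary Φ) (hΨ : FixesBoundary Ψ) (x : M) :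
    Φ x = Ψ x := by
  have := isometry_eq_self_of_fixesBoundary hM (h₁.trans h₂.symm) (hΦ.trans hΨ.symm) (Ψ x)
  rw [← this]
  exact congrArg Φ (Ψ.symm_apply_apply x).symm

lemma differential_add {a b : M → ℝ} (ha : ContMDiff (𝓡∂ n) 𝓘(ℝ, ℝ) ∞ a)
    (hb : ContMDiff (𝓡∂ n) 𝓘(ℝ, ℝ) ∞ b) (x : M) :
    differential (n := n) (fun y ↦ a y + b y) x = differential a x + differential b x :=
  (((ha x).mdifferentiableAt (by simp)).hasMFDerivAt.add
    ((hb x).mdifferentiableAt (by simp)).hasMFDerivAt).mfderiv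

lemma differential_comp {a : M → ℝ} (ha : ContMDiff (𝓡∂ n) 𝓘(ℝ, ℝ) ∞ a) (x : M) :
    differential (n := n) (fun y ↦ a (Ψ y)) x =
      (differential a (Ψ x)).comp (mfderiv (𝓡∂ n) (𝓡∂ n) Ψ x) :=
  mfderiv_comp x ((ha _).mdifferentiableAt (by simp)) ((Ψ.contMDiff _).mdifferentiableAt (by simp))

lemma differential_eq_iff [PreconnectedSpace M] [Nonempty M] {a b : M → ℝ}
    (ha : ContMDiff (𝓡∂ n) 𝓘(ℝ, ℝ) ∞ a) (hb : ContMDiff (𝓡∂ n) 𝓘(ℝ, ℝ) ∞ b) :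
    (∀ x, differential (n := n) a x = differential b x) ↔ ∃ c, ∀ x, a x = b x + c := by
  constructor
  · intro h
    have hd : ∀ x, HasMFDerivAt (𝓡∂ n) 𝓘(ℝ, ℝ) (fun y ↦ a y - b y) x
        (0 : TangentSpace (𝓡∂ n) x →L[ℝ] ℝ) := by
      intro x
      have h1 := ((ha x).mdifferentiableAt (by simp)).hasMFDerivAt.sub
        ((hb x).mdifferentiableAt (by simp)).hasMFDerivAt
      have h2 := h x
      unfold differential at h2
      rw [h2] at h1
      exact h1.congr_mfderiv (sub_self (mfderiv (𝓡∂ n) 𝓘(ℝ, ℝ) b x))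
    obtain ⟨x₀⟩ : Nonempty M := inferInstance
    refine ⟨a x₀ - b x₀, fun x ↦ ?_⟩
    have := eq_of_mfderiv_eq_zero hd x x₀
    linarith
  · rintro ⟨c, hc⟩ x
    have h1 := ((hb x).mdifferentiableAt (by simp)).hasMFDerivAt.add
      (hasMFDerivAt_const (I := 𝓡∂ n) c x)
    have h2 : a = b + fun _ ↦ c := funext hc
    rw [differential, h2]
    exact h1.mfderiv.trans (add_zero (mfderiv (𝓡∂ n) 𝓘(ℝ, ℝ) b x))

variable {β₁ β₂ : OneForm n M} {f₁ f₂ φ : M → ℝ}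

lemma differsBy_iff [PreconnectedSpace M] [Nonempty M] (hf₁ : ContMDiff (𝓡∂ n) 𝓘(ℝ, ℝ) ∞ f₁)
    (hf₂ : ContMDiff (𝓡∂ n) 𝓘(ℝ, ℝ) ∞ f₂) (hφ : ContMDiff (𝓡∂ n) 𝓘(ℝ, ℝ) ∞ φ)
    (hβ₁ : ∀ x, β₁.toFun x = differential f₁ x) (hβ₂ : ∀ x, β₂.toFun x = differential f₂ x) :
    DiffersBy β₁ β₂ φ ↔ ∃ c, ∀ x, f₂ x = f₁ x + φ x + c := by
  rw [← differential_eq_iff (b := fun x ↦ f₁ x + φ x) hf₂ (hf₁.add hφ)]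
  refine forall_congr' fun x ↦ ?_
  rw [hβ₁, hβ₂, differential_add hf₁ hφ]

lemma pullbackDiffersBy_iff [PreconnectedSpace M] [Nonempty M]
    (hf₁ : ContMDiff (𝓡∂ n) 𝓘(ℝ, ℝ) ∞ f₁) (hf₂ : ContMDiff (𝓡∂ n) 𝓘(ℝ, ℝ) ∞ f₂)
    (hφ : ContMDiff (𝓡∂ n) 𝓘(ℝ, ℝ) ∞ φ) (hβ₁ : ∀ x, β₁.toFun x = differential f₁ x)
    (hβ₂ : ∀ x, β₂.toFun x = differential f₂ x) :
    PullbackDiffersBy Ψ β₁ β₂ φ ↔ ∃ c, ∀ x, f₂ x = f₁ (Ψ x) + φ x + c := by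
  rw [← differential_eq_iff (b := fun x ↦ f₁ (Ψ x) + φ x) hf₂ ((hf₁.comp Ψ.contMDiff).add hφ)]
  refine forall_congr' fun x ↦ ?_
  rw [hβ₁, hβ₂, ← differential_comp hf₁]
  exact (congrArg (differential f₂ x = ·)
    (differential_add (hf₁.comp Ψ.contMDiff) hφ x).symm).to_iff

lemma randers_eq_pullback_add (h₁ : PullbackDiffersBy Ψ β₁ β₂ φ) (h₂ : IsPullbackMetric Ψ g₁ g₂)
    (x : M) (y : TangentSpace (𝓡∂ n) x) :
    randers g₂ β₂ x y = pullback Ψ (randers g₁ β₁) x y + differential φ x y := by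
  rw [randers, metricNorm, h₂, h₁, pullback, randers, metricNorm, add_assoc]
  rfl

end Pullback

end Randers

end

theorem theorem2 {n : ℕ} [NeZero n] (hn : 2 ≤ n)
    {M : Type*} [TopologicalSpace M] [T2Space M] [CompactSpace M] [SimplyConnectedSpace M]
    [ChartedSpace (EuclideanHalfSpace n) M] [IsManifold (𝓡∂ n) ∞ M]
    (hM : ((𝓡∂ n).boundary M).Nonempty)
    (g₁ g₂ : Randers.Metric n M) (β₁ β₂ : Randers.OneForm n M)
    (hβ₁ : β₁.Closed) (hβ₂ : β₂.Closed)
    (hn₁ : Randers.dualNorm (Randers.metricNorm g₁) β₁.toFun < 1)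
    (hn₂ : Randers.dualNorm (Randers.metricNorm g₂) β₂.toFun < 1)
    (hg₁ : Randers.Admissible (Randers.metricNorm g₁))
    (hg₂ : Randers.Admissible (Randers.metricNorm g₂))
    (hF₁ : Randers.Admissible (Randers.randers g₁ β₁))
    (hF₂ : Randers.Admissible (Randers.randers g₂ β₂))
    (hrigid : Randers.BoundaryRigid g₁ g₂ hg₁ hg₂) :
    List.TFAE
      [∀ p q : (𝓡∂ n).boundary M,
          Randers.boundaryDist (Randers.randers g₁ β₁) hF₁ p q
            = Randers.boundaryDist (Randers.randers g₂ β₂) hF₂ p q,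
        ∃! φ : C^∞⟮𝓡∂ n, M; 𝓘(ℝ, ℝ), ℝ⟯, (∀ x ∈ (𝓡∂ n).boundary M, φ x = 0) ∧
          ∃ Ψ : M ≃ₘ^∞⟮𝓡∂ n, 𝓡∂ n⟯ M, Randers.FixesBoundary Ψ ∧
            Randers.DiffersBy β₁ β₂ φ ∧ Randers.IsPullbackMetric Ψ g₁ g₂,
        ∃! φ : C^∞⟮𝓡∂ n, M; 𝓘(ℝ, ℝ), ℝ⟯, (∀ x ∈ (𝓡∂ n).boundary M, φ x = 0) ∧
          ∃ Ψ : M ≃ₘ^∞⟮𝓡∂ n, 𝓡∂ n⟯ M, Randers.FixesBoundary Ψ ∧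
            Randers.PullbackDiffersBy Ψ β₁ β₂ φ ∧ Randers.IsPullbackMetric Ψ g₁ g₂] ∧
    ∀ (φ : C^∞⟮𝓡∂ n, M; 𝓘(ℝ, ℝ), ℝ⟯) (Ψ : M ≃ₘ^∞⟮𝓡∂ n, 𝓡∂ n⟯ M),
      Randers.PullbackDiffersBy Ψ β₁ β₂ φ → Randers.IsPullbackMetric Ψ g₁ g₂ →
        ∀ (x : M) (y : TangentSpace (𝓡∂ n) x),
          Randers.randers g₂ β₂ x y
            = Randers.pullback Ψ (Randers.randers g₁ β₁) x y + Randers.differential φ x y := by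
  obtain ⟨f₁, hf₁, hd₁⟩ := hβ₁.exists_potential
  obtain ⟨f₂, hf₂, hd₂⟩ := hβ₂.exists_potential
  have hb₁ := Randers.boundaryDist_randers (Randers.randers_pos hn₁) hf₁ hd₁ hg₁ hF₁
  have hb₂ := Randers.boundaryDist_randers (Randers.randers_pos hn₂) hf₂ hd₂ hg₂ hF₂
  obtain ⟨p₀, hp₀⟩ := hM
  have hM : ((𝓡∂ n).boundary M).Nonempty := ⟨p₀, hp₀⟩
  refine ⟨?_, fun φ Ψ h₁ h₂ ↦ Randers.randers_eq_pullback_add h₁ h₂⟩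
  tfae_have 1 → 2 := by
    intro h
    have hsum := fun p q ↦ (h p q).symm.trans (hb₁ p q) |>.symm.trans (hb₂ p q)
    have hsymm₁ := Randers.boundaryDist_metricNorm_comm hg₁
    have hsymm₂ := Randers.boundaryDist_metricNorm_comm hg₂
    -- Adding the identities for `(p, q)` and `(q, p)` cancels the potentials.
    obtain ⟨Ψ, hΨ, hΨg⟩ := hrigid fun p q ↦ by
      linarith [hsum p q, hsum q p, hsymm₁ p q, hsymm₂ p q]
    -- Subtracting them instead cancels the distances.
    have hconst : ∀ x ∈ (𝓡∂ n).boundary M, f₂ x - f₁ x = f₂ p₀ - f₁ p₀ := fun x hx ↦ by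
      linarith [hsum ⟨p₀, hp₀⟩ ⟨x, hx⟩, hsum ⟨x, hx⟩ ⟨p₀, hp₀⟩, hsymm₁ ⟨p₀, hp₀⟩ ⟨x, hx⟩,
        hsymm₂ ⟨p₀, hp₀⟩ ⟨x, hx⟩]
    refine ⟨⟨fun x ↦ f₂ x - f₁ x - (f₂ p₀ - f₁ p₀), (hf₂.sub hf₁).sub contMDiff_const⟩,
      ⟨fun x hx ↦ sub_eq_zero.2 (hconst x hx), Ψ, hΨ, ?_, hΨg⟩, ?_⟩
    · refine (Randers.differsBy_iff hf₁ hf₂ (ContMDiffMap.contMDiff _) hd₁ hd₂).2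
        ⟨f₂ p₀ - f₁ p₀, fun x ↦ ?_⟩
      change f₂ x = f₁ x + (f₂ x - f₁ x - (f₂ p₀ - f₁ p₀)) + (f₂ p₀ - f₁ p₀)
      ring
    · rintro φ ⟨hφ, -, -, hφ', -⟩
      obtain ⟨c, hc⟩ := (Randers.differsBy_iff hf₁ hf₂ φ.contMDiff hd₁ hd₂).1 hφ'
      ext x
      change φ x = f₂ x - f₁ x - (f₂ p₀ - f₁ p₀)
      linarith [hc x, hc p₀, hφ p₀ hp₀]
  tfae_have 2 → 3 := by
    rintro ⟨φ, ⟨hφ, Ψ, hΨ, hφ', hΨg⟩, -⟩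
    obtain ⟨c, hc⟩ := (Randers.differsBy_iff hf₁ hf₂ φ.contMDiff hd₁ hd₂).1 hφ'
    -- The constant `c` is the value of `f₂ - f₁` on the boundary, where `Ψ` is the identity, so it
    -- also normalises the new function.
    refine ⟨⟨fun x ↦ f₂ x - f₁ (Ψ x) - c, (hf₂.sub (hf₁.comp Ψ.contMDiff)).sub contMDiff_const⟩,
      ⟨fun x hx ↦ ?_, Ψ, hΨ, ?_, hΨg⟩, ?_⟩
    · change f₂ x - f₁ (Ψ x) - c = 0
      rw [hΨ x hx]
      linarith [hc x, hφ x hx]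
    · refine (Randers.pullbackDiffersBy_iff hf₁ hf₂ (ContMDiffMap.contMDiff _) hd₁ hd₂).2
        ⟨c, fun x ↦ ?_⟩
      change f₂ x = f₁ (Ψ x) + (f₂ x - f₁ (Ψ x) - c) + c
      ring
    · rintro φ' ⟨hφ₀, Ψ', hΨ', hd', hΨg'⟩
      obtain ⟨c', hc'⟩ := (Randers.pullbackDiffersBy_iff hf₁ hf₂ φ'.contMDiff hd₁ hd₂).1 hd'
      -- The competitor comes with its own diffeomorphism, on which its potential depends; rigidity
      -- of isometries makes the two agree.
      have hΨΨ := hΨg.eq hM hΨg' hΨ hΨ'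
      ext x
      change φ' x = f₂ x - f₁ (Ψ x) - c
      have h1 := hc' x
      have h2 := hc' p₀
      rw [hΨ' p₀ hp₀] at h2
      rw [← hΨΨ x] at h1
      linarith [hc p₀, hφ p₀ hp₀, hφ₀ p₀ hp₀]
  tfae_have 3 → 1 := by
    rintro ⟨φ, ⟨hφ, Ψ, hΨ, hφ', hΨg⟩, -⟩ p q
    obtain ⟨c, hc⟩ := (Randers.pullbackDiffersBy_iff hf₁ hf₂ φ.contMDiff hd₁ hd₂).1 hφ'
    have hp := hc p
    have hq := hc q
    rw [hΨ p p.2, hφ p p.2] at hp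
    rw [hΨ q q.2, hφ q q.2] at hq
    rw [hb₁, hb₂, Randers.boundaryDist_eq_of_isPullbackMetric hΨg hΨ hg₁ hg₂]
    linarith
  tfae_finish
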